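/- Let $\beta>0$, $\mathbb T=\mathbb R/2\pi\mathbb Z$, $\Omega=\mathbb T^2\times(-1,1)$, $\Gamma=\mathbb T^2\times\{\pm1\}$ with outward normal $\nu=(0,0,\pm1)$, and let $\mathbb D\mathbf u=\frac12(\nabla\mathbf u+\nabla^\top\mathbf u)$. Consider the Stokes eigenvalue problem $$-\Delta\mathbf u+\nabla q=\lambda\mathbf u,\quad \nabla\cdot\mathbf u=0\ \text{ in }\Omega,\qquad \mathbf u\cdot\nu=0,\quad 2(\mathbb D\mathbf u\,\nu)\cdot\tau+\beta\,\mathbf u\cdot\tau=0\ \text{ on }\Gamma\ \text{ for every tangent vector }\tau .\tag{S}$$ Let $H_{\mathcal P}=\{\mathbf v\in L^2(\Omega;\mathbb R^3):\nabla\cdot\mathbf v=0,\ \mathbf v\cdot\nu=0\text{ on }\Gamma\}$ (in the weak sense) and $V_{\mathcal P}=H^1(\Omega)\cap H_{\mathcal P}$. An eigenfunction with eigenvalue $\lambda\in\mathbb R$ is a nonzero $\mathbf u\in V_{\mathcal P}$ with $$2(\mathbb D\mathbf u,\mathbb D\boldsymbol\varphi)+\beta\int_\Gamma\mathbf u_\tau\cdot\boldsymbol\varphi_\tau=\lambda(\mathbf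 u,\boldsymbol\varphi)\qquad\forall\,\boldsymbol\varphi\in V_{\mathcal P},$$ where $\mathbf u_\tau$ is the tangential trace; a pressure for it is a $q\in L^2(\Omega)$ with $-\Delta\mathbf u+\nabla q=\lambda\mathbf u$ in the sense of distributions. For $m,n\in\mathbb N=\{0,1,2,\dots\}$ put $\mu=\sqrt{m^2+n^2}$ and, for $a,b,c,d\in\mathbb R$, $$\begin{aligned} \mathcal P^u_{m,n}(x,y)&=a\cos(mx)\sin(ny)-b\sin(mx)\sin(ny)-c\sin(mx)\cos(ny)+d\cos(mx)\cos(ny),\\ \mathcal P^v_{m,n}(x,y)&=a\sin(mx)\cos(ny)+b\cos(mx)\cos(ny)-c\cos(mx)\sin(ny)-d\sin(mx)\sin(ny),\\ \mathcal P_{m,n}(x,y)&=a\sin(mx)\sin(ny)+b\cos(mx)\sin(ny)+c\cos(mx)\cos(ny)+d\sin(mx)\cos(ny). \end{aligned}$$ **Theorem.** For all $m,n\in\mathbb N$ there is a positive, strictly increasing, diverging sequence $(\lambda_{m,n,p})_{p\in\mathbb N}$, and, if $\mu>0$, a second such sequence $(\Lambda_{m,n,p})_{p\in\mathbb N}$,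 with the following properties. (i) $\lambda=\lambda_{m,n,p}\in\big(\mu^2+\frac{\pi^2}4p^2,\ \mu^2+\frac{\pi^2}4(1+p)^2\big)$ and $$\cot\sqrt{\lambda-\mu^2}=\frac{\sqrt{\lambda-\mu^2}}\beta\ \text{ if }p\text{ is even},\qquad \tan\sqrt{\lambda-\mu^2}=-\frac{\sqrt{\lambda-\mu^2}}\beta\ \text{ if }p\text{ is odd}.$$ (ii) If $\mu>0$, $\Lambda=\Lambda_{m,n,p}\in\big(\mu^2+\frac{\pi^2}4(1+p)^2,\ \mu^2+\frac{\pi^2}4(2+p)^2\big)$ and $$\sqrt{\Lambda-\mu^2}\,\tan\sqrt{\Lambda-\mu^2}=-\frac\Lambda\beta-\mu\tanh\mu\ \text{ if }p\text{ is even},\qquad \sqrt{\Lambda-\mu^2}\,\cot\sqrt{\Lambda-\mu^2}=\frac\Lambda\beta+\mu\coth\mu\ \text{ if }p\text{ is odd}.$$ (iii) For each $\lambda_{m,n,p}$, and for each $\Lambda_{m,n,p}$ with $\mu>0$, there are smooth functions $\mathcal U,\mathcal V,\mathcal W$ of $z$ (depending on $m,n,p$ and on the class) such that all the fields $$\big(\mathcal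 U(z)\,\mathcal P^u_{m,n}(x,y),\ \mathcal V(z)\,\mathcal P^v_{m,n}(x,y),\ \mathcal W(z)\,\mathcal P_{m,n}(x,y)\big),\qquad a,b,c,d\in\mathbb R,\tag{E}$$ some of which are nonzero, have the following property: those of the first class are smooth pointwise solutions of (S) with $\lambda=\lambda_{m,n,p}$ and constant pressure; those of the second class that are not zero are smooth pointwise solutions of (S) with $\lambda=\Lambda_{m,n,p}$ and a smooth pressure $q$ with $\nabla q\not\equiv0$. (iv) There are no others: for every $\ell\in\mathbb R$, the eigenfunctions with eigenvalue $\ell$ are exactly the nonzero finite linear combinations of the fields (E), of both classes, whose value ($\lambda_{m,n,p}$ or $\Lambda_{m,n,p}$) is $\ell$; those that have a pressure with $\nabla q\equiv0$ are exactly the nonzero finite linear combinations of the fields (E) of the first class with $\lambda_{m,n,p}=\ell$; and there is an eigenfunction with eigenvalue $\ell$ and a pressure with $\nabla q\not\equiv0$ if and only if $\ell=\Lambda_{m,n,p}$ for some $m,n,p$ with $\mu>0$. (v) The fields (E) of both classes with exactly one of $a,b,c,d$ equal to $1$ and the others $0$, those that vanish being omitted, are pairwise orthogonal and, once normalized in $L^2(\Omega)$,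 form a Hilbert basis of $H_{\mathcal P}$. -/

import Mathlib

open MeasureTheory Set Filter Topology
open scoped ContDiff

noncomputable section

namespace Stokes

/-! ## The domain `𝕋² × (-1,1)`, `𝕋 = ℝ / 2πℤ`

Functions on the domain are functions of `(x, y, z)` that are `2π`-periodic in `x` and `y`.
Integrals over the domain are integrals over one period cell, and an `L²` function on the domain
is an `L²` function on that cell. -/

/-- Points `(x, y, z)`. -/
abbrev Pt : Type := ℝ × ℝ × ℝ

/-- Values of velocity fields, with the Euclidean norm. -/
abbrev Vec : Type := EuclideanSpace ℝ (Fin 3)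

/-- One period cell of `𝕋² × (-1,1)`. -/
def cell : Set Pt := Ioo 0 (2 * Real.pi) ×ˢ Ioo 0 (2 * Real.pi) ×ˢ Ioo (-1) 1

/-- Lebesgue measure on `𝕋² × (-1,1)`. -/
def vol : Measure Pt := volume.restrict cell

/-- Surface measure on each of the two components `𝕋² × {1}`, `𝕋² × {-1}` of the boundary. -/
def area : Measure (ℝ × ℝ) :=
  volume.restrict (Ioo 0 (2 * Real.pi) ×ˢ Ioo 0 (2 * Real.pi))

/-- The Hilbert space of square integrable vector fields on `𝕋² × (-1,1)`. -/
abbrev L2 : Type := Lp Vec 2 vol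

/-- The partial derivative `∂ᵢ f`, `i = 0, 1, 2` standing for `x, y, z`. -/
def pd (i : Fin 3) (f : Pt → ℝ) (P : Pt) : ℝ :=
  fderiv ℝ f P (![((1 : ℝ), (0 : ℝ), (0 : ℝ)), (0, 1, 0), (0, 0, 1)] i)

/-- The Laplacian. -/
def lap (f : Pt → ℝ) (P : Pt) : ℝ := ∑ i, pd i (pd i f) P

/-- `2π`-periodicity in `x` and in `y`. -/
def IsPeriodic {α : Type*} (f : Pt → α) : Prop :=
  ∀ x y z : ℝ, f (x + 2 * Real.pi, y, z) = f (x, y, z) ∧ f (x, y + 2 * Real.pi, z) = f (x, y, z)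

/-- Smooth functions on the closed domain `𝕋² × [-1,1]` (restrictions of smooth functions). -/
def IsSmooth (φ : Pt → ℝ) : Prop := ContDiff ℝ ∞ φ ∧ IsPeriodic φ

/-- Test functions: smooth with compact support in `𝕋² × (-1,1)`. -/
def IsTest (φ : Pt → ℝ) : Prop :=
  IsSmooth φ ∧ ∃ r < 1, ∀ x y z : ℝ, r ≤ |z| → φ (x, y, z) = 0

/-! ## Facts needed to form the `L²` objects -/

instance : IsFiniteMeasure vol := by
  refine ⟨?_⟩
  have h : cell ⊆ Icc 0 (2 * Real.pi) ×ˢ Icc 0 (2 * Real.pi) ×ˢ Icc (-1) 1 :=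
    prod_mono Ioo_subset_Icc_self (prod_mono Ioo_subset_Icc_self Ioo_subset_Icc_self)
  rw [vol, Measure.restrict_apply_univ]
  exact lt_of_le_of_lt (measure_mono h)
    (isCompact_Icc.prod (isCompact_Icc.prod isCompact_Icc)).measure_lt_top

theorem memLp_of_continuous {F : Type*} [NormedAddCommGroup F] [SecondCountableTopology F]
    {f : Pt → F} (hf : Continuous f) : MemLp f 2 vol := by
  have hK : IsCompact (Icc (0 : ℝ) (2 * Real.pi) ×ˢ Icc (0 : ℝ) (2 * Real.pi) ×ˢ
      Icc (-1 : ℝ) 1) := isCompact_Icc.prod (isCompact_Icc.prod isCompact_Icc)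
  obtain ⟨C, hC⟩ := hK.exists_bound_of_continuousOn hf.continuousOn
  have h : cell ⊆ Icc 0 (2 * Real.pi) ×ˢ Icc 0 (2 * Real.pi) ×ˢ Icc (-1) 1 :=
    prod_mono Ioo_subset_Icc_self (prod_mono Ioo_subset_Icc_self Ioo_subset_Icc_self)
  have hm : MeasurableSet cell :=
    measurableSet_Ioo.prod (measurableSet_Ioo.prod measurableSet_Ioo)
  refine MemLp.of_bound hf.aestronglyMeasurable C ?_
  exact (ae_restrict_iff' hm).2 (Eventually.of_forall fun P hP => hC P (h hP))

theorem continuous_pd {φ : Pt → ℝ} (hφ : ContDiff ℝ ∞ φ) (i : Fin 3) :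
    Continuous (pd i φ) :=
  (hφ.continuous_fderiv (by simp)).clm_apply continuous_const

theorem integrable_comp_mul_pd (v : L2) {φ : Pt → ℝ} (hφ : ContDiff ℝ ∞ φ) (i : Fin 3) :
    Integrable (fun P => v P i * pd i φ P) vol :=
  MemLp.integrable_mul ((Lp.memLp v).eval_piLp i) (memLp_of_continuous (continuous_pd hφ i))

/-! ## Function spaces -/

/-- The space `H_𝒫` of square integrable fields `v` with `∇ · v = 0` in the sense of
distributions and `v · ν = 0` on `Γ = 𝕋² × {±1}`.  The normal trace of a divergence free field
`v ∈ L²` is the functional `φ ↦ ∫ v · ∇φ`, `φ` smooth on the closed domain; its vanishing for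
`φ` of compact support is `∇ · v = 0`. -/
def HP : Submodule ℝ L2 where
  carrier := {v | ∀ φ : Pt → ℝ, IsSmooth φ → ∫ P, ∑ i, v P i * pd i φ P ∂vol = 0}
  zero_mem' := by
    intro φ hφ
    rw [integral_eq_zero_of_ae]
    filter_upwards [Lp.coeFn_zero Vec 2 vol] with P hP
    simp only [hP, Pi.zero_apply, PiLp.zero_apply, zero_mul, Finset.sum_const_zero]
  add_mem' := by
    intro v w hv hw φ hφ
    have h1 : ∫ P, ∑ i, (v + w : L2) P i * pd i φ P ∂vol =
        ∫ P, (∑ i, v P i * pd i φ P + ∑ i, w P i * pd i φ P) ∂vol := by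
      refine integral_congr_ae ?_
      filter_upwards [Lp.coeFn_add v w] with P hP
      simp only [hP, Pi.add_apply, PiLp.add_apply, add_mul, Finset.sum_add_distrib]
    rw [h1, integral_add, hv φ hφ, hw φ hφ, add_zero]
    · exact integrable_finsetSum _ fun i _ => integrable_comp_mul_pd v hφ.1 i
    · exact integrable_finsetSum _ fun i _ => integrable_comp_mul_pd w hφ.1 i
  smul_mem' := by
    intro r v hv φ hφ
    have h1 : ∫ P, ∑ i, (r • v : L2) P i * pd i φ P ∂vol =
        ∫ P, r * ∑ i, v P i * pd i φ P ∂vol := by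
      refine integral_congr_ae ?_
      filter_upwards [Lp.coeFn_smul r v] with P hP
      simp only [hP, Pi.smul_apply, PiLp.smul_apply, smul_eq_mul, Finset.mul_sum, mul_assoc]
    rw [h1, integral_const_mul, hv φ hφ, mul_zero]

/-- `g` is the weak partial derivative `∂ᵢ f` in `𝕋² × (-1,1)`. -/
def HasWeakPartial (i : Fin 3) (f g : Pt → ℝ) : Prop :=
  ∀ φ, IsTest φ → ∫ P, f P * pd i φ P ∂vol = - ∫ P, g P * φ P ∂vol

/-- The scalar function `f` belongs to `H¹(𝕋² × (-1,1))`, its weak gradient is `G`, and its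
traces on `𝕋² × {1}` and `𝕋² × {-1}` are `top` and `bot`. -/
structure IsH1 (f : Pt → ℝ) (G : Fin 3 → Pt → ℝ) (top bot : ℝ × ℝ → ℝ) : Prop where
  memLp : MemLp f 2 vol
  memLp_grad : ∀ i, MemLp (G i) 2 vol
  weak_grad : ∀ i, HasWeakPartial i f (G i)
  memLp_top : MemLp top 2 area
  memLp_bot : MemLp bot 2 area
  green : ∀ φ, IsSmooth φ →
    ∫ P, (f P * pd 2 φ P + G 2 P * φ P) ∂vol =
      ∫ s, top s * φ (s.1, s.2, 1) ∂area - ∫ s, bot s * φ (s.1, s.2, -1) ∂area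

/-- The field `v` belongs to `V_𝒫 = H¹ ∩ H_𝒫`, with `G i j = ∂ⱼ vᵢ`, and with traces `top i`,
`bot i` of `vᵢ` on the two components of `Γ`. -/
structure IsVP (v : L2) (G : Fin 3 → Fin 3 → Pt → ℝ) (top bot : Fin 3 → ℝ × ℝ → ℝ) : Prop where
  mem : v ∈ HP
  h1 : ∀ i, IsH1 (fun P => v P i) (G i) (top i) (bot i)

/-! ## The Stokes eigenvalue problem with Navier slip-with-friction conditions -/

/-- The integrand `𝔻u : 𝔻φ`, where `𝔻` is the symmetric part of the gradient. -/
def strainDot (G H : Fin 3 → Fin 3 → Pt → ℝ) (P : Pt) : ℝ :=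
  ∑ i, ∑ j, ((G i j P + G j i P) / 2) * ((H i j P + H j i P) / 2)

/-- The integrand `u_τ · φ_τ` on one component of `Γ` (tangential components are `0, 1`). -/
def tangDot (s t : Fin 3 → ℝ × ℝ → ℝ) (Q : ℝ × ℝ) : ℝ := s 0 Q * t 0 Q + s 1 Q * t 1 Q

/-- `u` is an eigenfunction, with eigenvalue `ℓ`: a nonzero `u ∈ V_𝒫` such that
`2 (𝔻u, 𝔻φ) + β ∫_Γ u_τ · φ_τ = ℓ (u, φ)` for every `φ ∈ V_𝒫`. -/
def IsEigenfunction (β ℓ : ℝ) (u : L2) : Prop :=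
  u ≠ 0 ∧ ∃ G top bot, IsVP u G top bot ∧
    ∀ φ H ftop fbot, IsVP φ H ftop fbot →
      2 * ∫ P, strainDot G H P ∂vol
        + β * (∫ Q, tangDot top ftop Q ∂area + ∫ Q, tangDot bot fbot Q ∂area)
      = ℓ * inner ℝ u φ

/-- `q ∈ L²` is a pressure for `u`: `-Δu + ∇q = ℓ u` in the sense of distributions. -/
def IsPressure (ℓ : ℝ) (u : L2) (q : Pt → ℝ) : Prop :=
  MemLp q 2 vol ∧ ∀ (i : Fin 3) (φ : Pt → ℝ), IsTest φ →
    ∫ P, (-(u P i * lap φ P) - q P * pd i φ P) ∂vol = ℓ * ∫ P, u P i * φ P ∂vol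

/-- `∇q ≡ 0` in the sense of distributions. -/
def GradZero (q : Pt → ℝ) : Prop := ∀ i : Fin 3, HasWeakPartial i q (fun _ => 0)

/-- `(u, q)` is a smooth pointwise solution of
`-Δu + ∇q = ℓ u`, `∇ · u = 0` in `𝕋² × (-1,1)`, and
`u · ν = 0`, `2 (𝔻u ν) · τ + β u · τ = 0` on `𝕋² × {±1}`, where `ν = (0, 0, s)` on `z = s`
for `s = ±1` and `τ` runs over the unit vectors of the `x` and `y` axes. -/
structure IsClassicalSolution (β ℓ : ℝ) (u : Pt → Vec) (q : Pt → ℝ) : Prop where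
  smooth_u : ∀ i, IsSmooth (fun P => u P i)
  smooth_q : IsSmooth q
  momentum : ∀ x y z : ℝ, z ∈ Ioo (-1 : ℝ) 1 → ∀ i : Fin 3,
    - lap (fun P => u P i) (x, y, z) + pd i q (x, y, z) = ℓ * u (x, y, z) i
  div_zero : ∀ x y z : ℝ, z ∈ Ioo (-1 : ℝ) 1 →
    ∑ i : Fin 3, pd i (fun P => u P i) (x, y, z) = 0
  normal : ∀ x y s : ℝ, s = 1 ∨ s = -1 → u (x, y, s) 2 = 0
  slip : ∀ x y s : ℝ, s = 1 ∨ s = -1 → ∀ j : Fin 3, j = 0 ∨ j = 1 →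
    2 * ((pd 2 (fun P => u P j) (x, y, s) + pd j (fun P => u P 2) (x, y, s)) / 2 * s)
      + β * u (x, y, s) j = 0

/-! ## Separated fields -/

/-- `μ = √(m² + n²)`. -/
def mu (m n : ℕ) : ℝ := Real.sqrt ((m : ℝ) ^ 2 + (n : ℝ) ^ 2)

/-- The function `𝒫ᵘ`, with parameters `(a, b, c, d) = (κ 0, κ 1, κ 2, κ 3)`. -/
def perU (m n : ℕ) (κ : Fin 4 → ℝ) (x y : ℝ) : ℝ :=
  κ 0 * Real.cos (m * x) * Real.sin (n * y) - κ 1 * Real.sin (m * x) * Real.sin (n * y)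
    - κ 2 * Real.sin (m * x) * Real.cos (n * y) + κ 3 * Real.cos (m * x) * Real.cos (n * y)

/-- The function `𝒫ᵛ`. -/
def perV (m n : ℕ) (κ : Fin 4 → ℝ) (x y : ℝ) : ℝ :=
  κ 0 * Real.sin (m * x) * Real.cos (n * y) + κ 1 * Real.cos (m * x) * Real.cos (n * y)
    - κ 2 * Real.cos (m * x) * Real.sin (n * y) - κ 3 * Real.sin (m * x) * Real.sin (n * y)

/-- The function `𝒫`. -/
def perW (m n : ℕ) (κ : Fin 4 → ℝ) (x y : ℝ) : ℝ :=
  κ 0 * Real.sin (m * x) * Real.sin (n * y) + κ 1 * Real.cos (m * x) * Real.sin (n * y)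
    + κ 2 * Real.cos (m * x) * Real.cos (n * y) + κ 3 * Real.sin (m * x) * Real.cos (n * y)

/-- A triple `(𝒰, 𝒱, 𝒲)` of smooth functions of `z`. -/
structure Profile where
  U : ℝ → ℝ
  V : ℝ → ℝ
  W : ℝ → ℝ
  smooth_U : ContDiff ℝ ∞ U
  smooth_V : ContDiff ℝ ∞ V
  smooth_W : ContDiff ℝ ∞ W

/-- The field `(𝒰(z) 𝒫ᵘ(x,y), 𝒱(z) 𝒫ᵛ(x,y), 𝒲(z) 𝒫(x,y))`. -/
def Profile.field (Z : Profile) (m n : ℕ) (κ : Fin 4 → ℝ) (P : Pt) : Vec :=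
  !₂[Z.U P.2.2 * perU m n κ P.1 P.2.1, Z.V P.2.2 * perV m n κ P.1 P.2.1,
    Z.W P.2.2 * perW m n κ P.1 P.2.1]

theorem Profile.continuous_field (Z : Profile) (m n : ℕ) (κ : Fin 4 → ℝ) :
    Continuous (Z.field m n κ) := by
  have hU := Z.smooth_U.continuous
  have hV := Z.smooth_V.continuous
  have hW := Z.smooth_W.continuous
  have h1 : Continuous fun P : Pt => perU m n κ P.1 P.2.1 := by
    unfold perU
    fun_prop
  have h2 : Continuous fun P : Pt => perV m n κ P.1 P.2.1 := by
    unfold perV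
    fun_prop
  have h3 : Continuous fun P : Pt => perW m n κ P.1 P.2.1 := by
    unfold perW
    fun_prop
  have hz : Continuous fun P : Pt => P.2.2 := by fun_prop
  refine (PiLp.continuous_toLp 2 _).comp (continuous_pi fun i => ?_)
  fin_cases i
  · exact (hU.comp hz).mul h1
  · exact (hV.comp hz).mul h2
  · exact (hW.comp hz).mul h3

/-- The separated field as an element of `L²`. -/
def Profile.toL2 (Z : Profile) (m n : ℕ) (κ : Fin 4 → ℝ) : L2 :=
  (memLp_of_continuous (Z.continuous_field m n κ)).toLp (Z.field m n κ)

/-- The separated fields of the first class (profiles `Z m n p`, values `lam m n p`)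
whose value is `ℓ`. -/
def fieldsConst (lam : ℕ → ℕ → ℕ → ℝ) (Z : ℕ → ℕ → ℕ → Profile) (ℓ : ℝ) : Set L2 :=
  {v | ∃ m n p κ, lam m n p = ℓ ∧ v = (Z m n p).toL2 m n κ}

/-- The separated fields of the second class (profiles `Y m n p`, values `Lam m n p`, `μ > 0`)
whose value is `ℓ`. -/
def fieldsNonconst (Lam : ℕ → ℕ → ℕ → ℝ) (Y : ℕ → ℕ → ℕ → Profile) (ℓ : ℝ) : Set L2 :=
  {v | ∃ m n p κ, 0 < mu m n ∧ Lam m n p = ℓ ∧ v = (Y m n p).toL2 m n κ}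

/-- The family of all separated fields in which exactly one of the parameters `a, b, c, d` is `1`
and the others are `0`: those of the first class (`inl`) and those of the second class (`inr`),
the latter for `μ > 0` only. -/
def family (Z Y : ℕ → ℕ → ℕ → Profile) :
    (ℕ × ℕ × ℕ × Fin 4) ⊕ {k : ℕ × ℕ × ℕ × Fin 4 // 0 < mu k.1 k.2.1} → L2
  | .inl (m, n, p, j) => (Z m n p).toL2 m n (Pi.single j 1)
  | .inr ⟨(m, n, p, j), _⟩ => (Y m n p).toL2 m n (Pi.single j 1)

end Stokes

end

/-!
Fourier expansion in the horizontal variables turns the Stokes problem into ordinary differential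
equations in `z`. For a wave vector `(m, n)` with `μ > 0`, a solenoidal field has two independent
vertical profiles. The horizontal component orthogonal to the wave vector satisfies `-f'' = k² f`
with Robin conditions `f' = ∓β f` at `z = ±1` (first class, no pressure). The vertical component
`W` satisfies `(d²/dz² + k²)(d²/dz² - μ²) W = 0`, `W = 0` and `W'' = ∓β W'` at `z = ±1` (second
class); its pressure is `r(z) 𝒫(x, y)` with `r'' = μ² r` and `r' ≠ 0` for `z ≠ 0`. For `μ = 0` only
the Robin problem is left, for both horizontal components. Solutions are even or odd in `z`, which
gives explicit characteristic equations, and the intermediate value theorem gives a root `k` in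
each interval between consecutive multiples of `π / 2` (`exists_robin_frequency`,
`exists_stokes_frequency`). That the resulting fields solve the problem pointwise is a computation
(`isClassicalSolution_constProfile`, `isClassicalSolution_nonconstProfile`), and Green's formula
makes them weak solutions (`IsClassicalSolution.weak`), hence orthogonal to eigenfunctions with any
other eigenvalue (`IsEigenfunction.inner_eq_zero`).

The core is completeness: a field in `H_𝒫` orthogonal to all separated fields is zero
(`eq_zero_of_orthogonal`). It needs no spectral theorem for compact operators. Subtract from a
smooth profile its projections on the first `n + 1` eigenprofiles. If the Rayleigh quotient of the
remainder were smaller than a number `K_n` that separates these eigenvalues from the others, so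
would be that of all nonzero vectors of an `(n + 2)`-dimensional space; but this space contains a
function vanishing at `n + 1` given points, for which Poincaré inequalities on the pieces forbid it
(`rayleigh_bound_of_orthogonal`, `poincare_free`, `poincare_zeros`). Hence the remainders tend to
zero, and a bounded functional vanishing on all eigenprofiles vanishes
(`eq_zero_of_vanish_on_eigenvectors`, `eq_zero_of_robin`, `eq_zero_of_stokes`). The functionals in
question are the Fourier coefficients of the given `L²` field, tied together by the divergence
condition (`coef_div`); a field whose coefficients all vanish is zero (`eq_zero_of_coef`).

Since each eigenvalue occurs for finitely many indices only, an eigenfunction is the finite sum of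
its projections on the separated fields with the same eigenvalue (`IsEigenfunction.mem_span`). If
it has a pressure with vanishing gradient, its vertical Fourier coefficients, which are multiples
of those of a field of the second class, are incompatible with the pressure of that field unless
the multiple is zero (`IsEigenfunction.inner_nonconstProfile_eq_zero`); so only the first class
contributes.
-/

noncomputable section

namespace Stokes

/-! ### Completeness from a min-max count -/

/-- Dimension count.  A vector `r` that is `N`-orthogonal to `n + 1` eigenvectors with eigenvalues
below `K` has Rayleigh quotient at least `K`, as soon as `n + 1` linear constraints force the
Rayleigh quotient to be at least `K`: otherwise the span of `r` and the eigenvectors would contain a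
nonzero vector that satisfies the constraints and has Rayleigh quotient below `K`. -/
theorem rayleigh_bound_of_orthogonal {E : Type*} [AddCommGroup E] [Module ℝ E]
    (N a : E →ₗ[ℝ] E →ₗ[ℝ] ℝ) (hNs : ∀ x y, N x y = N y x) (has : ∀ x y, a x y = a y x)
    {n : ℕ} (e : Fin (n + 1) → E) (lam : Fin (n + 1) → ℝ) (K : ℝ)
    (heig : ∀ i x, a (e i) x = lam i * N (e i) x)
    (horth : ∀ i j, i ≠ j → N (e i) (e j) = 0) (hpos : ∀ i, 0 < N (e i) (e i))
    (hlt : ∀ i, lam i < K) (l : Fin (n + 1) → E →ₗ[ℝ] ℝ)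
    (hl : ∀ w, (∀ i, l i w = 0) → K * N w w ≤ a w w)
    (r : E) (hr : ∀ i, N (e i) r = 0) : K * N r r ≤ a r r := by
  let S : (Fin (n + 1) → ℝ) × ℝ →ₗ[ℝ] E :=
    (Fintype.linearCombination ℝ e).coprod (LinearMap.toSpanSingleton ℝ E r)
  let M : (Fin (n + 1) → ℝ) × ℝ →ₗ[ℝ] (Fin (n + 1) → ℝ) := (LinearMap.pi l).comp S
  have hker : LinearMap.ker M ≠ ⊥ := LinearMap.ker_ne_bot_of_finrank_lt (by simp)
  obtain ⟨⟨c, t⟩, hmem, hne⟩ := (Submodule.ne_bot_iff _).1 hker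
  set s : E := ∑ i, c i • e i with hs
  have hS : S (c, t) = s + t • r := by
    simp [S, hs, Fintype.linearCombination_apply]
  have hw : ∀ i, l i (s + t • r) = 0 := by
    intro i
    have := congrFun (LinearMap.mem_ker.1 hmem) i
    rw [← hS]
    simpa [M] using this
  have key := hl _ hw
  have hsr : N s r = 0 := by simp [hs, hr]
  have asr : a s r = 0 := by simp [hs, hr, heig]
  have hNe : ∀ i, N (e i) s = c i * N (e i) (e i) := by
    intro i
    rw [hs, map_sum, Finset.sum_eq_single i]
    · simp
    · intro j _ hj
      simp [horth i j (Ne.symm hj)]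
    · simp
  have hsx : ∀ (B : E →ₗ[ℝ] E →ₗ[ℝ] ℝ) (y : E), B s y = ∑ i, c i * B (e i) y := by
    intro B y
    rw [hs]
    simp
  have hss : N s s = ∑ i, c i ^ 2 * N (e i) (e i) := by
    rw [hsx N]
    refine Finset.sum_congr rfl fun i _ => ?_
    rw [hNe]
    ring
  have ass : a s s = ∑ i, lam i * (c i ^ 2 * N (e i) (e i)) := by
    rw [hsx a]
    refine Finset.sum_congr rfl fun i _ => ?_
    rw [heig, hNe]
    ring
  have hNw : N (s + t • r) (s + t • r) = N s s + t ^ 2 * N r r := by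
    simp only [map_add, map_smul, LinearMap.add_apply, LinearMap.smul_apply, smul_eq_mul, hsr,
      hNs r s]
    ring
  have haw : a (s + t • r) (s + t • r) = a s s + t ^ 2 * a r r := by
    simp only [map_add, map_smul, LinearMap.add_apply, LinearMap.smul_apply, smul_eq_mul, asr,
      has r s]
    ring
  have hgap : t ^ 2 * (a r r - K * N r r) ≥ ∑ i, (K - lam i) * (c i ^ 2 * N (e i) (e i)) := by
    have : ∑ i, (K - lam i) * (c i ^ 2 * N (e i) (e i)) = K * N s s - a s s := by
      rw [hss, ass, Finset.mul_sum, ← Finset.sum_sub_distrib]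
      exact Finset.sum_congr rfl fun i _ => by ring
    rw [this]
    rw [hNw, haw] at key
    linarith
  have hterm : ∀ i ∈ Finset.univ, 0 ≤ (K - lam i) * (c i ^ 2 * N (e i) (e i)) := fun i _ =>
    mul_nonneg (sub_nonneg.2 (hlt i).le) (mul_nonneg (sq_nonneg _) (hpos i).le)
  by_cases ht : t = 0
  · exfalso
    have hz : ∑ i, (K - lam i) * (c i ^ 2 * N (e i) (e i)) = 0 := by
      refine le_antisymm ?_ (Finset.sum_nonneg hterm)
      simpa [ht] using hgap
    have hc : c = 0 := by
      funext i
      have h0 := (Finset.sum_eq_zero_iff_of_nonneg hterm).1 hz i (Finset.mem_univ i)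
      have h1 : K - lam i ≠ 0 := (sub_pos.2 (hlt i)).ne'
      have h2 := (hpos i).ne'
      simpa [h1, h2] using h0
    exact hne (by simp [hc, ht])
  · have h0 := (Finset.sum_nonneg hterm).trans hgap
    have := nonneg_of_mul_nonneg_right h0 (by positivity)
    linarith

/-- Completeness in functional form: a functional that is bounded with respect to `N` and vanishes
on all eigenvectors `e i` is zero, provided that the `n`-th eigenvalue lies below a threshold `K n`
that `n + 1` linear constraints enforce on the Rayleigh quotient, with `K n → ∞`. -/
theorem eq_zero_of_vanish_on_eigenvectors {E : Type*} [AddCommGroup E] [Module ℝ E]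
    (N a : E →ₗ[ℝ] E →ₗ[ℝ] ℝ) (hNs : ∀ x y, N x y = N y x) (has : ∀ x y, a x y = a y x)
    (ha0 : ∀ x, 0 ≤ a x x)
    (e : ℕ → E) (lam K : ℕ → ℝ) (hmono : StrictMono lam) (hlam : ∀ i, 0 ≤ lam i)
    (hlt : ∀ i, lam i < K i) (hK : Tendsto K atTop atTop)
    (heig : ∀ i x, a (e i) x = lam i * N (e i) x) (hpos : ∀ i, 0 < N (e i) (e i))
    (l : (n : ℕ) → Fin (n + 1) → E →ₗ[ℝ] ℝ)
    (hl : ∀ n w, (∀ i, l n i w = 0) → K n * N w w ≤ a w w)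
    (A : E →ₗ[ℝ] ℝ) (C : ℝ) (hA : ∀ x, A x ^ 2 ≤ C * N x x) (hC : 0 ≤ C)
    (hAe : ∀ i, A (e i) = 0) (x : E) : A x = 0 := by
  have horth : ∀ i j, i ≠ j → N (e i) (e j) = 0 := by
    intro i j hij
    have h1 := heig i (e j)
    rw [has, heig, hNs] at h1
    have h2 : (lam j - lam i) * N (e i) (e j) = 0 := by linarith
    exact (mul_eq_zero.1 h2).resolve_left (sub_ne_zero.2 (hmono.injective.ne (Ne.symm hij)))
  have hKpos : ∀ n, 0 < K n := fun n => (hlam n).trans_lt (hlt n)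
  have hbound : ∀ n, A x ^ 2 ≤ C * a x x / K n := by
    intro n
    let c : Fin (n + 1) → ℝ := fun i => N (e i) x / N (e i) (e i)
    set s : E := ∑ i, c i • e i with hs
    have hNes : ∀ i : Fin (n + 1), N (e i) s = N (e i) x := by
      intro i
      rw [hs, map_sum, Finset.sum_eq_single i]
      · have := (hpos i).ne'
        simp only [c, map_smul, smul_eq_mul]
        field_simp
      · intro j _ hj
        rw [map_smul, horth i j (fun h => hj (Fin.ext h.symm)), smul_zero]
      · simp
    have hr : ∀ i : Fin (n + 1), N (e i) (x - s) = 0 := by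
      intro i
      rw [map_sub, hNes, sub_self]
    have h1 := rayleigh_bound_of_orthogonal N a hNs has (fun i : Fin (n + 1) => e i)
      (fun i => lam i) (K n) (fun i x => heig i x)
      (fun i j hij => horth i j (fun h => hij (Fin.ext h))) (fun i => hpos i)
      (fun i => (hmono.monotone (Nat.lt_succ_iff.1 i.2)).trans_lt (hlt n)) (l n) (hl n) (x - s) hr
    have has0 : a s (x - s) = 0 := by
      rw [hs, map_sum, LinearMap.sum_apply]
      refine Finset.sum_eq_zero fun i _ => ?_
      rw [map_smul, LinearMap.smul_apply, heig, ← hs, hr, mul_zero, smul_zero]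
    have h2 : a x x = a s s + a (x - s) (x - s) := by
      have h3 : a (x - s) s = 0 := by rw [has, has0]
      have h4 : a (s + (x - s)) (s + (x - s)) = a s s + a (x - s) (x - s) := by
        rw [map_add, map_add, LinearMap.add_apply, LinearMap.add_apply, has0, h3]
        ring
      simpa using h4
    have hAx : A x = A (x - s) := by
      rw [map_sub, hs, map_sum]
      simp [hAe]
    have h5 : N (x - s) (x - s) ≤ a x x / K n := by
      rw [le_div_iff₀ (hKpos n)]
      linarith [ha0 s]
    calc A x ^ 2 = A (x - s) ^ 2 := by rw [← hAx]
      _ ≤ C * N (x - s) (x - s) := hA _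
      _ ≤ C * (a x x / K n) := mul_le_mul_of_nonneg_left h5 hC
      _ = C * a x x / K n := by ring
  have hlim : Tendsto (fun n => C * a x x / K n) atTop (𝓝 0) := hK.const_div_atTop _
  have h0 : A x ^ 2 ≤ 0 := ge_of_tendsto' hlim hbound
  exact pow_eq_zero_iff two_ne_zero |>.1 (le_antisymm h0 (sq_nonneg _))

/-! ### Poincaré inequalities on intervals -/

/-- Poincaré inequality with the sharp constant, for functions vanishing at the left end. -/
theorem poincare_left {w : ℝ → ℝ} (hw : ContDiff ℝ ∞ w) {a b : ℝ} (hab : a < b) (h0 : w a = 0) :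
    (Real.pi / (2 * (b - a))) ^ 2 * ∫ z in a..b, w z ^ 2 ≤ ∫ z in a..b, deriv w z ^ 2 := by
  have hba : 0 < b - a := sub_pos.2 hab
  have hd : Continuous (deriv w) := hw.continuous_deriv (by simp)
  have hc := hw.continuous
  -- a slightly smaller constant keeps the multiplier `tan (κ (b - z))` regular on `[a, b]`
  have key : ∀ κ ∈ Ioo 0 (Real.pi / (2 * (b - a))),
      κ ^ 2 * ∫ z in a..b, w z ^ 2 ≤ ∫ z in a..b, deriv w z ^ 2 := by
    rintro κ ⟨hκ0, hκ⟩
    have hκ' : κ * (b - a) < Real.pi / 2 := by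
      rw [lt_div_iff₀ (by positivity)] at hκ
      linarith
    have hcos : ∀ z ∈ Icc a b, 0 < Real.cos (κ * (b - z)) := by
      intro z hz
      refine Real.cos_pos_of_mem_Ioo ⟨?_, ?_⟩
      · have : 0 ≤ κ * (b - z) := mul_nonneg hκ0.le (by linarith [hz.2])
        linarith [Real.pi_pos]
      · have : κ * (b - z) ≤ κ * (b - a) := mul_le_mul_of_nonneg_left (by linarith [hz.1]) hκ0.le
        linarith
    set T : ℝ → ℝ := fun z => Real.tan (κ * (b - z)) with hT
    set F' : ℝ → ℝ := fun z =>
      -κ ^ 2 * (1 + T z ^ 2) * w z ^ 2 + κ * T z * (2 * w z * deriv w z) with hF'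
    have hTd : ∀ z ∈ Icc a b, HasDerivAt T (-κ * (1 + T z ^ 2)) z := by
      intro z hz
      have h1 := (Real.hasDerivAt_tan (hcos z hz).ne')
      have h2 : HasDerivAt (fun z => κ * (b - z)) (κ * (0 - 1)) z :=
        ((hasDerivAt_const z b).sub (hasDerivAt_id z)).const_mul κ
      have h3 := h1.comp z h2
      refine h3.congr_deriv ?_
      simp only [hT, Real.tan_eq_sin_div_cos]
      have := (hcos z hz).ne'
      field_simp
      rw [Real.cos_sq_add_sin_sq]
      ring
    have hF : ∀ z ∈ Icc a b, HasDerivAt (fun z => κ * T z * w z ^ 2) (F' z) z := by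
      intro z hz
      have h1 := ((hw.differentiable (by simp)) z).hasDerivAt
      have h2 := ((hTd z hz).const_mul κ).mul (h1.pow 2)
      refine h2.congr_deriv ?_
      simp only [hF', Pi.pow_apply]
      push_cast
      ring
    have hTc : ContinuousOn T (uIcc a b) := by
      rw [uIcc_of_le hab.le]
      exact fun z hz => (hTd z hz).continuousAt.continuousWithinAt
    have hF'i : IntervalIntegrable F' volume a b := by
      refine ContinuousOn.intervalIntegrable ?_
      have h1 := hc.continuousOn (s := uIcc a b)
      have h2 := hd.continuousOn (s := uIcc a b)
      fun_prop
    have hint : ∫ z in a..b, F' z = 0 := by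
      rw [intervalIntegral.integral_eq_sub_of_hasDerivAt (f := fun z => κ * T z * w z ^ 2) ?_ hF'i]
      · simp [hT, h0]
      · rw [uIcc_of_le hab.le]
        exact hF
    have hi1 : IntervalIntegrable (fun z => deriv w z ^ 2) volume a b :=
      (hd.pow 2).intervalIntegrable a b
    have hi2 : IntervalIntegrable (fun z => κ ^ 2 * w z ^ 2) volume a b :=
      ((hc.pow 2).const_mul _).intervalIntegrable a b
    have hnn : 0 ≤ ∫ z in a..b, (deriv w z ^ 2 - κ ^ 2 * w z ^ 2 - F' z) := by
      refine intervalIntegral.integral_nonneg hab.le fun z _ => ?_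
      have : deriv w z ^ 2 - κ ^ 2 * w z ^ 2 - F' z = (deriv w z - κ * T z * w z) ^ 2 := by
        simp only [hF']
        ring
      rw [this]
      exact sq_nonneg _
    rw [intervalIntegral.integral_sub (hi1.sub hi2) hF'i, intervalIntegral.integral_sub hi1 hi2,
      intervalIntegral.integral_const_mul, hint] at hnn
    linarith
  have hpos : 0 < Real.pi / (2 * (b - a)) := by positivity
  refine le_of_tendsto (f := fun κ : ℝ => κ ^ 2 * ∫ z in a..b, w z ^ 2)
    (x := 𝓝[<] (Real.pi / (2 * (b - a)))) ?_ ?_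
  · exact ((continuous_id.pow 2).mul continuous_const).continuousAt.continuousWithinAt
  · filter_upwards [Ioo_mem_nhdsLT hpos] with κ hκ using key κ hκ

theorem poincare_right {w : ℝ → ℝ} (hw : ContDiff ℝ ∞ w) {a b : ℝ} (hab : a < b) (h0 : w b = 0) :
    (Real.pi / (2 * (b - a))) ^ 2 * ∫ z in a..b, w z ^ 2 ≤ ∫ z in a..b, deriv w z ^ 2 := by
  have h := poincare_left (w := fun z => w (-z)) (hw.comp contDiff_neg) (neg_lt_neg hab)
    (by simpa using h0)
  have h1 : ∀ z, deriv (fun z => w (-z)) z = -deriv w (-z) := fun z => deriv_comp_neg w z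
  simp only [h1, neg_sq] at h
  rw [intervalIntegral.integral_comp_neg (fun z => w z ^ 2),
    intervalIntegral.integral_comp_neg (fun z => deriv w z ^ 2)] at h
  simpa [sub_eq_add_neg, add_comm] using h

theorem poincare_join {w : ℝ → ℝ} (hw : ContDiff ℝ ∞ w) {K a b c : ℝ}
    (h1 : K * ∫ z in a..b, w z ^ 2 ≤ ∫ z in a..b, deriv w z ^ 2)
    (h2 : K * ∫ z in b..c, w z ^ 2 ≤ ∫ z in b..c, deriv w z ^ 2) :
    K * ∫ z in a..c, w z ^ 2 ≤ ∫ z in a..c, deriv w z ^ 2 := by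
  have hd : Continuous fun z => deriv w z ^ 2 := (hw.continuous_deriv (by simp)).pow 2
  have hc : Continuous fun z => w z ^ 2 := hw.continuous.pow 2
  rw [← intervalIntegral.integral_add_adjacent_intervals (hc.intervalIntegrable a b)
    (hc.intervalIntegrable b c), ← intervalIntegral.integral_add_adjacent_intervals
    (hd.intervalIntegrable a b) (hd.intervalIntegrable b c), mul_add]
  exact add_le_add h1 h2

theorem poincare_center {w : ℝ → ℝ} (hw : ContDiff ℝ ∞ w) {m h : ℝ} (hh : 0 < h) (h0 : w m = 0) :
    (Real.pi / (2 * h)) ^ 2 * ∫ z in (m - h)..(m + h), w z ^ 2 ≤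
      ∫ z in (m - h)..(m + h), deriv w z ^ 2 := by
  have h1 := poincare_right hw (a := m - h) (b := m) (by linarith) h0
  have h2 := poincare_left hw (a := m) (b := m + h) (by linarith) h0
  rw [sub_sub_cancel] at h1
  rw [add_sub_cancel_left] at h2
  exact poincare_join hw h1 h2

theorem poincare_dirichlet {w : ℝ → ℝ} (hw : ContDiff ℝ ∞ w) {a b : ℝ} (hab : a < b)
    (ha : w a = 0) (hb : w b = 0) :
    (Real.pi / (b - a)) ^ 2 * ∫ z in a..b, w z ^ 2 ≤ ∫ z in a..b, deriv w z ^ 2 := by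
  have h1 := poincare_left hw (a := a) (b := (a + b) / 2) (by linarith) ha
  have h2 := poincare_right hw (a := (a + b) / 2) (b := b) (by linarith) hb
  rw [show 2 * ((a + b) / 2 - a) = b - a by ring] at h1
  rw [show 2 * (b - (a + b) / 2) = b - a by ring] at h2
  exact poincare_join hw h1 h2

theorem poincare_partition {w : ℝ → ℝ} (hw : ContDiff ℝ ∞ w) {K : ℝ} (y : ℕ → ℝ) (n : ℕ)
    (h : ∀ k < n, K * ∫ z in (y k)..(y (k + 1)), w z ^ 2 ≤
      ∫ z in (y k)..(y (k + 1)), deriv w z ^ 2) :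
    K * ∫ z in (y 0)..(y n), w z ^ 2 ≤ ∫ z in (y 0)..(y n), deriv w z ^ 2 := by
  induction n with
  | zero => simp
  | succ n ih =>
    exact poincare_join hw (ih fun k hk => h k (hk.trans n.lt_succ_self)) (h n n.lt_succ_self)

/-- A function on `(-1, 1)` that vanishes at the `n + 1` zeros of the Neumann eigenfunction
`cos ((n + 1) π (z + 1) / 2)` has Rayleigh quotient at least that of this eigenfunction. -/
theorem poincare_free {w : ℝ → ℝ} (hw : ContDiff ℝ ∞ w) (n : ℕ)
    (h : ∀ i < n + 1, w (-1 + (2 * (i : ℝ) + 1) / (n + 1)) = 0) :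
    ((n + 1) * Real.pi / 2) ^ 2 * ∫ z in (-1 : ℝ)..1, w z ^ 2 ≤
      ∫ z in (-1 : ℝ)..1, deriv w z ^ 2 := by
  have hn : (0 : ℝ) < n + 1 := by positivity
  have := poincare_partition hw (K := ((n + 1) * Real.pi / 2) ^ 2)
    (fun k : ℕ => -1 + 2 * (k : ℝ) / (n + 1)) (n + 1) ?_
  · have e1 : (-1 : ℝ) + 2 * ((n : ℝ) + 1) / (n + 1) = 1 := by
      field_simp
      ring
    simpa [e1] using this
  · intro k hk
    have := poincare_center hw (h := 1 / ((n : ℝ) + 1)) (by positivity) (h k hk)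
    have e1 : -1 + (2 * (k : ℝ) + 1) / (n + 1) - 1 / (n + 1) = -1 + 2 * (k : ℝ) / (n + 1) := by
      ring
    have e2 : -1 + (2 * (k : ℝ) + 1) / (n + 1) + 1 / (n + 1) =
        -1 + 2 * ((k + 1 : ℕ) : ℝ) / (n + 1) := by
      push_cast
      ring
    have e3 : Real.pi / (2 * (1 / ((n : ℝ) + 1))) = (n + 1) * Real.pi / 2 := by
      field_simp
    rwa [e1, e2, e3] at this

/-- A function on `(-1, 1)` that vanishes at the `n + 3` zeros of the Dirichlet eigenfunction
`sin ((n + 2) π (z + 1) / 2)` has Rayleigh quotient at least that of this eigenfunction. -/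
theorem poincare_zeros {w : ℝ → ℝ} (hw : ContDiff ℝ ∞ w) (n : ℕ) (h1 : w 1 = 0) (h2 : w (-1) = 0)
    (h : ∀ i < n + 1, w (-1 + 2 * ((i : ℝ) + 1) / (n + 2)) = 0) :
    ((n + 2) * Real.pi / 2) ^ 2 * ∫ z in (-1 : ℝ)..1, w z ^ 2 ≤
      ∫ z in (-1 : ℝ)..1, deriv w z ^ 2 := by
  have hn : (0 : ℝ) < n + 2 := by positivity
  set y : ℕ → ℝ := fun k => -1 + 2 * (k : ℝ) / (n + 2) with hy
  have e1 : y (n + 2) = 1 := by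
    simp only [hy]
    push_cast
    field_simp
    ring
  have hz : ∀ k ≤ n + 2, w (y k) = 0 := by
    intro k hk
    rcases Nat.eq_zero_or_pos k with rfl | hk0
    · simpa [hy] using h2
    · rcases hk.eq_or_lt with rfl | hk'
      · rw [e1, h1]
      · have := h (k - 1) (by omega)
        rw [Nat.cast_sub hk0] at this
        simpa [hy] using this
  have := poincare_partition hw (K := ((n + 2) * Real.pi / 2) ^ 2) y (n + 2) ?_
  · rw [e1] at this
    simpa [hy] using this
  · intro k hk
    have e2 : y (k + 1) - y k = 2 / (n + 2) := by
      simp only [hy]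
      push_cast
      ring
    have := poincare_dirichlet hw (a := y k) (b := y (k + 1))
      (sub_pos.1 (by rw [e2]; positivity)) (hz k (by omega)) (hz (k + 1) (by omega))
    have e3 : Real.pi / (2 / ((n : ℝ) + 2)) = (n + 2) * Real.pi / 2 := by
      field_simp
    rwa [e2, e3] at this

/-! ### Smooth functions of one variable -/

/-- The space of smooth functions of `z`. -/
def smoothFns : Submodule ℝ (ℝ → ℝ) where
  carrier := {f | ContDiff ℝ ∞ f}
  zero_mem' := (contDiff_const : ContDiff ℝ ∞ fun _ : ℝ => (0 : ℝ))
  add_mem' := fun {f g} (hf : ContDiff ℝ ∞ f) (hg : ContDiff ℝ ∞ g) => hf.add hg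
  smul_mem' := fun c f (hf : ContDiff ℝ ∞ f) => hf.const_smul c

namespace smoothFns

theorem smooth (f : smoothFns) : ContDiff ℝ ∞ (f : ℝ → ℝ) := f.2

theorem differentiable (f : smoothFns) : Differentiable ℝ (f : ℝ → ℝ) :=
  (smooth f).differentiable (by simp)

theorem continuous (f : smoothFns) : Continuous (f : ℝ → ℝ) := (smooth f).continuous

/-- Differentiation. -/
def D : smoothFns →ₗ[ℝ] smoothFns where
  toFun f := ⟨deriv f, (contDiff_infty_iff_deriv.1 f.2).2⟩
  map_add' f g := by
    ext z
    exact deriv_add (differentiable f z) (differentiable g z)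
  map_smul' c f := by
    ext z
    exact deriv_const_smul c (differentiable f z)

theorem coe_D (f : smoothFns) : (D f : ℝ → ℝ) = deriv f := rfl

theorem hasDerivAt (f : smoothFns) (z : ℝ) : HasDerivAt (f : ℝ → ℝ) ((D f : ℝ → ℝ) z) z :=
  (differentiable f z).hasDerivAt

/-- Evaluation at a point. -/
def ev (z : ℝ) : smoothFns →ₗ[ℝ] ℝ where
  toFun f := (f : ℝ → ℝ) z
  map_add' _ _ := rfl
  map_smul' _ _ := rfl

theorem intervalIntegrable_mul (f g : smoothFns) (a b : ℝ) :
    IntervalIntegrable (fun z => (f : ℝ → ℝ) z * (g : ℝ → ℝ) z) volume a b :=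
  ((continuous f).mul (continuous g)).intervalIntegrable a b

/-- The inner product of `L²(-1, 1)`. -/
def ip : smoothFns →ₗ[ℝ] smoothFns →ₗ[ℝ] ℝ :=
  LinearMap.mk₂ ℝ (fun f g => ∫ z in (-1 : ℝ)..1, (f : ℝ → ℝ) z * (g : ℝ → ℝ) z)
    (fun f g h => by
      rw [← intervalIntegral.integral_add (intervalIntegrable_mul _ _ _ _)
        (intervalIntegrable_mul _ _ _ _)]
      exact intervalIntegral.integral_congr fun z _ => add_mul _ _ _)
    (fun c f g => by
      rw [smul_eq_mul, ← intervalIntegral.integral_const_mul]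
      exact intervalIntegral.integral_congr fun z _ => mul_assoc _ _ _)
    (fun f g h => by
      rw [← intervalIntegral.integral_add (intervalIntegrable_mul _ _ _ _)
        (intervalIntegrable_mul _ _ _ _)]
      exact intervalIntegral.integral_congr fun z _ => mul_add _ _ _)
    (fun c f g => by
      rw [smul_eq_mul, ← intervalIntegral.integral_const_mul]
      exact intervalIntegral.integral_congr fun z _ => mul_left_comm _ _ _)

theorem ip_apply (f g : smoothFns) :
    ip f g = ∫ z in (-1 : ℝ)..1, (f : ℝ → ℝ) z * (g : ℝ → ℝ) z := rfl

theorem ip_self (f : smoothFns) : ip f f = ∫ z in (-1 : ℝ)..1, (f : ℝ → ℝ) z ^ 2 := by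
  rw [ip_apply]
  exact intervalIntegral.integral_congr fun z _ => (sq _).symm

theorem ip_comm (f g : smoothFns) : ip f g = ip g f := by
  rw [ip_apply, ip_apply]
  exact intervalIntegral.integral_congr fun z _ => mul_comm _ _

theorem ip_self_nonneg (f : smoothFns) : 0 ≤ ip f f := by
  rw [ip_self]
  exact intervalIntegral.integral_nonneg (by norm_num) fun z _ => sq_nonneg _

theorem ip_self_pos {f : smoothFns} {z : ℝ} (hz : z ∈ Icc (-1 : ℝ) 1) (h : (f : ℝ → ℝ) z ≠ 0) :
    0 < ip f f := by
  rw [ip_self]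
  exact intervalIntegral.integral_pos (by norm_num) ((continuous f).pow 2).continuousOn
    (fun z _ => sq_nonneg _) ⟨z, hz, by positivity⟩

/-- The Cauchy-Schwarz inequality. -/
theorem ip_sq_le (f g : smoothFns) : ip f g ^ 2 ≤ ip f f * ip g g := by
  have h : ∀ t : ℝ, 0 ≤ ip g g * (t * t) + (2 * ip f g) * t + ip f f := by
    intro t
    have h1 := ip_self_nonneg (f + t • g)
    simp only [map_add, map_smul, LinearMap.add_apply, LinearMap.smul_apply, smul_eq_mul,
      ip_comm g f] at h1
    linarith
  have := discrim_le_zero h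
  simp only [discrim] at this
  linarith

/-- Integration by parts. -/
theorem ip_D_left (f g : smoothFns) :
    ip (D f) g = (f : ℝ → ℝ) 1 * (g : ℝ → ℝ) 1 - (f : ℝ → ℝ) (-1) * (g : ℝ → ℝ) (-1)
      - ip f (D g) := by
  have h := intervalIntegral.integral_deriv_mul_eq_sub (a := -1) (b := 1)
    (u := (f : ℝ → ℝ)) (v := (g : ℝ → ℝ)) (u' := (D f : ℝ → ℝ)) (v' := (D g : ℝ → ℝ))
    (fun z _ => hasDerivAt f z) (fun z _ => hasDerivAt g z)
    ((continuous (D f)).intervalIntegrable _ _) ((continuous (D g)).intervalIntegrable _ _)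
  rw [intervalIntegral.integral_add (intervalIntegrable_mul _ _ _ _)
    (intervalIntegrable_mul _ _ _ _)] at h
  rw [ip_apply, ip_apply, ← h]
  ring

/-- Every smooth function has a smooth primitive. -/
theorem exists_primitive (g : smoothFns) : ∃ G : smoothFns, D G = g := by
  have hd : ∀ z, HasDerivAt (fun z => ∫ s in (0 : ℝ)..z, (g : ℝ → ℝ) s) ((g : ℝ → ℝ) z) z :=
    fun z => intervalIntegral.integral_hasDerivAt_right ((continuous g).intervalIntegrable _ _)
      (continuous g).stronglyMeasurable.stronglyMeasurableAtFilter (continuous g).continuousAt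
  have hder : deriv (fun z => ∫ s in (0 : ℝ)..z, (g : ℝ → ℝ) s) = g := funext fun z => (hd z).deriv
  refine ⟨⟨fun z => ∫ s in (0 : ℝ)..z, (g : ℝ → ℝ) s, ?_⟩, Subtype.ext hder⟩
  refine contDiff_infty_iff_deriv.2 ⟨fun z => (hd z).differentiableAt, ?_⟩
  rw [hder]
  exact g.2

/-- The operator `d²/dz² - μ²`. -/
def helm (μ : ℝ) : smoothFns →ₗ[ℝ] smoothFns := D ∘ₗ D - μ ^ 2 • LinearMap.id

theorem helm_apply (μ : ℝ) (f : smoothFns) : helm μ f = D (D f) - μ ^ 2 • f := rfl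

/-- Smooth functions vanishing at `±1`. -/
def dirichlet : Submodule ℝ smoothFns := LinearMap.ker (ev 1) ⊓ LinearMap.ker (ev (-1))

theorem mem_dirichlet {f : smoothFns} :
    f ∈ dirichlet ↔ (f : ℝ → ℝ) 1 = 0 ∧ (f : ℝ → ℝ) (-1) = 0 := Iff.rfl

/-! ### Completeness of the two families of profiles -/

/-- The eigenfunctions of `-d²/dz²` with Robin conditions at `±1` are complete, provided the `p`-th
frequency lies in `(p π / 2, (p + 1) π / 2)`. -/
theorem eq_zero_of_robin {β : ℝ} (hβ : 0 < β) (k : ℕ → ℝ)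
    (hk : ∀ p : ℕ, k p ∈ Ioo (p * Real.pi / 2) ((p + 1) * Real.pi / 2)) (f : ℕ → smoothFns)
    (hf : ∀ p, D (D (f p)) = -(k p ^ 2) • f p)
    (hf1 : ∀ p, (D (f p) : ℝ → ℝ) 1 = -β * (f p : ℝ → ℝ) 1)
    (hf2 : ∀ p, (D (f p) : ℝ → ℝ) (-1) = β * (f p : ℝ → ℝ) (-1))
    (hpos : ∀ p, 0 < ip (f p) (f p))
    (A : smoothFns →ₗ[ℝ] ℝ) {C : ℝ} (hC : 0 ≤ C) (hA : ∀ g, A g ^ 2 ≤ C * ip g g)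
    (hAf : ∀ p, A (f p) = 0) (g : smoothFns) : A g = 0 := by
  have hk0 : ∀ p, 0 < k p := fun p => lt_of_le_of_lt (by positivity) (hk p).1
  have hkm : StrictMono k := by
    refine strictMono_nat_of_lt_succ fun p => (hk p).2.trans ?_
    have := (hk (p + 1)).1
    push_cast at this
    exact this
  let a : smoothFns →ₗ[ℝ] smoothFns →ₗ[ℝ] ℝ := ip.compl₁₂ D D +
    β • ((LinearMap.mul ℝ ℝ).compl₁₂ (ev 1) (ev 1)
      + (LinearMap.mul ℝ ℝ).compl₁₂ (ev (-1)) (ev (-1)))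
  have a_apply : ∀ x y : smoothFns, a x y = ip (D x) (D y) +
      β * ((x : ℝ → ℝ) 1 * (y : ℝ → ℝ) 1 + (x : ℝ → ℝ) (-1) * (y : ℝ → ℝ) (-1)) :=
    fun x y => rfl
  refine eq_zero_of_vanish_on_eigenvectors ip a ip_comm ?_ ?_ f (fun p => k p ^ 2)
    (fun p => ((p + 1) * Real.pi / 2) ^ 2) ?_ (fun p => sq_nonneg _) ?_ ?_ ?_ hpos
    (fun n i => ev (-1 + (2 * ((i : ℕ) : ℝ) + 1) / (n + 1))) ?_ A C hA hC hAf g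
  · intro x y
    rw [a_apply, a_apply, ip_comm]
    ring
  · intro x
    rw [a_apply]
    have := ip_self_nonneg (D x)
    have := mul_self_nonneg ((x : ℝ → ℝ) 1)
    have := mul_self_nonneg ((x : ℝ → ℝ) (-1))
    positivity
  · exact fun p q hpq => pow_lt_pow_left₀ (hkm hpq) (hk0 p).le two_ne_zero
  · exact fun p => pow_lt_pow_left₀ (hk p).2 (hk0 p).le two_ne_zero
  · refine (tendsto_pow_atTop two_ne_zero).comp ?_
    refine Tendsto.atTop_div_const two_pos (Tendsto.atTop_mul_const Real.pi_pos ?_)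
    exact tendsto_atTop_add_const_right _ _ tendsto_natCast_atTop_atTop
  · intro p x
    rw [a_apply, ip_comm, ip_D_left, ip_comm x, hf, hf1, hf2, map_smul, LinearMap.smul_apply,
      smul_eq_mul]
    ring
  · intro n w hw
    have h := poincare_free (smooth w) n fun i hi => hw ⟨i, hi⟩
    rw [a_apply, ip_self, ip_self]
    have := mul_self_nonneg ((w : ℝ → ℝ) 1)
    have := mul_self_nonneg ((w : ℝ → ℝ) (-1))
    refine h.trans (le_add_of_nonneg_right (by positivity))

/-- The eigenfunctions `W` of the fourth order problem `(d²/dz² - μ²)² W = -Λ (d²/dz² - μ²) W`,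
`W = 0`, `W'' ± β W' = 0` at `z = ±1`, are complete in the energy space of the inner product
`∫ W' X' + μ² W X`, provided the frequency of the `p`-th one lies in
`((p + 1) π / 2, (p + 2) π / 2)`. -/
theorem eq_zero_of_stokes {β μ : ℝ} (hβ : 0 < β) (k : ℕ → ℝ)
    (hk : ∀ p : ℕ, k p ∈ Ioo ((p + 1) * Real.pi / 2) ((p + 2) * Real.pi / 2))
    (W : ℕ → dirichlet)
    (hW : ∀ p, D (D (helm μ (W p))) = -(k p ^ 2) • helm μ (W p))
    (hW1 : ∀ p, (helm μ (W p) : ℝ → ℝ) 1 = -β * (D (W p : smoothFns) : ℝ → ℝ) 1)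
    (hW2 : ∀ p, (helm μ (W p) : ℝ → ℝ) (-1) = β * (D (W p : smoothFns) : ℝ → ℝ) (-1))
    (hpos : ∀ p, 0 < ip (D (W p)) (D (W p)))
    (A : dirichlet →ₗ[ℝ] ℝ) {C : ℝ} (hC : 0 ≤ C)
    (hA : ∀ X : dirichlet, A X ^ 2 ≤ C * (ip (D X) (D X) + μ ^ 2 * ip (X : smoothFns) X))
    (hAW : ∀ p, A (W p) = 0) (X : dirichlet) : A X = 0 := by
  have hk0 : ∀ p, 0 < k p := fun p => lt_of_le_of_lt (by positivity) (hk p).1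
  have hkm : StrictMono k := by
    refine strictMono_nat_of_lt_succ fun p => (hk p).2.trans ?_
    have := (hk (p + 1)).1
    push_cast at this
    convert this using 1
    ring
  let J : dirichlet →ₗ[ℝ] smoothFns := dirichlet.subtype
  let N : dirichlet →ₗ[ℝ] dirichlet →ₗ[ℝ] ℝ :=
    ip.compl₁₂ (D ∘ₗ J) (D ∘ₗ J) + μ ^ 2 • ip.compl₁₂ J J
  let a : dirichlet →ₗ[ℝ] dirichlet →ₗ[ℝ] ℝ := ip.compl₁₂ (helm μ ∘ₗ J) (helm μ ∘ₗ J) +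
    β • ((LinearMap.mul ℝ ℝ).compl₁₂ (ev 1 ∘ₗ D ∘ₗ J) (ev 1 ∘ₗ D ∘ₗ J)
      + (LinearMap.mul ℝ ℝ).compl₁₂ (ev (-1) ∘ₗ D ∘ₗ J) (ev (-1) ∘ₗ D ∘ₗ J))
  have N_apply : ∀ x y : dirichlet, N x y = ip (D x) (D y) + μ ^ 2 * ip (x : smoothFns) y :=
    fun x y => rfl
  have a_apply : ∀ x y : dirichlet, a x y = ip (helm μ x) (helm μ y) +
      β * ((D (x : smoothFns) : ℝ → ℝ) 1 * (D (y : smoothFns) : ℝ → ℝ) 1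
        + (D (x : smoothFns) : ℝ → ℝ) (-1) * (D (y : smoothFns) : ℝ → ℝ) (-1)) :=
    fun x y => rfl
  have bd1 : ∀ x : dirichlet, ((x : smoothFns) : ℝ → ℝ) 1 = 0 := fun x => (mem_dirichlet.1 x.2).1
  have bd2 : ∀ x : dirichlet, ((x : smoothFns) : ℝ → ℝ) (-1) = 0 :=
    fun x => (mem_dirichlet.1 x.2).2
  have ipN : ∀ x y : dirichlet, ip (helm μ x) (y : smoothFns) = -N x y := by
    intro x y
    rw [N_apply, helm_apply, map_sub, LinearMap.sub_apply, ip_D_left, bd1, bd2, map_smul,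
      LinearMap.smul_apply, smul_eq_mul]
    ring
  have hN0 : ∀ x, 0 ≤ N x x := by
    intro x
    rw [N_apply]
    have := ip_self_nonneg (D x)
    have := ip_self_nonneg (x : smoothFns)
    positivity
  refine eq_zero_of_vanish_on_eigenvectors N a ?_ ?_ ?_ W (fun p => k p ^ 2 + μ ^ 2)
    (fun p => ((p + 2) * Real.pi / 2) ^ 2 + μ ^ 2) ?_ (fun p => by positivity) ?_ ?_ ?_ ?_
    (fun n i => ev (-1 + 2 * (((i : ℕ) : ℝ) + 1) / (n + 2)) ∘ₗ J) ?_ A C ?_ hC hAW X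
  · intro x y
    rw [N_apply, N_apply, ip_comm, ip_comm (x : smoothFns)]
  · intro x y
    rw [a_apply, a_apply, ip_comm]
    ring
  · intro x
    rw [a_apply]
    have := ip_self_nonneg (helm μ x)
    have := mul_self_nonneg ((D (x : smoothFns) : ℝ → ℝ) 1)
    have := mul_self_nonneg ((D (x : smoothFns) : ℝ → ℝ) (-1))
    positivity
  · intro p q hpq
    have := pow_lt_pow_left₀ (hkm hpq) (hk0 p).le two_ne_zero
    simpa using this
  · intro p
    have := pow_lt_pow_left₀ (hk p).2 (hk0 p).le two_ne_zero
    simpa using this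
  · refine tendsto_atTop_add_const_right _ _ ((tendsto_pow_atTop two_ne_zero).comp ?_)
    refine Tendsto.atTop_div_const two_pos (Tendsto.atTop_mul_const Real.pi_pos ?_)
    exact tendsto_atTop_add_const_right _ _ tendsto_natCast_atTop_atTop
  · intro p x
    have h1 : ip (helm μ (W p)) (D (D x)) =
        (helm μ (W p) : ℝ → ℝ) 1 * (D (x : smoothFns) : ℝ → ℝ) 1
        - (helm μ (W p) : ℝ → ℝ) (-1) * (D (x : smoothFns) : ℝ → ℝ) (-1)
        + ip (D (D (helm μ (W p)))) x := by
      rw [ip_D_left (D (helm μ (W p))), bd1, bd2, ip_D_left (helm μ (W p)) (D x)]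
      ring
    rw [a_apply, helm_apply μ (x : smoothFns), map_sub, h1, hW, hW1, hW2, map_smul, map_smul,
      LinearMap.smul_apply, smul_eq_mul, smul_eq_mul, ipN]
    ring
  · intro p
    rw [N_apply]
    have := ip_self_nonneg (W p : smoothFns)
    have := hpos p
    positivity
  · intro n w hw
    have h := poincare_zeros (smooth (w : smoothFns)) n (bd1 w) (bd2 w) fun i hi => hw ⟨i, hi⟩
    rw [← ip_self, ← coe_D, ← ip_self] at h
    set K : ℝ := ((n + 2) * Real.pi / 2) ^ 2 + μ ^ 2 with hK
    have hKpos : 0 < K := by positivity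
    -- with `ω` the image of `w`: `N(w,w)² = (ω,w)² ≤ ‖ω‖² ‖w‖²` and `K ‖w‖² ≤ N(w,w)`
    have h1 : K * ip (w : smoothFns) w ≤ N w w := by
      rw [N_apply, hK, add_mul]
      exact add_le_add_left h _
    have h2 : N w w ^ 2 ≤ ip (helm μ w) (helm μ w) * ip (w : smoothFns) w := by
      have := ip_sq_le (helm μ w) (w : smoothFns)
      rwa [ipN, neg_sq] at this
    have h3 : K * N w w ≤ ip (helm μ w) (helm μ w) := by
      rcases (hN0 w).eq_or_lt with h0 | h0
      · rw [← h0, mul_zero]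
        exact ip_self_nonneg _
      · have h4 := ip_self_nonneg (helm μ w)
        have h5 : K * N w w ^ 2 ≤ ip (helm μ w) (helm μ w) * N w w := by
          calc K * N w w ^ 2 ≤ K * (ip (helm μ w) (helm μ w) * ip (w : smoothFns) w) :=
                mul_le_mul_of_nonneg_left h2 hKpos.le
            _ = ip (helm μ w) (helm μ w) * (K * ip (w : smoothFns) w) := by ring
            _ ≤ _ := mul_le_mul_of_nonneg_left h1 h4
        refine le_of_mul_le_mul_right ?_ h0
        linarith
    rw [a_apply]
    have := mul_self_nonneg ((D (w : smoothFns) : ℝ → ℝ) 1)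
    have := mul_self_nonneg ((D (w : smoothFns) : ℝ → ℝ) (-1))
    exact h3.trans (le_add_of_nonneg_right (by positivity))
  · intro x
    exact hA x

end smoothFns

/-! ### Frequencies: roots of the characteristic equations -/

theorem exists_zero_Ioo_of_mul_neg {F : ℝ → ℝ} (hF : Continuous F) {a b : ℝ} (hab : a < b)
    (h : F a * F b < 0) : ∃ c ∈ Ioo a b, F c = 0 := by
  rcases mul_neg_iff.1 h with ⟨h1, h2⟩ | ⟨h1, h2⟩
  · exact intermediate_value_Ioo' hab.le hF.continuousOn ⟨h2, h1⟩
  · exact intermediate_value_Ioo hab.le hF.continuousOn ⟨h1, h2⟩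

theorem neg_one_pow_mul_self (r : ℕ) : (-1 : ℝ) ^ r * (-1) ^ r = 1 := by
  rw [← mul_pow]
  norm_num

theorem cos_nat_mul_pi_add_pi_div_two (r : ℕ) : Real.cos (r * Real.pi + Real.pi / 2) = 0 := by
  rw [Real.cos_add_pi_div_two, Real.sin_nat_mul_pi, neg_zero]

theorem sin_nat_mul_pi_add_pi_div_two (r : ℕ) :
    Real.sin (r * Real.pi + Real.pi / 2) = (-1) ^ r := by
  rw [Real.sin_add_pi_div_two, Real.cos_nat_mul_pi]

/-- The open intervals between consecutive multiples of `π / 2` contain no zero of `sin`, `cos`. -/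
theorem cos_ne_zero_and_sin_ne_zero {k : ℝ} {p : ℕ}
    (hk : k ∈ Ioo (p * Real.pi / 2) ((p + 1) * Real.pi / 2)) :
    Real.cos k ≠ 0 ∧ Real.sin k ≠ 0 := by
  have h : Real.sin (2 * k) ≠ 0 := by
    intro h0
    obtain ⟨n, hn⟩ := Real.sin_eq_zero_iff.1 h0
    have h1 : (p : ℝ) * Real.pi < n * Real.pi := by linarith [hk.1]
    have h2 : (n : ℝ) * Real.pi < (p + 1) * Real.pi := by linarith [hk.2]
    have h3 := lt_of_mul_lt_mul_right h1 Real.pi_pos.le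
    have h4 := lt_of_mul_lt_mul_right h2 Real.pi_pos.le
    have h5 : (p : ℤ) < n := by exact_mod_cast h3
    have h6 : n < (p : ℤ) + 1 := by exact_mod_cast h4
    omega
  rw [Real.sin_two_mul] at h
  constructor <;> intro h0 <;> simp [h0] at h

theorem exists_robin_frequency {β : ℝ} (hβ : 0 < β) (p : ℕ) :
    ∃ k ∈ Ioo (p * Real.pi / 2) ((p + 1) * Real.pi / 2),
      (Even p → β * Real.cos k = k * Real.sin k) ∧
      (Odd p → β * Real.sin k = -(k * Real.cos k)) := by
  have hpi := Real.pi_pos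
  rcases Nat.even_or_odd' p with ⟨r, rfl | rfl⟩
  · obtain ⟨k, hk, h0⟩ := exists_zero_Ioo_of_mul_neg
      (F := fun z => β * Real.cos z - z * Real.sin z) (by fun_prop)
      (a := r * Real.pi) (b := r * Real.pi + Real.pi / 2) (by linarith) (by
        have h1 : 0 < r * Real.pi + Real.pi / 2 := by positivity
        simp only [Real.cos_nat_mul_pi, Real.sin_nat_mul_pi, cos_nat_mul_pi_add_pi_div_two,
          sin_nat_mul_pi_add_pi_div_two]
        have : (β * (-1) ^ r - r * Real.pi * 0) *
            (β * 0 - (r * Real.pi + Real.pi / 2) * (-1) ^ r) =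
            -(β * (r * Real.pi + Real.pi / 2)) * ((-1) ^ r * (-1) ^ r) := by ring
        rw [this, neg_one_pow_mul_self]
        have := mul_pos hβ h1
        linarith)
    refine ⟨k, ?_, fun _ => sub_eq_zero.1 h0, fun h => ?_⟩
    · push_cast
      exact ⟨by linarith [hk.1], by linarith [hk.2]⟩
    · exact absurd (even_two_mul r) (Nat.not_even_iff_odd.2 h)
  · obtain ⟨k, hk, h0⟩ := exists_zero_Ioo_of_mul_neg
      (F := fun z => β * Real.sin z + z * Real.cos z) (by fun_prop)
      (a := r * Real.pi + Real.pi / 2) (b := (r + 1 : ℕ) * Real.pi)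
      (by push_cast; linarith) (by
        simp only [Real.cos_nat_mul_pi, Real.sin_nat_mul_pi, cos_nat_mul_pi_add_pi_div_two,
          sin_nat_mul_pi_add_pi_div_two]
        have h1 : 0 < ((r + 1 : ℕ) : ℝ) * Real.pi := by positivity
        have : (β * (-1) ^ r + (r * Real.pi + Real.pi / 2) * 0) *
            (β * 0 + ((r + 1 : ℕ) : ℝ) * Real.pi * (-1) ^ (r + 1)) =
            -(β * (((r + 1 : ℕ) : ℝ) * Real.pi)) * ((-1) ^ r * (-1) ^ r) := by ring
        rw [this, neg_one_pow_mul_self]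
        have := mul_pos hβ h1
        linarith)
    refine ⟨k, ?_, fun h => ?_, fun _ => by simpa using eq_neg_of_add_eq_zero_left h0⟩
    · push_cast at hk ⊢
      exact ⟨by linarith [hk.1], by linarith [hk.2]⟩
    · exact absurd (odd_two_mul_add_one r) (Nat.not_odd_iff_even.2 h)

theorem tanh_nonneg {μ : ℝ} (hμ : 0 ≤ μ) : 0 ≤ Real.tanh μ := by
  rw [Real.tanh_eq_sinh_div_cosh]
  exact div_nonneg (Real.sinh_nonneg_iff.2 hμ) (Real.cosh_pos μ).le

theorem exists_stokes_frequency {β μ : ℝ} (hβ : 0 < β) (hμ : 0 < μ) (p : ℕ) :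
    ∃ k ∈ Ioo ((p + 1) * Real.pi / 2) ((p + 2) * Real.pi / 2),
      (Even p → k * Real.sin k = (-((k ^ 2 + μ ^ 2) / β) - μ * Real.tanh μ) * Real.cos k) ∧
      (Odd p → k * Real.cos k =
        ((k ^ 2 + μ ^ 2) / β + μ * (Real.cosh μ / Real.sinh μ)) * Real.sin k) := by
  have hpi := Real.pi_pos
  rcases Nat.even_or_odd' p with ⟨r, rfl | rfl⟩
  · obtain ⟨k, hk, h0⟩ := exists_zero_Ioo_of_mul_neg
      (F := fun z => z * Real.sin z + ((z ^ 2 + μ ^ 2) / β + μ * Real.tanh μ) * Real.cos z)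
      (by fun_prop) (a := r * Real.pi + Real.pi / 2) (b := (r + 1 : ℕ) * Real.pi)
      (by push_cast; linarith) (by
        have h1 : 0 < r * Real.pi + Real.pi / 2 := by positivity
        have h2 : 0 < (((r + 1 : ℕ) * Real.pi) ^ 2 + μ ^ 2) / β + μ * Real.tanh μ := by
          have := tanh_nonneg hμ.le
          positivity
        generalize hc : (((r + 1 : ℕ) * Real.pi) ^ 2 + μ ^ 2) / β + μ * Real.tanh μ = c at h2
        simp only [Real.cos_nat_mul_pi, Real.sin_nat_mul_pi, cos_nat_mul_pi_add_pi_div_two,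
          sin_nat_mul_pi_add_pi_div_two]
        have : ((r * Real.pi + Real.pi / 2) * (-1) ^ r) * (c * (-1) ^ (r + 1)) =
            -((r * Real.pi + Real.pi / 2) * c) * ((-1) ^ r * (-1) ^ r) := by ring
        rw [mul_zero, mul_zero, add_zero, zero_add, this, neg_one_pow_mul_self]
        have := mul_pos h1 h2
        linarith)
    refine ⟨k, ?_, fun _ => by linarith [h0], fun h => ?_⟩
    · push_cast at hk ⊢
      exact ⟨by linarith [hk.1], by linarith [hk.2]⟩
    · exact absurd (even_two_mul r) (Nat.not_even_iff_odd.2 h)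
  · obtain ⟨k, hk, h0⟩ := exists_zero_Ioo_of_mul_neg
      (F := fun z => z * Real.cos z -
        ((z ^ 2 + μ ^ 2) / β + μ * (Real.cosh μ / Real.sinh μ)) * Real.sin z)
      (by fun_prop) (a := (r + 1 : ℕ) * Real.pi) (b := (r + 1 : ℕ) * Real.pi + Real.pi / 2)
      (by linarith) (by
        have h1 : 0 < ((r + 1 : ℕ) : ℝ) * Real.pi := by positivity
        have h2 : 0 < (((r + 1 : ℕ) * Real.pi + Real.pi / 2) ^ 2 + μ ^ 2) / β
            + μ * (Real.cosh μ / Real.sinh μ) := by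
          have := Real.sinh_pos_iff.2 hμ
          have := Real.cosh_pos μ
          positivity
        generalize hc : (((r + 1 : ℕ) * Real.pi + Real.pi / 2) ^ 2 + μ ^ 2) / β
            + μ * (Real.cosh μ / Real.sinh μ) = c at h2
        simp only [Real.cos_nat_mul_pi, Real.sin_nat_mul_pi, cos_nat_mul_pi_add_pi_div_two,
          sin_nat_mul_pi_add_pi_div_two]
        have : (((r + 1 : ℕ) : ℝ) * Real.pi * (-1) ^ (r + 1)) * (-(c * (-1) ^ (r + 1))) =
            -(((r + 1 : ℕ) : ℝ) * Real.pi * c) * ((-1) ^ (r + 1) * (-1) ^ (r + 1)) := by ring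
        rw [mul_zero, mul_zero, sub_zero, zero_sub, this, neg_one_pow_mul_self]
        have := mul_pos h1 h2
        linarith)
    refine ⟨k, ?_, fun h => ?_, fun _ => by linarith [h0]⟩
    · push_cast at hk ⊢
      exact ⟨by linarith [hk.1], by linarith [hk.2]⟩
    · exact absurd (odd_two_mul_add_one r) (Nat.not_odd_iff_even.2 h)

/-! ### Vertical profiles -/

namespace smoothFns

/-- The function `cos (k z)`. -/
def cosFn (k : ℝ) : smoothFns :=
  ⟨fun z => Real.cos (k * z),
    show ContDiff ℝ ∞ fun z => Real.cos (k * z) by fun_prop⟩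

/-- The function `sin (k z)`. -/
def sinFn (k : ℝ) : smoothFns :=
  ⟨fun z => Real.sin (k * z),
    show ContDiff ℝ ∞ fun z => Real.sin (k * z) by fun_prop⟩

/-- The function `cosh (k z)`. -/
def coshFn (k : ℝ) : smoothFns :=
  ⟨fun z => Real.cosh (k * z),
    show ContDiff ℝ ∞ fun z => Real.cosh (k * z) by fun_prop⟩

/-- The function `sinh (k z)`. -/
def sinhFn (k : ℝ) : smoothFns :=
  ⟨fun z => Real.sinh (k * z),
    show ContDiff ℝ ∞ fun z => Real.sinh (k * z) by fun_prop⟩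

theorem hasDerivAt_const_mul' (k z : ℝ) : HasDerivAt (fun z => k * z) k z := by
  simpa using (hasDerivAt_id z).const_mul k

theorem D_cosFn (k : ℝ) : D (cosFn k) = -k • sinFn k := by
  ext z
  refine (((hasDerivAt_const_mul' k z).cos).deriv).trans ?_
  simp [sinFn]
  ring

theorem D_sinFn (k : ℝ) : D (sinFn k) = k • cosFn k := by
  ext z
  refine (((hasDerivAt_const_mul' k z).sin).deriv).trans ?_
  simp [cosFn]
  ring

theorem D_coshFn (k : ℝ) : D (coshFn k) = k • sinhFn k := by
  ext z
  refine (((hasDerivAt_const_mul' k z).cosh).deriv).trans ?_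
  simp [sinhFn]
  ring

theorem D_sinhFn (k : ℝ) : D (sinhFn k) = k • coshFn k := by
  ext z
  refine (((hasDerivAt_const_mul' k z).sinh).deriv).trans ?_
  simp [coshFn]
  ring

theorem coe_add (f g : smoothFns) (z : ℝ) :
    ((f + g : smoothFns) : ℝ → ℝ) z = (f : ℝ → ℝ) z + (g : ℝ → ℝ) z := rfl

theorem coe_sub (f g : smoothFns) (z : ℝ) :
    ((f - g : smoothFns) : ℝ → ℝ) z = (f : ℝ → ℝ) z - (g : ℝ → ℝ) z := rfl

theorem coe_smul (c : ℝ) (f : smoothFns) (z : ℝ) :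
    ((c • f : smoothFns) : ℝ → ℝ) z = c * (f : ℝ → ℝ) z := rfl

theorem coe_zero (z : ℝ) : ((0 : smoothFns) : ℝ → ℝ) z = 0 := rfl

/-- The product of two smooth functions. -/
def mulFn (f g : smoothFns) : smoothFns := ⟨fun z => (f : ℝ → ℝ) z * (g : ℝ → ℝ) z,
  (smooth f).mul (smooth g)⟩

theorem coe_mulFn (f g : smoothFns) (z : ℝ) :
    (mulFn f g : ℝ → ℝ) z = (f : ℝ → ℝ) z * (g : ℝ → ℝ) z := rfl

theorem D_mulFn (f g : smoothFns) : D (mulFn f g) = mulFn (D f) g + mulFn f (D g) := by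
  ext z
  exact ((hasDerivAt f z).mul (hasDerivAt g z)).deriv

/-- The Dirichlet problem for `d²/dz² - μ²` is solvable with smooth data. -/
theorem exists_dirichlet_helm {μ : ℝ} (hμ : 0 < μ) (g : smoothFns) :
    ∃ W : dirichlet, helm μ W = g := by
  obtain ⟨G₁, h1⟩ := exists_primitive (mulFn (coshFn μ) g)
  obtain ⟨G₂, h2⟩ := exists_primitive (mulFn (sinhFn μ) g)
  -- variation of constants
  set W₀ : smoothFns := μ⁻¹ • (mulFn (sinhFn μ) G₁ - mulFn (coshFn μ) G₂) with hW₀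
  have hH0 : helm μ W₀ = g := by
    have hD : D W₀ = mulFn (coshFn μ) G₁ - mulFn (sinhFn μ) G₂ := by
      ext z
      simp only [hW₀, map_smul, map_sub, D_mulFn, h1, h2, D_coshFn, D_sinhFn, coe_smul, coe_sub,
        coe_add, coe_mulFn]
      field_simp
      ring
    ext z
    have hcs := Real.cosh_sq (μ * z)
    rw [helm_apply, hD]
    simp only [hW₀, map_sub, D_mulFn, h1, h2, D_coshFn, D_sinhFn, coe_smul, coe_sub,
        coe_add, coe_mulFn]
    simp only [coshFn, sinhFn]
    field_simp
    linear_combination ((g : ℝ → ℝ) z) * hcs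
  have hC : helm μ (coshFn μ) = 0 := by
    rw [helm_apply, D_coshFn, map_smul, D_sinhFn, smul_smul, sq, sub_self]
  have hS : helm μ (sinhFn μ) = 0 := by
    rw [helm_apply, D_sinhFn, map_smul, D_coshFn, smul_smul, sq, sub_self]
  have hcosh := (Real.cosh_pos μ).ne'
  have hsinh := (Real.sinh_pos_iff.2 hμ).ne'
  refine ⟨⟨W₀ - (((W₀ : ℝ → ℝ) 1 + (W₀ : ℝ → ℝ) (-1)) / (2 * Real.cosh μ)) • coshFn μ
    - (((W₀ : ℝ → ℝ) 1 - (W₀ : ℝ → ℝ) (-1)) / (2 * Real.sinh μ)) • sinhFn μ,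
    mem_dirichlet.2 ⟨?_, ?_⟩⟩, ?_⟩
  · simp only [coe_sub, coe_smul]
    simp only [coshFn, sinhFn, mul_one]
    field_simp
    ring
  · simp only [coe_sub, coe_smul]
    simp only [coshFn, sinhFn, mul_neg, mul_one, Real.cosh_neg, Real.sinh_neg]
    field_simp
    ring
  · simp only [map_sub, map_smul, hH0, hC, hS, smul_zero, sub_zero]

/-- The even (`cos`) or odd (`sin`) solution of `f'' = -k² f`, according to the parity of `p`. -/
def trigFn (p : ℕ) (k : ℝ) : smoothFns := if Even p then cosFn k else sinFn k

/-- The even (`cosh`) or odd (`sinh`) solution of `f'' = μ² f`, according to the parity of `p`. -/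
def hypFn (p : ℕ) (μ : ℝ) : smoothFns := if Even p then coshFn μ else sinhFn μ

/-- The vertical component of the second class: the solution of `W'' - μ² W = (k² + μ²) trigFn`
that vanishes at `±1`. -/
def vertFn (p : ℕ) (μ k : ℝ) : smoothFns :=
  ((trigFn p k : ℝ → ℝ) 1 / (hypFn p μ : ℝ → ℝ) 1) • hypFn p μ - trigFn p k

theorem trigFn_even {p : ℕ} (hp : Even p) (k : ℝ) : trigFn p k = cosFn k := if_pos hp

theorem trigFn_odd {p : ℕ} (hp : Odd p) (k : ℝ) : trigFn p k = sinFn k :=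
  if_neg (Nat.not_even_iff_odd.2 hp)

theorem hypFn_even {p : ℕ} (hp : Even p) (k : ℝ) : hypFn p k = coshFn k := if_pos hp

theorem hypFn_odd {p : ℕ} (hp : Odd p) (k : ℝ) : hypFn p k = sinhFn k :=
  if_neg (Nat.not_even_iff_odd.2 hp)

theorem D_D_trigFn (p : ℕ) (k : ℝ) : D (D (trigFn p k)) = -(k ^ 2) • trigFn p k := by
  rcases Nat.even_or_odd p with hp | hp
  · rw [trigFn_even hp, D_cosFn, map_smul, D_sinFn, smul_smul]
    congr 1
    ring
  · rw [trigFn_odd hp, D_sinFn, map_smul, D_cosFn, smul_smul]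
    congr 1
    ring

theorem D_D_hypFn (p : ℕ) (k : ℝ) : D (D (hypFn p k)) = k ^ 2 • hypFn p k := by
  rcases Nat.even_or_odd p with hp | hp
  · rw [hypFn_even hp, D_coshFn, map_smul, D_sinhFn, smul_smul, sq]
  · rw [hypFn_odd hp, D_sinhFn, map_smul, D_coshFn, smul_smul, sq]

theorem trigFn_neg (p : ℕ) (k z : ℝ) :
    (trigFn p k : ℝ → ℝ) (-z) = (-1) ^ p * (trigFn p k : ℝ → ℝ) z := by
  rcases Nat.even_or_odd p with hp | hp
  · rw [trigFn_even hp, hp.neg_one_pow]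
    simp [cosFn]
  · rw [trigFn_odd hp, hp.neg_one_pow]
    simp [sinFn]

theorem hypFn_neg (p : ℕ) (k z : ℝ) :
    (hypFn p k : ℝ → ℝ) (-z) = (-1) ^ p * (hypFn p k : ℝ → ℝ) z := by
  rcases Nat.even_or_odd p with hp | hp
  · rw [hypFn_even hp, hp.neg_one_pow]
    simp [coshFn]
  · rw [hypFn_odd hp, hp.neg_one_pow]
    simp [sinhFn]

theorem D_neg_of_parity {f : smoothFns} {ε : ℝ}
    (h : ∀ z, (f : ℝ → ℝ) (-z) = ε * (f : ℝ → ℝ) z) (z : ℝ) :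
    (D f : ℝ → ℝ) (-z) = -ε * (D f : ℝ → ℝ) z := by
  have h1 : HasDerivAt (fun z => (f : ℝ → ℝ) (-z)) (-(D f : ℝ → ℝ) (-z)) z := by
    simpa [Function.comp_def] using (hasDerivAt f (-z)).scomp z (hasDerivAt_neg z)
  have h2 : HasDerivAt (fun z => (f : ℝ → ℝ) (-z)) (ε * (D f : ℝ → ℝ) z) z := by
    simp only [h]
    exact (hasDerivAt f z).const_mul ε
  linarith [h1.unique h2]

theorem hypFn_ne_zero (p : ℕ) {μ z : ℝ} (hμ : 0 < μ) (hz : z ≠ 0) :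
    (hypFn p μ : ℝ → ℝ) z ≠ 0 := by
  rcases Nat.even_or_odd p with hp | hp
  · rw [hypFn_even hp]
    exact (Real.cosh_pos _).ne'
  · rw [hypFn_odd hp]
    exact fun h => mul_ne_zero hμ.ne' hz (Real.sinh_eq_zero.1 h)

theorem D_hypFn_ne_zero (p : ℕ) {μ z : ℝ} (hμ : 0 < μ) (hz : z ≠ 0) :
    (D (hypFn p μ) : ℝ → ℝ) z ≠ 0 := by
  rcases Nat.even_or_odd p with hp | hp
  · rw [hypFn_even hp, D_coshFn, coe_smul]
    exact mul_ne_zero hμ.ne' fun h => mul_ne_zero hμ.ne' hz (Real.sinh_eq_zero.1 h)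
  · rw [hypFn_odd hp, D_sinhFn, coe_smul]
    exact mul_ne_zero hμ.ne' (Real.cosh_pos _).ne'

theorem trigFn_one_ne_zero {p q : ℕ} {k : ℝ}
    (hk : k ∈ Ioo (q * Real.pi / 2) ((q + 1) * Real.pi / 2)) : (trigFn p k : ℝ → ℝ) 1 ≠ 0 := by
  obtain ⟨h1, h2⟩ := cos_ne_zero_and_sin_ne_zero hk
  rcases Nat.even_or_odd p with hp | hp
  · rw [trigFn_even hp]
    simpa [cosFn] using h1
  · rw [trigFn_odd hp]
    simpa [sinFn] using h2

theorem D_trigFn_one {β k : ℝ} {p : ℕ} (h1 : Even p → β * Real.cos k = k * Real.sin k)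
    (h2 : Odd p → β * Real.sin k = -(k * Real.cos k)) :
    (D (trigFn p k) : ℝ → ℝ) 1 = -β * (trigFn p k : ℝ → ℝ) 1 := by
  rcases Nat.even_or_odd p with hp | hp
  · have := h1 hp
    rw [trigFn_even hp, D_cosFn, coe_smul]
    simp only [cosFn, sinFn, mul_one]
    linarith
  · have := h2 hp
    rw [trigFn_odd hp, D_sinFn, coe_smul]
    simp only [cosFn, sinFn, mul_one]
    linarith

theorem D_trigFn_neg_one {β k : ℝ} {p : ℕ}
    (h : (D (trigFn p k) : ℝ → ℝ) 1 = -β * (trigFn p k : ℝ → ℝ) 1) :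
    (D (trigFn p k) : ℝ → ℝ) (-1) = β * (trigFn p k : ℝ → ℝ) (-1) := by
  rw [D_neg_of_parity (trigFn_neg p k), trigFn_neg, h]
  ring

theorem vertFn_neg (p : ℕ) (μ k z : ℝ) :
    (vertFn p μ k : ℝ → ℝ) (-z) = (-1) ^ p * (vertFn p μ k : ℝ → ℝ) z := by
  rw [vertFn, coe_sub, coe_sub, coe_smul, coe_smul, trigFn_neg, hypFn_neg]
  ring

theorem vertFn_mem (p : ℕ) {μ : ℝ} (hμ : 0 < μ) (k : ℝ) : vertFn p μ k ∈ dirichlet := by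
  have h1 : (vertFn p μ k : ℝ → ℝ) 1 = 0 := by
    have := hypFn_ne_zero p hμ one_ne_zero
    rw [vertFn, coe_sub, coe_smul]
    field_simp
    ring
  refine mem_dirichlet.2 ⟨h1, ?_⟩
  rw [vertFn_neg, h1, mul_zero]

theorem helm_vertFn (p : ℕ) (μ k : ℝ) : helm μ (vertFn p μ k) = (k ^ 2 + μ ^ 2) • trigFn p k := by
  rw [helm_apply, vertFn, map_sub, map_sub, map_smul, map_smul, D_D_hypFn, D_D_trigFn]
  module

theorem helm_vertFn_one {β μ k : ℝ} {p : ℕ} (hβ : 0 < β) (hμ : 0 < μ)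
    (h1 : Even p → k * Real.sin k = (-((k ^ 2 + μ ^ 2) / β) - μ * Real.tanh μ) * Real.cos k)
    (h2 : Odd p → k * Real.cos k =
      ((k ^ 2 + μ ^ 2) / β + μ * (Real.cosh μ / Real.sinh μ)) * Real.sin k) :
    (helm μ (vertFn p μ k) : ℝ → ℝ) 1 = -β * (D (vertFn p μ k) : ℝ → ℝ) 1 := by
  rw [helm_vertFn, vertFn, map_sub, map_smul, coe_sub, coe_smul, coe_smul]
  rcases Nat.even_or_odd p with hp | hp
  · have := h1 hp
    have hc := (Real.cosh_pos μ).ne'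
    rw [trigFn_even hp, hypFn_even hp, D_cosFn, D_coshFn, coe_smul, coe_smul]
    simp only [cosFn, sinFn, coshFn, sinhFn, mul_one]
    rw [Real.tanh_eq_sinh_div_cosh] at this
    field_simp at this ⊢
    linear_combination this
  · have := h2 hp
    have hc := (Real.sinh_pos_iff.2 hμ).ne'
    rw [trigFn_odd hp, hypFn_odd hp, D_sinFn, D_sinhFn, coe_smul, coe_smul]
    simp only [cosFn, sinFn, coshFn, sinhFn, mul_one]
    field_simp at this ⊢
    linear_combination -this

theorem helm_vertFn_neg_one {β μ k : ℝ} {p : ℕ}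
    (h : (helm μ (vertFn p μ k) : ℝ → ℝ) 1 = -β * (D (vertFn p μ k) : ℝ → ℝ) 1) :
    (helm μ (vertFn p μ k) : ℝ → ℝ) (-1) = β * (D (vertFn p μ k) : ℝ → ℝ) (-1) := by
  have h1 : (helm μ (vertFn p μ k) : ℝ → ℝ) (-1) =
      (-1) ^ p * (helm μ (vertFn p μ k) : ℝ → ℝ) 1 := by
    rw [helm_vertFn, coe_smul, coe_smul, trigFn_neg]
    ring
  rw [h1, h, D_neg_of_parity (vertFn_neg p μ k)]
  ring

end smoothFns

/-! ### Calculus of partial derivatives -/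

theorem IsSmooth.differentiable {f : Pt → ℝ} (hf : IsSmooth f) : Differentiable ℝ f :=
  hf.1.differentiable (by simp)

theorem IsSmooth.continuous {f : Pt → ℝ} (hf : IsSmooth f) : Continuous f := hf.1.continuous

theorem contDiff_pd {f : Pt → ℝ} (hf : ContDiff ℝ ∞ f) (i : Fin 3) : ContDiff ℝ ∞ (pd i f) :=
  (hf.fderiv_right (m := ∞) (by simp)).clm_apply contDiff_const

theorem IsPeriodic.fderiv {f : Pt → ℝ} (hf : IsPeriodic f) : IsPeriodic (fderiv ℝ f) := by
  intro x y z
  have h1 : (fun P : Pt => f (P + (2 * Real.pi, 0, 0))) = f := by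
    funext ⟨x, y, z⟩
    simpa using (hf x y z).1
  have h2 : (fun P : Pt => f (P + (0, 2 * Real.pi, 0))) = f := by
    funext ⟨x, y, z⟩
    simpa using (hf x y z).2
  constructor
  · have := fderiv_comp_add_right (𝕜 := ℝ) (f := f) (x := (x, y, z)) (2 * Real.pi, 0, 0)
    rw [h1] at this
    simpa using this.symm
  · have := fderiv_comp_add_right (𝕜 := ℝ) (f := f) (x := (x, y, z)) (0, 2 * Real.pi, 0)
    rw [h2] at this
    simpa using this.symm

theorem IsSmooth.pd {f : Pt → ℝ} (hf : IsSmooth f) (i : Fin 3) : IsSmooth (pd i f) := by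
  refine ⟨contDiff_pd hf.1 i, fun x y z => ?_⟩
  have := hf.2.fderiv x y z
  exact ⟨by simp only [Stokes.pd, this.1], by simp only [Stokes.pd, this.2]⟩

theorem IsSmooth.add {f g : Pt → ℝ} (hf : IsSmooth f) (hg : IsSmooth g) :
    IsSmooth (fun P => f P + g P) :=
  ⟨hf.1.add hg.1, fun x y z => ⟨by simp only [(hf.2 x y z).1, (hg.2 x y z).1],
    by simp only [(hf.2 x y z).2, (hg.2 x y z).2]⟩⟩

theorem IsSmooth.mul {f g : Pt → ℝ} (hf : IsSmooth f) (hg : IsSmooth g) :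
    IsSmooth (fun P => f P * g P) :=
  ⟨hf.1.mul hg.1, fun x y z => ⟨by simp only [(hf.2 x y z).1, (hg.2 x y z).1],
    by simp only [(hf.2 x y z).2, (hg.2 x y z).2]⟩⟩

theorem isSmooth_const (c : ℝ) : IsSmooth (fun _ => c) :=
  ⟨contDiff_const, fun _ _ _ => ⟨rfl, rfl⟩⟩

theorem IsSmooth.const_mul {f : Pt → ℝ} (hf : IsSmooth f) (c : ℝ) : IsSmooth (fun P => c * f P) :=
  (isSmooth_const c).mul hf

theorem isSmooth_comp_z {g : ℝ → ℝ} (hg : ContDiff ℝ ∞ g) : IsSmooth (fun P => g P.2.2) :=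
  ⟨hg.comp contDiff_snd.snd, fun _ _ _ => ⟨rfl, rfl⟩⟩

theorem pd_add {f g : Pt → ℝ} (hf : Differentiable ℝ f) (hg : Differentiable ℝ g) (i : Fin 3)
    (P : Pt) : pd i (fun P => f P + g P) P = pd i f P + pd i g P := by
  simp only [pd]
  rw [fderiv_fun_add (hf P) (hg P)]
  rfl

theorem pd_const_mul {f : Pt → ℝ} (hf : Differentiable ℝ f) (c : ℝ) (i : Fin 3)
    (P : Pt) : pd i (fun P => c * f P) P = c * pd i f P := by
  simp only [pd]
  rw [fderiv_const_mul (hf P) c]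
  rfl

theorem pd_mul {f g : Pt → ℝ} (hf : Differentiable ℝ f) (hg : Differentiable ℝ g) (i : Fin 3)
    (P : Pt) : pd i (fun P => f P * g P) P = pd i f P * g P + f P * pd i g P := by
  simp only [pd]
  rw [fderiv_fun_mul (hf P) (hg P)]
  simp only [add_apply, smul_apply, smul_eq_mul]
  ring

theorem pd_const (c : ℝ) (i : Fin 3) (P : Pt) : pd i (fun _ => c) P = 0 := by
  simp [pd]

theorem hasDerivAt_pd_zero {f : Pt → ℝ} (hf : Differentiable ℝ f) (x y z : ℝ) :
    HasDerivAt (fun t => f (t, y, z)) (pd 0 f (x, y, z)) x := by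
  have h : HasDerivAt (fun t : ℝ => (t, y, z)) ((1 : ℝ), (0 : ℝ), (0 : ℝ)) x :=
    (hasDerivAt_id x).prodMk (hasDerivAt_const x (y, z))
  exact (hf (x, y, z)).hasFDerivAt.comp_hasDerivAt x h

theorem hasDerivAt_pd_one {f : Pt → ℝ} (hf : Differentiable ℝ f) (x y z : ℝ) :
    HasDerivAt (fun t => f (x, t, z)) (pd 1 f (x, y, z)) y := by
  have h : HasDerivAt (fun t : ℝ => (x, t, z)) ((0 : ℝ), (1 : ℝ), (0 : ℝ)) y :=
    (hasDerivAt_const y x).prodMk ((hasDerivAt_id y).prodMk (hasDerivAt_const y z))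
  exact (hf (x, y, z)).hasFDerivAt.comp_hasDerivAt y h

theorem hasDerivAt_pd_two {f : Pt → ℝ} (hf : Differentiable ℝ f) (x y z : ℝ) :
    HasDerivAt (fun t => f (x, y, t)) (pd 2 f (x, y, z)) z := by
  have h : HasDerivAt (fun t : ℝ => (x, y, t)) ((0 : ℝ), (0 : ℝ), (1 : ℝ)) z :=
    (hasDerivAt_const z x).prodMk ((hasDerivAt_const z y).prodMk (hasDerivAt_id z))
  exact (hf (x, y, z)).hasFDerivAt.comp_hasDerivAt z h

theorem pd_comm {f : Pt → ℝ} (hf : ContDiff ℝ ∞ f) (i j : Fin 3) (P : Pt) :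
    pd i (pd j f) P = pd j (pd i f) P := by
  have hd : DifferentiableAt ℝ (fderiv ℝ f) P :=
    ((hf.fderiv_right (m := ∞) (by simp)).differentiable (by simp)) P
  have h : ∀ i j : Fin 3, pd i (pd j f) P = fderiv ℝ (fderiv ℝ f) P
      (![((1 : ℝ), (0 : ℝ), (0 : ℝ)), (0, 1, 0), (0, 0, 1)] i)
      (![((1 : ℝ), (0 : ℝ), (0 : ℝ)), (0, 1, 0), (0, 0, 1)] j) := by
    intro i j
    have h1 : HasFDerivAt (pd j f) _ P := hd.hasFDerivAt.clm_apply (hasFDerivAt_const _ P)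
    rw [pd, h1.fderiv]
    simp
  rw [h, h]
  have h2 : (2 : WithTop ℕ∞) ≤ ∞ := WithTop.coe_le_coe.2 (le_top : (2 : ℕ∞) ≤ ⊤)
  exact (hf.contDiffAt.isSymmSndFDerivAt (by simpa using h2)) _ _

theorem pd_congr_of_eqOn {f g : Pt → ℝ} {s : Set Pt} (hs : IsOpen s) (h : EqOn f g s) {P : Pt}
    (hP : P ∈ s) (i : Fin 3) : pd i f P = pd i g P := by
  have : f =ᶠ[𝓝 P] g := h.eventuallyEq_of_mem (hs.mem_nhds hP)
  rw [pd, pd, this.fderiv_eq]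

/-! ### Integrals over the cell -/

theorem measurableSet_cell : MeasurableSet cell :=
  measurableSet_Ioo.prod (measurableSet_Ioo.prod measurableSet_Ioo)

theorem isOpen_cell : IsOpen cell := isOpen_Ioo.prod (isOpen_Ioo.prod isOpen_Ioo)

theorem ae_mem_cell : ∀ᵐ P ∂vol, P ∈ cell := ae_restrict_mem measurableSet_cell

theorem area_eq : area = (volume.restrict (Ioo 0 (2 * Real.pi))).prod
    (volume.restrict (Ioo 0 (2 * Real.pi))) := by
  rw [area, Measure.prod_restrict]
  rfl

theorem vol_eq : vol = (volume.restrict (Ioo 0 (2 * Real.pi))).prod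
    ((volume.restrict (Ioo 0 (2 * Real.pi))).prod (volume.restrict (Ioo (-1 : ℝ) 1))) := by
  rw [Measure.prod_restrict, Measure.prod_restrict, vol, cell]
  rfl

theorem integrable_restrict_of_continuous {X : Type*} [TopologicalSpace X] [MeasurableSpace X]
    [OpensMeasurableSpace X] [T2Space X] {μ : Measure X} [IsFiniteMeasureOnCompacts μ] {s K : Set X}
    (hK : IsCompact K) (hs : s ⊆ K) {f : X → ℝ} (hf : Continuous f) :
    Integrable f (μ.restrict s) :=
  (hf.continuousOn.integrableOn_compact hK).mono_set hs

theorem integrable_vol {f : Pt → ℝ} (hf : Continuous f) : Integrable f vol :=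
  integrable_restrict_of_continuous (isCompact_Icc.prod (isCompact_Icc.prod isCompact_Icc))
    (prod_mono Ioo_subset_Icc_self (prod_mono Ioo_subset_Icc_self Ioo_subset_Icc_self)) hf

theorem integrable_area {f : ℝ × ℝ → ℝ} (hf : Continuous f) : Integrable f area :=
  integrable_restrict_of_continuous (isCompact_Icc.prod isCompact_Icc)
    (prod_mono Ioo_subset_Icc_self Ioo_subset_Icc_self) hf

theorem integral_Ioo_eq_sub {F F' : ℝ → ℝ} {a b : ℝ} (hab : a ≤ b)
    (h : ∀ t, HasDerivAt F (F' t) t) (hc : Continuous F') :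
    ∫ t in Ioo a b, F' t = F b - F a := by
  rw [← integral_Ioc_eq_integral_Ioo, ← intervalIntegral.integral_of_le hab]
  exact intervalIntegral.integral_eq_sub_of_hasDerivAt (fun t _ => h t)
    (hc.intervalIntegrable _ _)

theorem integral_pd_zero {F : Pt → ℝ} (hF : IsSmooth F) : ∫ P, pd 0 F P ∂vol = 0 := by
  have hc := (hF.pd 0).continuous
  have hi := integrable_vol hc
  rw [vol_eq] at hi ⊢
  rw [integral_prod_symm _ hi]
  refine integral_eq_zero_of_ae (Eventually.of_forall fun Q => ?_)
  change ∫ x in Ioo 0 (2 * Real.pi), pd 0 F (x, Q.1, Q.2) = 0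
  rw [integral_Ioo_eq_sub (by positivity) (fun t => hasDerivAt_pd_zero hF.differentiable t Q.1 Q.2)
    (by fun_prop)]
  have := (hF.2 0 Q.1 Q.2).1
  rw [zero_add] at this
  rw [this, sub_self]

theorem integral_pd_one {F : Pt → ℝ} (hF : IsSmooth F) : ∫ P, pd 1 F P ∂vol = 0 := by
  have hc := (hF.pd 1).continuous
  have hi := integrable_vol hc
  rw [vol_eq] at hi ⊢
  rw [integral_prod _ hi]
  refine integral_eq_zero_of_ae (Eventually.of_forall fun x => ?_)
  have hi2 : Integrable (fun Q : ℝ × ℝ => pd 1 F (x, Q))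
      ((volume.restrict (Ioo 0 (2 * Real.pi))).prod (volume.restrict (Ioo (-1 : ℝ) 1))) := by
    rw [Measure.prod_restrict]
    exact integrable_restrict_of_continuous (isCompact_Icc.prod isCompact_Icc)
      (prod_mono Ioo_subset_Icc_self Ioo_subset_Icc_self) (by fun_prop)
  change ∫ Q, pd 1 F (x, Q) ∂((volume.restrict (Ioo 0 (2 * Real.pi))).prod
    (volume.restrict (Ioo (-1 : ℝ) 1))) = 0
  rw [integral_prod_symm _ hi2]
  refine integral_eq_zero_of_ae (Eventually.of_forall fun z => ?_)
  change ∫ y in Ioo 0 (2 * Real.pi), pd 1 F (x, y, z) = 0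
  rw [integral_Ioo_eq_sub (by positivity) (fun t => hasDerivAt_pd_one hF.differentiable x t z)
    (by fun_prop)]
  have := (hF.2 x 0 z).2
  rw [zero_add] at this
  rw [this, sub_self]

theorem integral_pd_two {F : Pt → ℝ} (hF : IsSmooth F) : ∫ P, pd 2 F P ∂vol =
    ∫ s, F (s.1, s.2, 1) ∂area - ∫ s, F (s.1, s.2, -1) ∂area := by
  have hc := (hF.pd 2).continuous
  have hF0 := hF.continuous
  have hi := integrable_vol hc
  have hi1 : Integrable (fun s : ℝ × ℝ => F (s.1, s.2, 1) - F (s.1, s.2, -1)) area :=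
    integrable_area (by fun_prop)
  rw [← integral_sub (integrable_area (by fun_prop)) (integrable_area (by fun_prop))]
  rw [vol_eq] at hi ⊢
  rw [area_eq] at hi1 ⊢
  rw [integral_prod _ hi, integral_prod _ hi1]
  refine integral_congr_ae (Eventually.of_forall fun x => ?_)
  have hi2 : Integrable (fun Q : ℝ × ℝ => pd 2 F (x, Q))
      ((volume.restrict (Ioo 0 (2 * Real.pi))).prod (volume.restrict (Ioo (-1 : ℝ) 1))) := by
    rw [Measure.prod_restrict]
    exact integrable_restrict_of_continuous (isCompact_Icc.prod isCompact_Icc)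
      (prod_mono Ioo_subset_Icc_self Ioo_subset_Icc_self) (by fun_prop)
  change ∫ Q, pd 2 F (x, Q) ∂((volume.restrict (Ioo 0 (2 * Real.pi))).prod
    (volume.restrict (Ioo (-1 : ℝ) 1))) = _
  rw [integral_prod _ hi2]
  refine integral_congr_ae (Eventually.of_forall fun y => ?_)
  exact integral_Ioo_eq_sub (by norm_num) (fun t => hasDerivAt_pd_two hF.differentiable x y t)
    (by fun_prop)

theorem integrable_memLp_mul {f g : Pt → ℝ} (hf : MemLp f 2 vol) (hg : Continuous g) :
    Integrable (fun P => f P * g P) vol :=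
  MemLp.integrable_mul hf (memLp_of_continuous hg)

theorem memLp_area {f : ℝ × ℝ → ℝ} (hf : Continuous f) : MemLp f 2 area := by
  refine (memLp_two_iff_integrable_sq hf.aestronglyMeasurable).2 ?_
  exact integrable_area (hf.pow 2)

theorem integrable_area_mul {f g : ℝ × ℝ → ℝ} (hf : MemLp f 2 area) (hg : Continuous g) :
    Integrable (fun P => f P * g P) area :=
  MemLp.integrable_mul hf (memLp_area hg)

/-! ### Smooth functions belong to `H¹` -/

theorem IsTest.smooth {φ : Pt → ℝ} (hφ : IsTest φ) : IsSmooth φ := hφ.1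

theorem IsTest.pd {φ : Pt → ℝ} (hφ : IsTest φ) (i : Fin 3) : IsTest (pd i φ) := by
  obtain ⟨h, r, hr, h0⟩ := hφ
  refine ⟨h.pd i, (r + 1) / 2, by linarith, fun x y z hz => ?_⟩
  have hs : IsOpen {P : Pt | r < |P.2.2|} := isOpen_lt continuous_const (by fun_prop)
  rw [pd_congr_of_eqOn (g := fun _ => 0) hs (fun P hP => h0 _ _ _ (le_of_lt hP))
    (show r < |z| by linarith), pd_const]

theorem IsTest.mul_smooth {φ f : Pt → ℝ} (hφ : IsTest φ) (hf : IsSmooth f) :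
    IsTest (fun P => φ P * f P) := by
  obtain ⟨h, r, hr, h0⟩ := hφ
  exact ⟨h.mul hf, r, hr, fun x y z hz => by simp only [h0 x y z hz, zero_mul]⟩

theorem IsTest.at_one {φ : Pt → ℝ} (hφ : IsTest φ) (x y : ℝ) :
    φ (x, y, 1) = 0 ∧ φ (x, y, -1) = 0 := by
  obtain ⟨h, r, hr, h0⟩ := hφ
  exact ⟨h0 _ _ _ (by simpa using hr.le), h0 _ _ _ (by simpa using hr.le)⟩

theorem integral_pd_mul_test {F φ : Pt → ℝ} (hF : IsSmooth F) (hφ : IsTest φ) (i : Fin 3) :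
    ∫ P, pd i (fun P => F P * φ P) P ∂vol = 0 := by
  have h := hF.mul hφ.smooth
  fin_cases i
  · exact integral_pd_zero h
  · exact integral_pd_one h
  · refine (integral_pd_two h).trans ?_
    simp [hφ.at_one]

theorem hasWeakPartial_of_smooth {f : Pt → ℝ} (hf : IsSmooth f) (i : Fin 3) :
    HasWeakPartial i f (pd i f) := by
  intro φ hφ
  have h := integral_pd_mul_test hf hφ i
  simp only [pd_mul hf.differentiable hφ.smooth.differentiable] at h
  have h1 : Integrable (fun P => pd i f P * φ P) vol :=
    integrable_vol ((hf.pd i).continuous.mul hφ.smooth.continuous)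
  have h2 : Integrable (fun P => f P * pd i φ P) vol :=
    integrable_vol (hf.continuous.mul (hφ.smooth.pd i).continuous)
  rw [integral_add h1 h2] at h
  linarith

theorem isH1_of_smooth {f : Pt → ℝ} (hf : IsSmooth f) :
    IsH1 f (fun i => pd i f) (fun s => f (s.1, s.2, 1)) (fun s => f (s.1, s.2, -1)) where
  memLp := memLp_of_continuous hf.continuous
  memLp_grad i := memLp_of_continuous (hf.pd i).continuous
  weak_grad i := hasWeakPartial_of_smooth hf i
  memLp_top := by
    have := hf.continuous
    exact memLp_area (by fun_prop)
  memLp_bot := by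
    have := hf.continuous
    exact memLp_area (by fun_prop)
  green φ hφ := by
    have h := integral_pd_two (hf.mul hφ)
    simp only [pd_mul hf.differentiable hφ.differentiable] at h
    rw [← h]
    exact integral_congr_ae (Eventually.of_forall fun P => add_comm _ _)

theorem IsH1.congr_ae {f g : Pt → ℝ} {G : Fin 3 → Pt → ℝ} {top bot : ℝ × ℝ → ℝ}
    (h : IsH1 f G top bot) (hfg : f =ᵐ[vol] g) : IsH1 g G top bot where
  memLp := h.memLp.ae_eq hfg
  memLp_grad := h.memLp_grad
  weak_grad i φ hφ := by
    rw [← h.weak_grad i φ hφ]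
    refine integral_congr_ae ?_
    filter_upwards [hfg] with P hP
    rw [hP]
  memLp_top := h.memLp_top
  memLp_bot := h.memLp_bot
  green φ hφ := by
    rw [← h.green φ hφ]
    refine integral_congr_ae ?_
    filter_upwards [hfg] with P hP
    rw [hP]

/-! ### Integration by parts against functions that do not vanish on the boundary -/

/-- A cutoff in `z`: it vanishes near `z = ±1`, and tends to `1` on `(-1, 1)` as `n → ∞`. -/
def cutoff (n : ℕ) (z : ℝ) : ℝ := Real.smoothTransition (n * (1 - z ^ 2) - 1)

theorem contDiff_cutoff (n : ℕ) : ContDiff ℝ ∞ (cutoff n) :=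
  Real.smoothTransition.contDiff.comp (by fun_prop)

theorem cutoff_nonneg (n : ℕ) (z : ℝ) : 0 ≤ cutoff n z := Real.smoothTransition.nonneg _

theorem abs_cutoff_le (n : ℕ) (z : ℝ) : |cutoff n z| ≤ 1 := by
  rw [abs_of_nonneg (cutoff_nonneg n z)]
  exact Real.smoothTransition.le_one _

theorem isTest_cutoff (n : ℕ) : IsTest (fun P => cutoff n P.2.2) := by
  refine ⟨isSmooth_comp_z (contDiff_cutoff n), √(1 - 1 / (n + 1)), ?_, fun x y z hz => ?_⟩
  · rw [Real.sqrt_lt' one_pos, one_pow]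
    have : (0 : ℝ) < 1 / (n + 1) := by positivity
    linarith
  · refine Real.smoothTransition.zero_of_nonpos ?_
    have h1 : 1 - 1 / ((n : ℝ) + 1) ≤ z ^ 2 := by
      have := Real.sqrt_le_left (abs_nonneg z) |>.1 hz
      rwa [sq_abs] at this
    have h2 : (n : ℝ) * (1 - z ^ 2) ≤ n * (1 / (n + 1)) :=
      mul_le_mul_of_nonneg_left (by linarith) (Nat.cast_nonneg n)
    have h3 : (n : ℝ) * (1 / (n + 1)) ≤ 1 := by
      rw [mul_one_div, div_le_one (by positivity)]
      linarith
    linarith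

theorem cutoff_eventually_eq {z : ℝ} (hz : z ∈ Ioo (-1 : ℝ) 1) : ∀ᶠ n in atTop, cutoff n z = 1 := by
  have h1 : 0 < 1 - z ^ 2 := by nlinarith [hz.1, hz.2]
  have h2 : Tendsto (fun n : ℕ => (n : ℝ) * (1 - z ^ 2)) atTop atTop :=
    tendsto_natCast_atTop_atTop.atTop_mul_const h1
  filter_upwards [h2.eventually_ge_atTop 2] with n hn
  exact Real.smoothTransition.one_of_one_le (by linarith)

theorem tendsto_integral_cutoff {f : Pt → ℝ} (hf : Integrable f vol) :
    Tendsto (fun n => ∫ P, cutoff n P.2.2 * f P ∂vol) atTop (𝓝 (∫ P, f P ∂vol)) := by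
  refine tendsto_integral_of_dominated_convergence (fun P => ‖f P‖) (fun n => ?_) hf.norm
    (fun n => Eventually.of_forall fun P => ?_) ?_
  · exact ((contDiff_cutoff n).continuous.comp (by fun_prop)).aestronglyMeasurable.mul
      hf.aestronglyMeasurable
  · rw [norm_mul, Real.norm_eq_abs (cutoff _ _)]
    exact mul_le_of_le_one_left (norm_nonneg _) (abs_cutoff_le _ _)
  · filter_upwards [ae_mem_cell] with P hP
    refine tendsto_const_nhds.congr' ?_
    filter_upwards [cutoff_eventually_eq hP.2.2] with n hn
    rw [hn, one_mul]

theorem pd_cutoff_mul {ψ : Pt → ℝ} (hψ : IsSmooth ψ) (n : ℕ) {i : Fin 3} (hi : i ≠ 2) (P : Pt) :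
    pd i (fun P => cutoff n P.2.2 * ψ P) P = cutoff n P.2.2 * pd i ψ P := by
  have h := (isTest_cutoff n).smooth.differentiable
  rw [pd_mul h hψ.differentiable]
  have h0 : pd i (fun P => cutoff n P.2.2) P = 0 := by
    obtain ⟨x, y, z⟩ := P
    have hc := hasDerivAt_const (𝕜 := ℝ) (F := ℝ)
    fin_cases i
    · exact (hasDerivAt_pd_zero h x y z).unique (hc x (cutoff n z))
    · exact (hasDerivAt_pd_one h x y z).unique (hc y (cutoff n z))
    · exact absurd rfl hi
  rw [h0, zero_mul, zero_add]

theorem IsH1.integral_mul_pd {f : Pt → ℝ} {G : Fin 3 → Pt → ℝ} {top bot : ℝ × ℝ → ℝ}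
    (h : IsH1 f G top bot) {ψ : Pt → ℝ} (hψ : IsSmooth ψ) {i : Fin 3} (hi : i ≠ 2) :
    ∫ P, f P * pd i ψ P ∂vol = -∫ P, G i P * ψ P ∂vol := by
  have h1 := tendsto_integral_cutoff (integrable_memLp_mul h.memLp (hψ.pd i).continuous)
  have h2 := (tendsto_integral_cutoff
    (integrable_memLp_mul (h.memLp_grad i) hψ.continuous)).neg
  refine tendsto_nhds_unique h1 (h2.congr fun n => ?_)
  have h3 := h.weak_grad i _ ((isTest_cutoff n).mul_smooth hψ)
  simp only [pd_cutoff_mul hψ n hi] at h3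
  have e1 : ∀ P : Pt, f P * (cutoff n P.2.2 * pd i ψ P) = cutoff n P.2.2 * (f P * pd i ψ P) :=
    fun P => mul_left_comm _ _ _
  have e2 : ∀ P : Pt, G i P * (cutoff n P.2.2 * ψ P) = cutoff n P.2.2 * (G i P * ψ P) :=
    fun P => mul_left_comm _ _ _
  simp only [e1, e2] at h3
  exact h3.symm

/-- Fields in `V_𝒫` are divergence free, also when tested against functions that do not vanish on
the boundary. -/
theorem IsVP.integral_div_mul {v : L2} {G : Fin 3 → Fin 3 → Pt → ℝ} {top bot : Fin 3 → ℝ × ℝ → ℝ}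
    (h : IsVP v G top bot) {ψ : Pt → ℝ} (hψ : IsSmooth ψ) :
    ∫ P, (∑ i, G i i P) * ψ P ∂vol = 0 := by
  have hint : ∀ {ψ : Pt → ℝ}, IsSmooth ψ → ∀ i, Integrable (fun P => G i i P * ψ P) vol :=
    fun hψ i => integrable_memLp_mul ((h.h1 i).memLp_grad i) hψ.continuous
  have htest : ∀ φ, IsTest φ → ∫ P, (∑ i, G i i P) * φ P ∂vol = 0 := by
    intro φ hφ
    have h1 := h.mem φ hφ.smooth
    rw [integral_finsetSum _ fun i _ => integrable_comp_mul_pd v hφ.smooth.1 i] at h1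
    simp only [Finset.sum_mul]
    rw [integral_finsetSum _ fun i _ => hint hφ.smooth i]
    have h2 : ∀ i, ∫ P, G i i P * φ P ∂vol = -∫ P, v P i * pd i φ P ∂vol := fun i => by
      rw [(h.h1 i).weak_grad i φ hφ, neg_neg]
    simp only [h2, Finset.sum_neg_distrib, h1, neg_zero]
  have hI : Integrable (fun P => (∑ i, G i i P) * ψ P) vol := by
    simp only [Finset.sum_mul]
    exact integrable_finsetSum _ fun i _ => hint hψ i
  refine tendsto_nhds_unique (tendsto_integral_cutoff hI) (tendsto_const_nhds.congr fun n => ?_)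
  rw [← htest _ ((isTest_cutoff n).mul_smooth hψ)]
  exact integral_congr_ae (Eventually.of_forall fun P => mul_left_comm _ _ _)

/-- The normal trace of a field in `V_𝒫` vanishes. -/
theorem IsVP.flux_eq_zero {v : L2} {G : Fin 3 → Fin 3 → Pt → ℝ} {top bot : Fin 3 → ℝ × ℝ → ℝ}
    (h : IsVP v G top bot) {ψ : Pt → ℝ} (hψ : IsSmooth ψ) :
    ∫ s, top 2 s * ψ (s.1, s.2, 1) ∂area - ∫ s, bot 2 s * ψ (s.1, s.2, -1) ∂area = 0 := by
  have hG : ∀ i, Integrable (fun P => G i i P * ψ P) vol :=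
    fun i => integrable_memLp_mul ((h.h1 i).memLp_grad i) hψ.continuous
  have h1 := h.integral_div_mul hψ
  have h2 := h.mem ψ hψ
  simp only [Finset.sum_mul] at h1
  rw [integral_finsetSum _ fun i _ => hG i, Fin.sum_univ_three] at h1
  rw [integral_finsetSum _ fun i _ => integrable_comp_mul_pd v hψ.1 i, Fin.sum_univ_three] at h2
  rw [← (h.h1 2).green ψ hψ, integral_add (integrable_comp_mul_pd v hψ.1 2) (hG 2)]
  have h3 := (h.h1 0).integral_mul_pd hψ (i := 0) (by decide)
  have h4 := (h.h1 1).integral_mul_pd hψ (i := 1) (by decide)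
  linarith

/-! ### Pointwise solutions are weak solutions -/

theorem inner_eq_integral (u v : L2) : inner ℝ u v = ∫ P, ∑ i, u P i * v P i ∂vol := by
  rw [L2.inner_def]
  refine integral_congr_ae (Eventually.of_forall fun P => ?_)
  simp only [PiLp.inner_apply, RCLike.inner_apply, conj_trivial]
  exact Finset.sum_congr rfl fun i _ => mul_comm _ _

theorem integral_mul_add_pd {f g : Pt → ℝ} (hf : IsSmooth f) (hg : IsSmooth g) (i : Fin 3) :
    ∫ P, f P * pd i g P ∂vol = ∫ P, pd i (fun P => f P * g P) P ∂vol
      - ∫ P, pd i f P * g P ∂vol := by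
  have h1 : Integrable (fun P => pd i f P * g P) vol :=
    integrable_vol ((hf.pd i).continuous.mul hg.continuous)
  have h2 : Integrable (fun P => f P * pd i g P) vol :=
    integrable_vol (hf.continuous.mul (hg.pd i).continuous)
  simp only [pd_mul hf.differentiable hg.differentiable]
  rw [integral_add h1 h2]
  ring

namespace IsClassicalSolution

variable {β ℓ : ℝ} {U : Pt → Vec} {q : Pt → ℝ}

theorem mem_HP (h : IsClassicalSolution β ℓ U q) {u : L2} (hu : u =ᵐ[vol] U) : u ∈ HP := by
  intro φ hφ
  have e1 : ∫ P, ∑ i, u P i * pd i φ P ∂vol = ∑ i, ∫ P, U P i * pd i φ P ∂vol := by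
    rw [← integral_finsetSum]
    · refine integral_congr_ae ?_
      filter_upwards [hu] with P hP
      rw [hP]
    · exact fun i _ => integrable_vol ((h.smooth_u i).continuous.mul (hφ.pd i).continuous)
  have e2 : ∑ i, ∫ P, pd i (fun P => U P i) P * φ P ∂vol = 0 := by
    rw [← integral_finsetSum]
    · refine integral_eq_zero_of_ae ?_
      filter_upwards [ae_mem_cell] with P hP
      obtain ⟨x, y, z⟩ := P
      rw [← Finset.sum_mul, h.div_zero x y z hP.2.2, zero_mul]
      rfl
    · exact fun i _ => integrable_vol (((h.smooth_u i).pd i).continuous.mul hφ.continuous)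
  rw [e1]
  simp only [integral_mul_add_pd (h.smooth_u _) hφ]
  rw [Finset.sum_sub_distrib, e2, Fin.sum_univ_three, integral_pd_zero ((h.smooth_u 0).mul hφ),
    integral_pd_one ((h.smooth_u 1).mul hφ), integral_pd_two ((h.smooth_u 2).mul hφ)]
  simp [h.normal]

theorem isVP (h : IsClassicalSolution β ℓ U q) {u : L2} (hu : u =ᵐ[vol] U) :
    IsVP u (fun i j => pd j (fun P => U P i)) (fun i s => U (s.1, s.2, 1) i)
      (fun i s => U (s.1, s.2, -1) i) where
  mem := h.mem_HP hu
  h1 i := (isH1_of_smooth (h.smooth_u i)).congr_ae (by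
    filter_upwards [hu] with P hP
    rw [hP])

/-- The divergence of twice the strain. -/
theorem div_strain (h : IsClassicalSolution β ℓ U q) {P : Pt} (hP : P.2.2 ∈ Ioo (-1 : ℝ) 1)
    (i : Fin 3) :
    ∑ j, pd j (fun P => pd j (fun P => U P i) P + pd i (fun P => U P j) P) P =
      pd i q P - ℓ * U P i := by
  have h1 : ∀ j, pd j (fun P => pd j (fun P => U P i) P + pd i (fun P => U P j) P) P =
      pd j (pd j (fun P => U P i)) P + pd i (pd j (fun P => U P j)) P := by
    intro j
    rw [pd_add ((h.smooth_u i).pd j).differentiable ((h.smooth_u j).pd i).differentiable,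
      pd_comm (h.smooth_u j).1]
  have hs : IsOpen {P : Pt | P.2.2 ∈ Ioo (-1 : ℝ) 1} := isOpen_Ioo.preimage (by fun_prop)
  have h2 : pd i (fun P => ∑ j, pd j (fun P => U P j) P) P = 0 := by
    rw [pd_congr_of_eqOn (g := fun _ => 0) hs (fun Q hQ => h.div_zero Q.1 Q.2.1 Q.2.2 hQ) hP,
      pd_const]
  have h3 : ∑ j, pd i (pd j (fun P => U P j)) P = 0 := by
    rw [← h2]
    simp only [Fin.sum_univ_three]
    rw [pd_add (((h.smooth_u 0).pd 0).add ((h.smooth_u 1).pd 1)).differentiable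
      ((h.smooth_u 2).pd 2).differentiable, pd_add ((h.smooth_u 0).pd 0).differentiable
      ((h.smooth_u 1).pd 1).differentiable]
  have h4 := h.momentum P.1 P.2.1 P.2.2 hP i
  simp only [h1, Finset.sum_add_distrib, h3, add_zero]
  rw [lap] at h4
  linarith

/-- A pointwise solution satisfies the weak form of the eigenvalue problem. -/
theorem weak (h : IsClassicalSolution β ℓ U q) {u : L2} (hu : u =ᵐ[vol] U) {φ : L2}
    {H : Fin 3 → Fin 3 → Pt → ℝ} {ftop fbot : Fin 3 → ℝ × ℝ → ℝ} (hφ : IsVP φ H ftop fbot) :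
    2 * ∫ P, strainDot (fun i j => pd j (fun P => U P i)) H P ∂vol
        + β * (∫ Q, tangDot (fun i s => U (s.1, s.2, 1) i) ftop Q ∂area
          + ∫ Q, tangDot (fun i s => U (s.1, s.2, -1) i) fbot Q ∂area)
      = ℓ * inner ℝ u φ := by
  have hUc : ∀ i, Continuous (fun P => U P i) := fun i => (h.smooth_u i).continuous
  set S : Fin 3 → Fin 3 → Pt → ℝ :=
    fun i j P => pd j (fun P => U P i) P + pd i (fun P => U P j) P with hS
  have hSs : ∀ i j, IsSmooth (S i j) := fun i j =>
    ((h.smooth_u i).pd j).add ((h.smooth_u j).pd i)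
  have hSc : ∀ i j, Continuous (S i j) := fun i j => (hSs i j).continuous
  have iHS : ∀ i j, Integrable (fun P => H i j P * S i j P) vol := fun i j =>
    integrable_memLp_mul ((hφ.h1 i).memLp_grad j) (hSc i j)
  have iφS : ∀ i j k, Integrable (fun P => φ P i * pd k (S i j) P) vol := fun i j k =>
    integrable_memLp_mul (hφ.h1 i).memLp ((hSs i j).pd k).continuous
  have e1 : 2 * ∫ P, strainDot (fun i j => pd j (fun P => U P i)) H P ∂vol =
      ∑ i, ∑ j, ∫ P, H i j P * S i j P ∂vol := by
    have e2 : ∀ i, ∑ j, ∫ P, H i j P * S i j P ∂vol = ∫ P, ∑ j, H i j P * S i j P ∂vol :=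
      fun i => (integral_finsetSum _ fun j _ => iHS i j).symm
    simp only [e2]
    rw [← integral_finsetSum _ fun i _ => integrable_finsetSum _ fun j _ => iHS i j,
      ← integral_const_mul]
    refine integral_congr_ae (Eventually.of_forall fun P => ?_)
    simp only [strainDot, hS, Fin.sum_univ_three]
    ring
  have e3 : ∀ i, ∑ j, ∫ P, H i j P * S i j P ∂vol =
      -∫ P, φ P i * ∑ j, pd j (S i j) P ∂vol
        + (∫ s, ftop i s * S i 2 (s.1, s.2, 1) ∂area
          - ∫ s, fbot i s * S i 2 (s.1, s.2, -1) ∂area) := by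
    intro i
    have h0 := (hφ.h1 i).integral_mul_pd (hSs i 0) (i := 0) (by decide)
    have h1 := (hφ.h1 i).integral_mul_pd (hSs i 1) (i := 1) (by decide)
    have h2 := (hφ.h1 i).green _ (hSs i 2)
    rw [integral_add (iφS i 2 2) (iHS i 2)] at h2
    simp only [Finset.mul_sum]
    rw [integral_finsetSum _ fun j _ => iφS i j j, Fin.sum_univ_three, Fin.sum_univ_three, ← h2]
    linarith
  have iφq : ∀ i, Integrable (fun P => φ P i * pd i q P) vol :=
    fun i => integrable_comp_mul_pd φ h.smooth_q.1 i
  have iφU : ∀ i, Integrable (fun P => φ P i * U P i) vol := fun i =>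
    integrable_memLp_mul (hφ.h1 i).memLp (hUc i)
  have e4 : ∀ i, ∫ P, φ P i * ∑ j, pd j (S i j) P ∂vol =
      ∫ P, φ P i * pd i q P ∂vol - ℓ * ∫ P, φ P i * U P i ∂vol := by
    intro i
    rw [← integral_const_mul, ← integral_sub (iφq i) ((iφU i).const_mul ℓ)]
    refine integral_congr_ae ?_
    filter_upwards [ae_mem_cell] with P hP
    simp only [hS, h.div_strain hP.2.2 i]
    ring
  have e5 : ∑ i, ∫ P, φ P i * pd i q P ∂vol = 0 := by
    rw [← integral_finsetSum _ fun i _ => iφq i]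
    exact hφ.mem q h.smooth_q
  have e6 : ∑ i, ∫ P, φ P i * U P i ∂vol = inner ℝ u φ := by
    rw [inner_eq_integral, ← integral_finsetSum _ fun i _ => iφU i]
    refine integral_congr_ae ?_
    filter_upwards [hu] with P hP
    rw [hP]
    exact Finset.sum_congr rfl fun i _ => mul_comm _ _
  have htop : ∀ i : Fin 3, i = 0 ∨ i = 1 → ∀ x y, S i 2 (x, y, 1) = -β * U (x, y, 1) i := by
    intro i hi x y
    have := h.slip x y 1 (Or.inl rfl) i hi
    simp only [hS]
    linarith
  have hbot : ∀ i : Fin 3, i = 0 ∨ i = 1 → ∀ x y, S i 2 (x, y, -1) = β * U (x, y, -1) i := by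
    intro i hi x y
    have := h.slip x y (-1) (Or.inr rfl) i hi
    simp only [hS]
    linarith
  have itop : ∀ i, Integrable (fun s : ℝ × ℝ => U (s.1, s.2, 1) i * ftop i s) area := by
    intro i
    have := integrable_area_mul (hφ.h1 i).memLp_top (g := fun s => U (s.1, s.2, 1) i)
      ((hUc i).comp (by fun_prop))
    simpa only [mul_comm] using this
  have ibot : ∀ i, Integrable (fun s : ℝ × ℝ => U (s.1, s.2, -1) i * fbot i s) area := by
    intro i
    have := integrable_area_mul (hφ.h1 i).memLp_bot (g := fun s => U (s.1, s.2, -1) i)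
      ((hUc i).comp (by fun_prop))
    simpa only [mul_comm] using this
  have e7 : ∀ i : Fin 3, i = 0 ∨ i = 1 →
      ∫ s, ftop i s * S i 2 (s.1, s.2, 1) ∂area - ∫ s, fbot i s * S i 2 (s.1, s.2, -1) ∂area =
      -β * (∫ s, U (s.1, s.2, 1) i * ftop i s ∂area
        + ∫ s, U (s.1, s.2, -1) i * fbot i s ∂area) := by
    intro i hi
    simp only [htop i hi, hbot i hi]
    have a1 : ∀ s : ℝ × ℝ, ftop i s * (-β * U (s.1, s.2, 1) i) =
      -β * (U (s.1, s.2, 1) i * ftop i s) := fun s => by ring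
    have a2 : ∀ s : ℝ × ℝ, fbot i s * (β * U (s.1, s.2, -1) i) =
      β * (U (s.1, s.2, -1) i * fbot i s) := fun s => by ring
    simp only [a1, a2]
    rw [integral_const_mul, integral_const_mul]
    ring
  have e8 := hφ.flux_eq_zero (hSs 2 2)
  have e9 : ∫ Q, tangDot (fun i s => U (s.1, s.2, 1) i) ftop Q ∂area =
      ∫ s, U (s.1, s.2, 1) 0 * ftop 0 s ∂area + ∫ s, U (s.1, s.2, 1) 1 * ftop 1 s ∂area := by
    rw [← integral_add (itop 0) (itop 1)]
    rfl
  have e10 : ∫ Q, tangDot (fun i s => U (s.1, s.2, -1) i) fbot Q ∂area =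
      ∫ s, U (s.1, s.2, -1) 0 * fbot 0 s ∂area + ∫ s, U (s.1, s.2, -1) 1 * fbot 1 s ∂area := by
    rw [← integral_add (ibot 0) (ibot 1)]
    rfl
  rw [e1, e9, e10]
  simp only [e3, e4]
  rw [Finset.sum_add_distrib, Finset.sum_neg_distrib, Finset.sum_sub_distrib, e5, ← Finset.mul_sum,
    e6, Fin.sum_univ_three, e8, e7 0 (Or.inl rfl), e7 1 (Or.inr rfl)]
  ring

/-- A nonzero pointwise solution is an eigenfunction. -/
theorem isEigenfunction (h : IsClassicalSolution β ℓ U q) {u : L2} (hu : u =ᵐ[vol] U)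
    (h0 : u ≠ 0) : IsEigenfunction β ℓ u :=
  ⟨h0, _, _, _, h.isVP hu, fun _ _ _ _ hφ => h.weak hu hφ⟩

/-- The pressure of a pointwise solution is a pressure in the sense of distributions. -/
theorem isPressure (h : IsClassicalSolution β ℓ U q) {u : L2} (hu : u =ᵐ[vol] U) :
    IsPressure ℓ u q := by
  refine ⟨memLp_of_continuous h.smooth_q.continuous, fun i φ hφ => ?_⟩
  have hUs := h.smooth_u i
  have i1 : ∀ j, Integrable (fun P => U P i * pd j (pd j φ) P) vol := fun j =>
    integrable_vol (hUs.continuous.mul ((hφ.pd j).pd j).smooth.continuous)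
  have i2 : ∀ j, Integrable (fun P => pd j (pd j (fun P => U P i)) P * φ P) vol := fun j =>
    integrable_vol (((hUs.pd j).pd j).continuous.mul hφ.smooth.continuous)
  have i3 : Integrable (fun P => q P * pd i φ P) vol :=
    integrable_vol (h.smooth_q.continuous.mul (hφ.pd i).smooth.continuous)
  have i4 : Integrable (fun P => pd i q P * φ P) vol :=
    integrable_vol ((h.smooth_q.pd i).continuous.mul hφ.smooth.continuous)
  have e1 : ∫ P, U P i * lap φ P ∂vol = ∫ P, lap (fun P => U P i) P * φ P ∂vol := by
    simp only [lap, Finset.mul_sum, Finset.sum_mul]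
    rw [integral_finsetSum _ fun j _ => i1 j, integral_finsetSum _ fun j _ => i2 j]
    refine Finset.sum_congr rfl fun j _ => ?_
    rw [hasWeakPartial_of_smooth hUs j _ (hφ.pd j),
      hasWeakPartial_of_smooth (hUs.pd j) j _ hφ, neg_neg]
  have i5 : Integrable (fun P => U P i * lap φ P) vol := by
    simp only [lap, Finset.mul_sum]
    exact integrable_finsetSum _ fun j _ => i1 j
  have i6 : Integrable (fun P => lap (fun P => U P i) P * φ P) vol := by
    simp only [lap, Finset.sum_mul]
    exact integrable_finsetSum _ fun j _ => i2 j
  have e2 := hasWeakPartial_of_smooth h.smooth_q i φ hφ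
  have e3 : ∫ P, (-(u P i * lap φ P) - q P * pd i φ P) ∂vol =
      ∫ P, (-(U P i * lap φ P) - q P * pd i φ P) ∂vol := by
    refine integral_congr_ae ?_
    filter_upwards [hu] with P hP
    rw [hP]
  have e4 : ∫ P, u P i * φ P ∂vol = ∫ P, U P i * φ P ∂vol := by
    refine integral_congr_ae ?_
    filter_upwards [hu] with P hP
    rw [hP]
  have i7 : Integrable (fun P => -(U P i * lap φ P)) vol := i5.neg
  have i8 : Integrable (fun P => -(lap (fun P => U P i) P * φ P)) vol := i6.neg
  rw [e3, e4, integral_sub i7 i3, integral_neg, e1, e2, ← integral_const_mul,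
    ← integral_neg, sub_neg_eq_add, ← integral_add i8 i4]
  refine integral_congr_ae ?_
  filter_upwards [ae_mem_cell] with P hP
  have := h.momentum P.1 P.2.1 P.2.2 hP.2.2 i
  linear_combination (φ P) * this

end IsClassicalSolution

theorem strainDot_comm (G H : Fin 3 → Fin 3 → Pt → ℝ) (P : Pt) :
    strainDot G H P = strainDot H G P := by
  simp only [strainDot, mul_comm]

theorem tangDot_comm (s t : Fin 3 → ℝ × ℝ → ℝ) (Q : ℝ × ℝ) : tangDot s t Q = tangDot t s Q := by
  simp only [tangDot, mul_comm]

/-- Eigenfunctions are orthogonal to pointwise solutions with a different eigenvalue. -/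
theorem IsEigenfunction.inner_eq_zero {β ℓ ℓ' : ℝ} {u : L2} (hu : IsEigenfunction β ℓ u)
    {U : Pt → Vec} {q : Pt → ℝ} (h : IsClassicalSolution β ℓ' U q) {v : L2} (hv : v =ᵐ[vol] U)
    (hne : ℓ ≠ ℓ') : inner ℝ v u = 0 := by
  obtain ⟨-, G, top, bot, hVP, hweak⟩ := hu
  have h1 := hweak v _ _ _ (h.isVP hv)
  have h2 := h.weak hv hVP
  simp only [strainDot_comm G, tangDot_comm top, tangDot_comm bot] at h1
  rw [h1, real_inner_comm] at h2
  have h3 : (ℓ - ℓ') * inner ℝ v u = 0 := by linarith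
  exact (mul_eq_zero.1 h3).resolve_left (sub_ne_zero.2 hne)

/-! ### Linear combinations of pointwise solutions -/

theorem IsClassicalSolution.add {β ℓ : ℝ} {U V : Pt → Vec} {q r : Pt → ℝ}
    (h : IsClassicalSolution β ℓ U q) (h' : IsClassicalSolution β ℓ V r) :
    IsClassicalSolution β ℓ (fun P => U P + V P) (fun P => q P + r P) := by
  have hU := fun i => (h.smooth_u i).differentiable
  have hV := fun i => (h'.smooth_u i).differentiable
  have hpd : ∀ i j, pd i (fun P => U P j + V P j) =
      fun P => pd i (fun P => U P j) P + pd i (fun P => V P j) P :=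
    fun i j => funext fun P => pd_add (hU j) (hV j) i P
  refine ⟨fun i => (h.smooth_u i).add (h'.smooth_u i), h.smooth_q.add h'.smooth_q, ?_, ?_, ?_, ?_⟩
  · intro x y z hz i
    have h1 := h.momentum x y z hz i
    have h2 := h'.momentum x y z hz i
    simp only [lap, hpd, pd_add ((h.smooth_u i).pd _).differentiable
      ((h'.smooth_u i).pd _).differentiable, Finset.sum_add_distrib,
      pd_add h.smooth_q.differentiable h'.smooth_q.differentiable, PiLp.add_apply] at h1 h2 ⊢
    linarith
  · intro x y z hz
    simp only [PiLp.add_apply, hpd, Finset.sum_add_distrib, h.div_zero x y z hz,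
      h'.div_zero x y z hz, add_zero]
  · intro x y s hs
    rw [PiLp.add_apply, h.normal x y s hs, h'.normal x y s hs, add_zero]
  · intro x y s hs j hj
    have h1 := h.slip x y s hs j hj
    have h2 := h'.slip x y s hs j hj
    simp only [PiLp.add_apply, hpd]
    linarith

theorem IsClassicalSolution.smul {β ℓ : ℝ} {U : Pt → Vec} {q : Pt → ℝ}
    (h : IsClassicalSolution β ℓ U q) (c : ℝ) :
    IsClassicalSolution β ℓ (fun P => c • U P) (fun P => c * q P) := by
  have hU := fun i => (h.smooth_u i).differentiable
  have hpd : ∀ i j, pd i (fun P => c * U P j) = fun P => c * pd i (fun P => U P j) P :=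
    fun i j => funext fun P => pd_const_mul (hU j) c i P
  refine ⟨fun i => (h.smooth_u i).const_mul c, h.smooth_q.const_mul c, ?_, ?_, ?_, ?_⟩
  · intro x y z hz i
    have h1 := h.momentum x y z hz i
    simp only [lap, hpd, pd_const_mul ((h.smooth_u i).pd _).differentiable, ← Finset.mul_sum,
      pd_const_mul h.smooth_q.differentiable, PiLp.smul_apply, smul_eq_mul] at h1 ⊢
    linear_combination c * h1
  · intro x y z hz
    simp only [PiLp.smul_apply, smul_eq_mul, hpd, ← Finset.mul_sum, h.div_zero x y z hz, mul_zero]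
  · intro x y s hs
    rw [PiLp.smul_apply, h.normal x y s hs, smul_zero]
  · intro x y s hs j hj
    have h1 := h.slip x y s hs j hj
    simp only [PiLp.smul_apply, smul_eq_mul, hpd]
    linear_combination c * h1

theorem isClassicalSolution_zero (β ℓ : ℝ) :
    IsClassicalSolution β ℓ (fun _ => 0) (fun _ => 0) := by
  have hpd : ∀ i, pd i (fun _ : Pt => (0 : ℝ)) = fun _ => 0 := fun i => funext (pd_const 0 i)
  refine ⟨fun i => isSmooth_const 0, isSmooth_const 0, ?_, ?_, ?_, ?_⟩ <;>
    simp [lap, hpd, PiLp.zero_apply]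

/-- In the span of fields that have representatives solving the problem pointwise with a pressure
satisfying `p`, a property stable under linear combinations, every field has such a
representative. -/
theorem exists_classical_of_mem_span {β ℓ : ℝ} {p : (Pt → ℝ) → Prop} (hp0 : p fun _ => 0)
    (hpadd : ∀ q r, p q → p r → p fun P => q P + r P)
    (hpmul : ∀ (c : ℝ) q, p q → p fun P => c * q P)
    {s : Set L2}
    (hs : ∀ u ∈ s, ∃ U q, IsClassicalSolution β ℓ U q ∧ u =ᵐ[vol] U ∧ p q) {u : L2}
    (hu : u ∈ Submodule.span ℝ s) : ∃ U q, IsClassicalSolution β ℓ U q ∧ u =ᵐ[vol] U ∧ p q := by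
  induction hu using Submodule.span_induction with
  | mem u hu => exact hs u hu
  | zero => exact ⟨_, _, isClassicalSolution_zero β ℓ, Lp.coeFn_zero Vec 2 vol, hp0⟩
  | add u v _ _ hu hv =>
    obtain ⟨U, q, h1, h2, h3⟩ := hu
    obtain ⟨V, r, k1, k2, k3⟩ := hv
    refine ⟨_, _, h1.add k1, ?_, hpadd _ _ h3 k3⟩
    filter_upwards [Lp.coeFn_add u v, h2, k2] with P hP h k
    rw [hP, Pi.add_apply, h, k]
  | smul c u _ hu =>
    obtain ⟨U, q, h1, h2, h3⟩ := hu
    refine ⟨_, _, h1.smul c, ?_, hpmul c _ h3⟩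
    filter_upwards [Lp.coeFn_smul c u, h2] with P hP h
    rw [hP, Pi.smul_apply, h]

/-! ### Horizontal factors -/

/-- The function `∂_y 𝒫ᵘ / n = ∂_x 𝒫ᵛ / m`, which closes the system of derivatives of `𝒫ᵘ`, `𝒫ᵛ`,
`𝒫`. -/
def perQ (m n : ℕ) (κ : Fin 4 → ℝ) (x y : ℝ) : ℝ :=
  κ 0 * Real.cos (m * x) * Real.cos (n * y) - κ 1 * Real.sin (m * x) * Real.cos (n * y)
    + κ 2 * Real.sin (m * x) * Real.sin (n * y) - κ 3 * Real.cos (m * x) * Real.sin (n * y)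

theorem hasDerivAt_trig (A B k t : ℝ) :
    HasDerivAt (fun t => A * Real.cos (k * t) + B * Real.sin (k * t))
      (k * (B * Real.cos (k * t) - A * Real.sin (k * t))) t := by
  have h := smoothFns.hasDerivAt_const_mul' k t
  refine ((h.cos.const_mul A).add (h.sin.const_mul B)).congr_deriv ?_
  ring

section derivatives

variable (m n : ℕ) (κ : Fin 4 → ℝ) (x y : ℝ)

theorem perU_dx : HasDerivAt (fun t => perU m n κ t y) (-(m * perW m n κ x y)) x := by
  refine ((hasDerivAt_trig (κ 0 * Real.sin (n * y) + κ 3 * Real.cos (n * y))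
    (-κ 1 * Real.sin (n * y) - κ 2 * Real.cos (n * y)) m x).congr_deriv ?_).congr_of_eventuallyEq
    (Eventually.of_forall fun t => ?_)
  · simp only [perW]
    ring
  · simp only [perU]
    ring

theorem perU_dy : HasDerivAt (fun t => perU m n κ x t) (n * perQ m n κ x y) y := by
  refine ((hasDerivAt_trig (-κ 2 * Real.sin (m * x) + κ 3 * Real.cos (m * x))
    (κ 0 * Real.cos (m * x) - κ 1 * Real.sin (m * x)) n y).congr_deriv ?_).congr_of_eventuallyEq
    (Eventually.of_forall fun t => ?_)
  · simp only [perQ]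
    ring
  · simp only [perU]
    ring

theorem perV_dx : HasDerivAt (fun t => perV m n κ t y) (m * perQ m n κ x y) x := by
  refine ((hasDerivAt_trig (κ 1 * Real.cos (n * y) - κ 2 * Real.sin (n * y))
    (κ 0 * Real.cos (n * y) - κ 3 * Real.sin (n * y)) m x).congr_deriv ?_).congr_of_eventuallyEq
    (Eventually.of_forall fun t => ?_)
  · simp only [perQ]
    ring
  · simp only [perV]
    ring

theorem perV_dy : HasDerivAt (fun t => perV m n κ x t) (-(n * perW m n κ x y)) y := by
  refine ((hasDerivAt_trig (κ 0 * Real.sin (m * x) + κ 1 * Real.cos (m * x))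
    (-κ 2 * Real.cos (m * x) - κ 3 * Real.sin (m * x)) n y).congr_deriv ?_).congr_of_eventuallyEq
    (Eventually.of_forall fun t => ?_)
  · simp only [perW]
    ring
  · simp only [perV]
    ring

theorem perW_dx : HasDerivAt (fun t => perW m n κ t y) (m * perU m n κ x y) x := by
  refine ((hasDerivAt_trig (κ 1 * Real.sin (n * y) + κ 2 * Real.cos (n * y))
    (κ 0 * Real.sin (n * y) + κ 3 * Real.cos (n * y)) m x).congr_deriv ?_).congr_of_eventuallyEq
    (Eventually.of_forall fun t => ?_)
  · simp only [perU]
    ring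
  · simp only [perW]
    ring

theorem perW_dy : HasDerivAt (fun t => perW m n κ x t) (n * perV m n κ x y) y := by
  refine ((hasDerivAt_trig (κ 2 * Real.cos (m * x) + κ 3 * Real.sin (m * x))
    (κ 0 * Real.sin (m * x) + κ 1 * Real.cos (m * x)) n y).congr_deriv ?_).congr_of_eventuallyEq
    (Eventually.of_forall fun t => ?_)
  · simp only [perV]
    ring
  · simp only [perW]
    ring

theorem perQ_dx : HasDerivAt (fun t => perQ m n κ t y) (-(m * perV m n κ x y)) x := by
  refine ((hasDerivAt_trig (κ 0 * Real.cos (n * y) - κ 3 * Real.sin (n * y))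
    (-κ 1 * Real.cos (n * y) + κ 2 * Real.sin (n * y)) m x).congr_deriv ?_).congr_of_eventuallyEq
    (Eventually.of_forall fun t => ?_)
  · simp only [perV]
    ring
  · simp only [perQ]
    ring

theorem perQ_dy : HasDerivAt (fun t => perQ m n κ x t) (-(n * perU m n κ x y)) y := by
  refine ((hasDerivAt_trig (κ 0 * Real.cos (m * x) - κ 1 * Real.sin (m * x))
    (κ 2 * Real.sin (m * x) - κ 3 * Real.cos (m * x)) n y).congr_deriv ?_).congr_of_eventuallyEq
    (Eventually.of_forall fun t => ?_)
  · simp only [perU]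
    ring
  · simp only [perQ]
    ring

end derivatives

/-- Smooth functions of `(x, y)` that are `2π`-periodic in both variables. -/
def IsSmoothPer (h : ℝ → ℝ → ℝ) : Prop :=
  ContDiff ℝ ∞ (fun s : ℝ × ℝ => h s.1 s.2) ∧
    ∀ x y, h (x + 2 * Real.pi) y = h x y ∧ h x (y + 2 * Real.pi) = h x y

theorem cos_nat_mul_add (m : ℕ) (x : ℝ) :
    Real.cos (m * (x + 2 * Real.pi)) = Real.cos (m * x) := by
  rw [mul_add, Real.cos_add_nat_mul_two_pi]

theorem sin_nat_mul_add (m : ℕ) (x : ℝ) :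
    Real.sin (m * (x + 2 * Real.pi)) = Real.sin (m * x) := by
  rw [mul_add, Real.sin_add_nat_mul_two_pi]

theorem isSmoothPer_perU (m n : ℕ) (κ : Fin 4 → ℝ) : IsSmoothPer (perU m n κ) := by
  refine ⟨by unfold perU; fun_prop, fun x y => ?_⟩
  simp only [perU, cos_nat_mul_add, sin_nat_mul_add, and_self]

theorem isSmoothPer_perV (m n : ℕ) (κ : Fin 4 → ℝ) : IsSmoothPer (perV m n κ) := by
  refine ⟨by unfold perV; fun_prop, fun x y => ?_⟩
  simp only [perV, cos_nat_mul_add, sin_nat_mul_add, and_self]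

theorem isSmoothPer_perW (m n : ℕ) (κ : Fin 4 → ℝ) : IsSmoothPer (perW m n κ) := by
  refine ⟨by unfold perW; fun_prop, fun x y => ?_⟩
  simp only [perW, cos_nat_mul_add, sin_nat_mul_add, and_self]

theorem isSmoothPer_perQ (m n : ℕ) (κ : Fin 4 → ℝ) : IsSmoothPer (perQ m n κ) := by
  refine ⟨by unfold perQ; fun_prop, fun x y => ?_⟩
  simp only [perQ, cos_nat_mul_add, sin_nat_mul_add, and_self]

/-! ### Separated functions -/

/-- The function `g(z) h(x, y)`. -/
def sep (g : smoothFns) (h : ℝ → ℝ → ℝ) (P : Pt) : ℝ := (g : ℝ → ℝ) P.2.2 * h P.1 P.2.1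

open smoothFns

theorem isSmooth_sep (g : smoothFns) {h : ℝ → ℝ → ℝ} (hh : IsSmoothPer h) : IsSmooth (sep g h) := by
  refine (isSmooth_comp_z (smooth g)).mul (g := fun P => h P.1 P.2.1) ⟨?_, fun x y z => ?_⟩
  · exact hh.1.comp (contDiff_fst.prodMk contDiff_snd.fst)
  · exact ⟨(hh.2 x y).1, (hh.2 x y).2⟩

theorem pd_zero_sep (g : smoothFns) {h h' : ℝ → ℝ → ℝ} (hh : IsSmoothPer h)
    (hd : ∀ x y, HasDerivAt (fun t => h t y) (h' x y) x) : pd 0 (sep g h) = sep g h' := by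
  funext ⟨x, y, z⟩
  exact (hasDerivAt_pd_zero (isSmooth_sep g hh).differentiable x y z).unique
    ((hd x y).const_mul ((g : ℝ → ℝ) z))

theorem pd_one_sep (g : smoothFns) {h h' : ℝ → ℝ → ℝ} (hh : IsSmoothPer h)
    (hd : ∀ x y, HasDerivAt (fun t => h x t) (h' x y) y) : pd 1 (sep g h) = sep g h' := by
  funext ⟨x, y, z⟩
  exact (hasDerivAt_pd_one (isSmooth_sep g hh).differentiable x y z).unique
    ((hd x y).const_mul ((g : ℝ → ℝ) z))

theorem pd_two_sep (g : smoothFns) {h : ℝ → ℝ → ℝ} (hh : IsSmoothPer h) :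
    pd 2 (sep g h) = sep (D g) h := by
  funext ⟨x, y, z⟩
  exact (hasDerivAt_pd_two (isSmooth_sep g hh).differentiable x y z).unique
    ((smoothFns.hasDerivAt g z).mul_const (h x y))

theorem sep_const_mul (g : smoothFns) (c : ℝ) (h : ℝ → ℝ → ℝ) :
    sep g (fun x y => c * h x y) = sep (c • g) h := by
  funext P
  simp only [sep, coe_smul]
  ring

theorem sep_neg_const_mul (g : smoothFns) (c : ℝ) (h : ℝ → ℝ → ℝ) :
    sep g (fun x y => -(c * h x y)) = sep (-c • g) h := by
  funext P
  simp only [sep, coe_smul]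
  ring

section pd_sep

variable (g : smoothFns) (m n : ℕ) (κ : Fin 4 → ℝ)

theorem pd_zero_sep_perU : pd 0 (sep g (perU m n κ)) = sep (-(m : ℝ) • g) (perW m n κ) := by
  rw [pd_zero_sep g (isSmoothPer_perU m n κ) (perU_dx m n κ), sep_neg_const_mul]

theorem pd_one_sep_perU : pd 1 (sep g (perU m n κ)) = sep ((n : ℝ) • g) (perQ m n κ) := by
  rw [pd_one_sep g (isSmoothPer_perU m n κ) (perU_dy m n κ), sep_const_mul]

theorem pd_two_sep_perU : pd 2 (sep g (perU m n κ)) = sep (D g) (perU m n κ) :=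
  pd_two_sep g (isSmoothPer_perU m n κ)

theorem pd_zero_sep_perV : pd 0 (sep g (perV m n κ)) = sep ((m : ℝ) • g) (perQ m n κ) := by
  rw [pd_zero_sep g (isSmoothPer_perV m n κ) (perV_dx m n κ), sep_const_mul]

theorem pd_one_sep_perV : pd 1 (sep g (perV m n κ)) = sep (-(n : ℝ) • g) (perW m n κ) := by
  rw [pd_one_sep g (isSmoothPer_perV m n κ) (perV_dy m n κ), sep_neg_const_mul]

theorem pd_two_sep_perV : pd 2 (sep g (perV m n κ)) = sep (D g) (perV m n κ) :=
  pd_two_sep g (isSmoothPer_perV m n κ)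

theorem pd_zero_sep_perW : pd 0 (sep g (perW m n κ)) = sep ((m : ℝ) • g) (perU m n κ) := by
  rw [pd_zero_sep g (isSmoothPer_perW m n κ) (perW_dx m n κ), sep_const_mul]

theorem pd_one_sep_perW : pd 1 (sep g (perW m n κ)) = sep ((n : ℝ) • g) (perV m n κ) := by
  rw [pd_one_sep g (isSmoothPer_perW m n κ) (perW_dy m n κ), sep_const_mul]

theorem pd_two_sep_perW : pd 2 (sep g (perW m n κ)) = sep (D g) (perW m n κ) :=
  pd_two_sep g (isSmoothPer_perW m n κ)

theorem pd_zero_sep_perQ : pd 0 (sep g (perQ m n κ)) = sep (-(m : ℝ) • g) (perV m n κ) := by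
  rw [pd_zero_sep g (isSmoothPer_perQ m n κ) (perQ_dx m n κ), sep_neg_const_mul]

theorem pd_one_sep_perQ : pd 1 (sep g (perQ m n κ)) = sep (-(n : ℝ) • g) (perU m n κ) := by
  rw [pd_one_sep g (isSmoothPer_perQ m n κ) (perQ_dy m n κ), sep_neg_const_mul]

theorem mu_sq : mu m n ^ 2 = (m : ℝ) ^ 2 + (n : ℝ) ^ 2 := Real.sq_sqrt (by positivity)

theorem lap_sep_perU (P : Pt) : lap (sep g (perU m n κ)) P =
    sep (D (D g) - mu m n ^ 2 • g) (perU m n κ) P := by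
  simp only [lap, Fin.sum_univ_three, pd_zero_sep_perU, pd_one_sep_perU, pd_two_sep_perU,
    pd_zero_sep_perW, pd_one_sep_perQ, mu_sq]
  simp only [sep, coe_smul, coe_sub]
  ring

theorem lap_sep_perV (P : Pt) : lap (sep g (perV m n κ)) P =
    sep (D (D g) - mu m n ^ 2 • g) (perV m n κ) P := by
  simp only [lap, Fin.sum_univ_three, pd_zero_sep_perV, pd_one_sep_perV, pd_two_sep_perV,
    pd_one_sep_perW, pd_zero_sep_perQ, mu_sq]
  simp only [sep, coe_smul, coe_sub]
  ring

theorem lap_sep_perW (P : Pt) : lap (sep g (perW m n κ)) P =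
    sep (D (D g) - mu m n ^ 2 • g) (perW m n κ) P := by
  simp only [lap, Fin.sum_univ_three, pd_zero_sep_perW, pd_one_sep_perW, pd_two_sep_perW,
    pd_zero_sep_perU, pd_one_sep_perV, mu_sq]
  simp only [sep, coe_smul, coe_sub]
  ring

end pd_sep

/-! ### Separated solutions -/

/-- The profile with the given components. -/
def profile (U V W : smoothFns) : Profile where
  U := U
  V := V
  W := W
  smooth_U := smooth U
  smooth_V := smooth V
  smooth_W := smooth W

section profile

variable (U V W : smoothFns) (m n : ℕ) (κ : Fin 4 → ℝ)

theorem profile_field_zero : (fun P => (profile U V W).field m n κ P 0) = sep U (perU m n κ) := rfl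

theorem profile_field_one : (fun P => (profile U V W).field m n κ P 1) = sep V (perV m n κ) := rfl

theorem profile_field_two : (fun P => (profile U V W).field m n κ P 2) = sep W (perW m n κ) := rfl

theorem profile_field_zero_apply (P : Pt) :
    (profile U V W).field m n κ P 0 = sep U (perU m n κ) P := rfl

theorem profile_field_one_apply (P : Pt) :
    (profile U V W).field m n κ P 1 = sep V (perV m n κ) P := rfl

theorem profile_field_two_apply (P : Pt) :
    (profile U V W).field m n κ P 2 = sep W (perW m n κ) P := rfl

end profile

/-- Reduction of the Stokes problem for separated fields to ordinary differential equations; the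
gradient of the pressure is that of `r(z) 𝒫(x, y)`. -/
theorem isClassicalSolution_profile {β ℓ : ℝ} {U V W r : smoothFns} {m n : ℕ} {κ : Fin 4 → ℝ}
    {q : Pt → ℝ} (hq : IsSmooth q) (hq0 : pd 0 q = sep ((m : ℝ) • r) (perU m n κ))
    (hq1 : pd 1 q = sep ((n : ℝ) • r) (perV m n κ)) (hq2 : pd 2 q = sep (D r) (perW m n κ))
    (hU : D (D U) = (mu m n ^ 2 - ℓ) • U + (m : ℝ) • r)
    (hV : D (D V) = (mu m n ^ 2 - ℓ) • V + (n : ℝ) • r)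
    (hW : D (D W) = (mu m n ^ 2 - ℓ) • W + D r)
    (hdiv : D W = (m : ℝ) • U + (n : ℝ) • V) (hWd : W ∈ dirichlet)
    (hU1 : (D U : ℝ → ℝ) 1 = -β * (U : ℝ → ℝ) 1) (hU2 : (D U : ℝ → ℝ) (-1) = β * (U : ℝ → ℝ) (-1))
    (hV1 : (D V : ℝ → ℝ) 1 = -β * (V : ℝ → ℝ) 1) (hV2 : (D V : ℝ → ℝ) (-1) = β * (V : ℝ → ℝ) (-1)) :
    IsClassicalSolution β ℓ ((profile U V W).field m n κ) q := by
  obtain ⟨hW1, hW2⟩ := mem_dirichlet.1 hWd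
  refine ⟨fun i => ?_, hq, fun x y z _ i => ?_, fun x y z _ => ?_, fun x y s hs => ?_,
    fun x y s hs j hj => ?_⟩
  · fin_cases i
    · exact isSmooth_sep U (isSmoothPer_perU m n κ)
    · exact isSmooth_sep V (isSmoothPer_perV m n κ)
    · exact isSmooth_sep W (isSmoothPer_perW m n κ)
  · fin_cases i
    · change -lap (sep U (perU m n κ)) (x, y, z) + pd 0 q (x, y, z) = ℓ * sep U (perU m n κ) _
      rw [hq0, lap_sep_perU, hU]
      simp only [sep, coe_smul, coe_sub, coe_add]
      ring
    · change -lap (sep V (perV m n κ)) (x, y, z) + pd 1 q (x, y, z) = ℓ * sep V (perV m n κ) _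
      rw [hq1, lap_sep_perV, hV]
      simp only [sep, coe_smul, coe_sub, coe_add]
      ring
    · change -lap (sep W (perW m n κ)) (x, y, z) + pd 2 q (x, y, z) = ℓ * sep W (perW m n κ) _
      rw [hq2, lap_sep_perW, hW]
      simp only [sep, coe_smul, coe_sub, coe_add]
      ring
  · rw [Fin.sum_univ_three, profile_field_zero, profile_field_one, profile_field_two,
      pd_zero_sep_perU, pd_one_sep_perV, pd_two_sep_perW, hdiv]
    simp only [sep, coe_smul, coe_add]
    ring
  · rw [profile_field_two_apply, sep]
    rcases hs with rfl | rfl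
    · rw [hW1, zero_mul]
    · rw [hW2, zero_mul]
  · rw [profile_field_two]
    have hWs : (W : ℝ → ℝ) s = 0 := by
      rcases hs with rfl | rfl
      · exact hW1
      · exact hW2
    have hUs : (D U : ℝ → ℝ) s * s + β * (U : ℝ → ℝ) s = 0 := by
      rcases hs with rfl | rfl
      · linarith
      · linarith
    have hVs : (D V : ℝ → ℝ) s * s + β * (V : ℝ → ℝ) s = 0 := by
      rcases hs with rfl | rfl
      · linarith
      · linarith
    rcases hj with rfl | rfl
    · rw [profile_field_zero, profile_field_zero_apply, pd_two_sep_perU, pd_zero_sep_perW]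
      simp only [sep, coe_smul, hWs]
      linear_combination (perU m n κ x y) * hUs
    · rw [profile_field_one, profile_field_one_apply, pd_two_sep_perV, pd_one_sep_perW]
      simp only [sep, coe_smul, hWs]
      linear_combination (perV m n κ x y) * hVs

/-- The profile of the first class: horizontal and, if `μ > 0`, orthogonal to the wave vector. -/
def constProfile (m n : ℕ) (f : smoothFns) : Profile :=
  if m = 0 ∧ n = 0 then profile f f 0 else profile ((n : ℝ) • f) (-(m : ℝ) • f) 0

/-- The profile of the second class, with vertical component `W`. -/
def nonconstProfile (m n : ℕ) (W : smoothFns) : Profile :=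
  profile (((m : ℝ) / mu m n ^ 2) • D W) (((n : ℝ) / mu m n ^ 2) • D W) W

theorem zero_mem_dirichlet : (0 : smoothFns) ∈ dirichlet := dirichlet.zero_mem

theorem isClassicalSolution_constProfile {β k : ℝ} {f : smoothFns} (hf : D (D f) = -(k ^ 2) • f)
    (hf1 : (D f : ℝ → ℝ) 1 = -β * (f : ℝ → ℝ) 1) (hf2 : (D f : ℝ → ℝ) (-1) = β * (f : ℝ → ℝ) (-1))
    (m n : ℕ) (κ : Fin 4 → ℝ) (Q₀ : ℝ) :
    IsClassicalSolution β (mu m n ^ 2 + k ^ 2) ((constProfile m n f).field m n κ)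
      (fun _ => Q₀) := by
  have hz : ∀ h : ℝ → ℝ → ℝ, (fun _ : Pt => (0 : ℝ)) = sep 0 h := by
    intro h
    funext P
    simp [sep, coe_zero]
  have hq : ∀ i, pd i (fun _ : Pt => Q₀) = fun _ => 0 := fun i => funext (pd_const Q₀ i)
  have hs : ∀ c : ℝ, D (D (c • f)) = (mu m n ^ 2 - (mu m n ^ 2 + k ^ 2)) • (c • f) := by
    intro c
    rw [map_smul, map_smul, hf]
    module
  have hs1 : ∀ c : ℝ, (D (c • f) : ℝ → ℝ) 1 = -β * ((c • f : smoothFns) : ℝ → ℝ) 1 := by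
    intro c
    rw [map_smul, coe_smul, coe_smul, hf1]
    ring
  have hs2 : ∀ c : ℝ, (D (c • f) : ℝ → ℝ) (-1) = β * ((c • f : smoothFns) : ℝ → ℝ) (-1) := by
    intro c
    rw [map_smul, coe_smul, coe_smul, hf2]
    ring
  have key : ∀ c d : ℝ, (m : ℝ) * c + n * d = 0 →
      IsClassicalSolution β (mu m n ^ 2 + k ^ 2) ((profile (c • f) (d • f) 0).field m n κ)
        (fun _ => Q₀) := by
    intro c d hcd
    refine isClassicalSolution_profile (r := 0) (isSmooth_const Q₀) ?_ ?_ ?_ ?_ ?_ ?_ ?_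
      zero_mem_dirichlet (hs1 c) (hs2 c) (hs1 d) (hs2 d)
    · rw [hq, smul_zero, hz]
    · rw [hq, smul_zero, hz]
    · rw [hq, map_zero, hz]
    · rw [smul_zero, add_zero, hs]
    · rw [smul_zero, add_zero, hs]
    · simp
    · rw [map_zero, smul_smul, smul_smul, ← add_smul, hcd, zero_smul]
  unfold constProfile
  split_ifs with h
  · have := key 1 1 (by simp [h.1, h.2])
    rwa [one_smul] at this
  · exact key _ _ (by ring)

/-- The vertical factor of the pressure of the second class. -/
def pressureFn (p : ℕ) (μ k : ℝ) : smoothFns :=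
  ((k ^ 2 + μ ^ 2) * ((trigFn p k : ℝ → ℝ) 1 / (hypFn p μ : ℝ → ℝ) 1) / μ ^ 2) • D (hypFn p μ)

theorem isClassicalSolution_nonconstProfile {β k : ℝ} {p m n : ℕ} (hμ : 0 < mu m n)
    (hW1 : (helm (mu m n) (vertFn p (mu m n) k) : ℝ → ℝ) 1 =
      -β * (D (vertFn p (mu m n) k) : ℝ → ℝ) 1) (κ : Fin 4 → ℝ) :
    IsClassicalSolution β (mu m n ^ 2 + k ^ 2)
      ((nonconstProfile m n (vertFn p (mu m n) k)).field m n κ)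
      (sep (pressureFn p (mu m n) k) (perW m n κ)) := by
  have hW2 := helm_vertFn_neg_one hW1
  have hWd := vertFn_mem p hμ k
  obtain ⟨hd1, hd2⟩ := mem_dirichlet.1 hWd
  have hmu := mu_sq m n
  set μ := mu m n with hμdef
  set W := vertFn p μ k with hWdef
  set c : ℝ := (trigFn p k : ℝ → ℝ) 1 / (hypFn p μ : ℝ → ℝ) 1 with hc
  have hμ0 : μ ^ 2 ≠ 0 := by positivity
  have hDr : D (pressureFn p μ k) = ((k ^ 2 + μ ^ 2) * c) • hypFn p μ := by
    rw [pressureFn, map_smul, D_D_hypFn, smul_smul, div_mul_cancel₀ _ hμ0]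
  have hDDW : D (D W) = (-k ^ 2) • W + ((k ^ 2 + μ ^ 2) * c) • hypFn p μ := by
    rw [hWdef, vertFn, map_sub, map_sub, map_smul, map_smul, D_D_hypFn, D_D_trigFn]
    module
  have hDDDW : D (D (D W)) = (-k ^ 2) • D W + μ ^ 2 • pressureFn p μ k := by
    rw [hDDW, map_add, map_smul, map_smul, pressureFn, smul_smul, mul_div_cancel₀ _ hμ0]
  have hb1 : (D (D W) : ℝ → ℝ) 1 = -β * (D W : ℝ → ℝ) 1 := by
    rw [helm_apply, coe_sub, coe_smul, hd1] at hW1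
    linarith
  have hb2 : (D (D W) : ℝ → ℝ) (-1) = β * (D W : ℝ → ℝ) (-1) := by
    rw [helm_apply, coe_sub, coe_smul, hd2] at hW2
    linarith
  have hODE : ∀ a : ℝ, D (D ((a / μ ^ 2) • D W)) =
      (μ ^ 2 - (μ ^ 2 + k ^ 2)) • ((a / μ ^ 2) • D W) + a • pressureFn p μ k := by
    intro a
    rw [map_smul, map_smul, hDDDW, smul_add, smul_smul (a / μ ^ 2) (μ ^ 2),
      div_mul_cancel₀ _ hμ0]
    module
  have hBC1 : ∀ a : ℝ, (D ((a / μ ^ 2) • D W) : ℝ → ℝ) 1 =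
      -β * (((a / μ ^ 2) • D W : smoothFns) : ℝ → ℝ) 1 := by
    intro a
    rw [map_smul, coe_smul, coe_smul, hb1]
    ring
  have hBC2 : ∀ a : ℝ, (D ((a / μ ^ 2) • D W) : ℝ → ℝ) (-1) =
      β * (((a / μ ^ 2) • D W : smoothFns) : ℝ → ℝ) (-1) := by
    intro a
    rw [map_smul, coe_smul, coe_smul, hb2]
    ring
  refine isClassicalSolution_profile (r := pressureFn p μ k)
    (isSmooth_sep _ (isSmoothPer_perW m n κ)) (pd_zero_sep_perW _ m n κ) (pd_one_sep_perW _ m n κ)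
    (pd_two_sep_perW _ m n κ) (hODE m) (hODE n) ?_ ?_ hWd (hBC1 m) (hBC2 m) (hBC1 n) (hBC2 n)
  · rw [hDr, hDDW]
    module
  · rw [smul_smul, smul_smul, ← add_smul]
    have : (m : ℝ) * (m / μ ^ 2) + n * (n / μ ^ 2) = 1 := by
      field_simp
      exact hmu.symm
    rw [this, one_smul]

/-! ### Separating classes of test functions -/

/-- A class of functions separates integrable functions if an integrable function with vanishing
integral against all functions of the class is zero almost everywhere. -/
def Separates {X : Type*} [MeasurableSpace X] (μ : Measure X) (𝒯 : Set (X → ℝ)) : Prop :=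
  ∀ F : X → ℝ, Integrable F μ → (∀ T ∈ 𝒯, ∫ x, F x * T x ∂μ = 0) → F =ᵐ[μ] 0

/-- Bounded continuous functions, unbundled. -/
def BddCts {X : Type*} [TopologicalSpace X] (T : X → ℝ) : Prop :=
  Continuous T ∧ ∃ C, ∀ x, ‖T x‖ ≤ C

theorem ae_eq_zero_of_boxes {X Y : Type*} [MeasurableSpace X] [MeasurableSpace Y] {μ : Measure X}
    {ν : Measure Y} [SFinite μ] [SFinite ν] {F : X × Y → ℝ} (hF : Integrable F (μ.prod ν))
    (h : ∀ I J, MeasurableSet I → MeasurableSet J → ∫ P in I ×ˢ J, F P ∂(μ.prod ν) = 0) :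
    F =ᵐ[μ.prod ν] 0 := by
  refine hF.ae_eq_zero_of_forall_setIntegral_eq_zero fun s hs _ => ?_
  have huniv : ∫ P, F P ∂(μ.prod ν) = 0 := by
    have := h univ univ .univ .univ
    rwa [univ_prod_univ, setIntegral_univ] at this
  refine MeasurableSpace.induction_on_inter
    (C := fun s _ => ∫ P in s, F P ∂(μ.prod ν) = 0) generateFrom_prod.symm isPiSystem_prod
    (by simp) ?_ ?_ ?_ s hs
  · rintro _ ⟨I, hI, J, hJ, rfl⟩
    exact h I J hI hJ
  · intro t ht h0
    have := integral_add_compl ht hF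
    rw [h0, huniv] at this
    linarith
  · intro f hd hm h0
    rw [integral_iUnion hm hd hF.integrableOn]
    simp [h0]

theorem Separates.prod {X Y : Type*} [TopologicalSpace X] [MeasurableSpace X]
    [OpensMeasurableSpace X] [TopologicalSpace Y] [MeasurableSpace Y]
    [OpensMeasurableSpace Y] {μ : Measure X} {ν : Measure Y} [SFinite μ] [SFinite ν]
    {𝒯 : Set (X → ℝ)} {𝒮 : Set (Y → ℝ)} (hμ : Separates μ 𝒯) (hν : Separates ν 𝒮)
    (h𝒯 : ∀ T ∈ 𝒯, BddCts T) (h𝒮 : ∀ S ∈ 𝒮, BddCts S) :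
    Separates (μ.prod ν) {R | ∃ T ∈ 𝒯, ∃ S ∈ 𝒮, R = fun P => T P.1 * S P.2} := by
  intro F hF h
  have hint : ∀ S ∈ 𝒮, Integrable (fun P : X × Y => F P * S P.2) (μ.prod ν) := by
    intro S hS
    obtain ⟨hc, C, hC⟩ := h𝒮 S hS
    refine hF.mul_bdd (c := C) ?_ (Eventually.of_forall fun P => hC P.2)
    exact (hc.measurable.comp measurable_snd).aestronglyMeasurable
  have h1 : ∀ S ∈ 𝒮, (fun x => ∫ y, F (x, y) * S y ∂ν) =ᵐ[μ] 0 := by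
    intro S hS
    refine hμ _ (hint S hS).integral_prod_left fun T hT => ?_
    have h2 := h _ ⟨T, hT, S, hS, rfl⟩
    have hi : Integrable (fun P : X × Y => F P * (T P.1 * S P.2)) (μ.prod ν) := by
      obtain ⟨hc, C, hC⟩ := h𝒯 T hT
      have h3 := (hint S hS).mul_bdd (c := C) (g := fun P : X × Y => T P.1)
        (hc.measurable.comp measurable_fst).aestronglyMeasurable
        (Eventually.of_forall fun P => hC P.1)
      refine h3.congr (Eventually.of_forall fun P => ?_)
      simp only
      ring
    rw [integral_prod _ hi] at h2
    rw [← h2]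
    refine integral_congr_ae (Eventually.of_forall fun x => ?_)
    simp only
    rw [← integral_mul_const]
    exact integral_congr_ae (Eventually.of_forall fun y => by ring)
  refine ae_eq_zero_of_boxes hF fun I J hI hJ => ?_
  have h3 : (fun y => ∫ x in I, F (x, y) ∂μ) =ᵐ[ν] 0 := by
    have hFI : Integrable F ((μ.restrict I).prod ν) := by
      rw [← Measure.restrict_univ (μ := ν), Measure.prod_restrict]
      exact hF.restrict
    refine hν _ hFI.integral_prod_right fun S hS => ?_
    have hFIS : Integrable (fun P : X × Y => F P * S P.2) ((μ.restrict I).prod ν) := by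
      have := hint S hS
      rw [← Measure.restrict_univ (μ := ν), Measure.prod_restrict]
      exact this.restrict
    have h4 := integral_prod_symm _ hFIS
    rw [integral_prod _ hFIS] at h4
    simp only [integral_mul_const] at h4
    rw [← h4]
    refine integral_eq_zero_of_ae ?_
    exact ae_restrict_of_ae (h1 S hS)
  have hFIJ : Integrable F ((μ.restrict I).prod (ν.restrict J)) := by
    rw [Measure.prod_restrict]
    exact hF.restrict
  rw [← Measure.prod_restrict, integral_prod_symm _ hFIJ]
  exact integral_eq_zero_of_ae (ae_restrict_of_ae h3)

/-- `cos t` or `sin t`. -/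
def trig (b : Bool) (t : ℝ) : ℝ := if b then Real.cos t else Real.sin t

theorem continuous_trig (b : Bool) : Continuous (trig b) := by
  cases b
  · exact Real.continuous_sin
  · exact Real.continuous_cos

theorem abs_trig_le (b : Bool) (t : ℝ) : |trig b t| ≤ 1 := by
  cases b
  · exact Real.abs_sin_le_one t
  · exact Real.abs_cos_le_one t

/-- Trigonometric functions separate, by the density of trigonometric polynomials. -/
theorem separates_trig : Separates (volume.restrict (Ioo 0 (2 * Real.pi)))
    {T | ∃ (b : Bool) (m : ℕ), T = fun x => trig b (m * x)} := by
  intro F hF h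
  have : Fact (0 < 2 * Real.pi) := ⟨Real.two_pi_pos⟩
  have hFc : Integrable (fun x => (F x : ℂ)) (volume.restrict (Ioo 0 (2 * Real.pi))) := hF.ofReal
  have hint : ∀ f : C(AddCircle (2 * Real.pi), ℂ), Integrable
      (fun x : ℝ => (F x : ℂ) * f (x : AddCircle (2 * Real.pi)))
      (volume.restrict (Ioo 0 (2 * Real.pi))) := by
    intro f
    refine hFc.mul_bdd (c := ‖f‖) ?_ (Eventually.of_forall fun x => f.norm_coe_le_norm _)
    exact (f.continuous.comp (AddCircle.continuous_mk' _)).aestronglyMeasurable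
  let L : C(AddCircle (2 * Real.pi), ℂ) →L[ℂ] ℂ := LinearMap.mkContinuous
    { toFun := fun f => ∫ x in Ioo 0 (2 * Real.pi), (F x : ℂ) * f (x : AddCircle (2 * Real.pi))
      map_add' := fun f g => by
        rw [← integral_add (hint f) (hint g)]
        exact integral_congr_ae (Eventually.of_forall fun x => mul_add _ _ _)
      map_smul' := fun c f => by
        rw [RingHom.id_apply, smul_eq_mul, ← integral_const_mul]
        exact integral_congr_ae (Eventually.of_forall fun x => mul_left_comm _ _ _) }
    (∫ x in Ioo 0 (2 * Real.pi), ‖(F x : ℂ)‖) (fun f => by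
      refine (norm_integral_le_integral_norm _).trans ?_
      rw [← integral_mul_const]
      refine integral_mono (hint f).norm (hFc.norm.mul_const _) fun x => ?_
      simp only [norm_mul]
      exact mul_le_mul_of_nonneg_left (f.norm_coe_le_norm _) (norm_nonneg _))
  have L_apply : ∀ f, L f =
    ∫ x in Ioo 0 (2 * Real.pi), (F x : ℂ) * f (x : AddCircle (2 * Real.pi)) := fun _ => rfl
  have hcos : ∀ n : ℤ, ∫ x in Ioo 0 (2 * Real.pi), F x * Real.cos (n * x) = 0 := by
    intro n
    refine Eq.trans ?_ (h _ ⟨true, n.natAbs, rfl⟩)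
    refine integral_congr_ae (Eventually.of_forall fun x => ?_)
    simp only [trig, if_true]
    rcases Int.natAbs_eq n with hn | hn
    · rw [hn]
      simp
    · rw [hn]
      simp [Real.cos_neg]
  have hsin : ∀ n : ℤ, ∫ x in Ioo 0 (2 * Real.pi), F x * Real.sin (n * x) = 0 := by
    intro n
    have h0 := h _ ⟨false, n.natAbs, rfl⟩
    simp only [trig, Bool.false_eq_true, if_false] at h0
    rcases Int.natAbs_eq n with hn | hn
    · rw [hn]
      simpa using h0
    · rw [hn]
      simp only [Int.cast_neg, Int.cast_natCast, neg_mul, Real.sin_neg, mul_neg, integral_neg, h0,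
        neg_zero]
  have ic : ∀ n : ℤ, Integrable (fun x => F x * Real.cos (n * x))
      (volume.restrict (Ioo 0 (2 * Real.pi))) := fun n =>
    hF.mul_bdd (c := 1) (by fun_prop) (Eventually.of_forall fun x => Real.abs_cos_le_one _)
  have is : ∀ n : ℤ, Integrable (fun x => F x * Real.sin (n * x))
      (volume.restrict (Ioo 0 (2 * Real.pi))) := fun n =>
    hF.mul_bdd (c := 1) (by fun_prop) (Eventually.of_forall fun x => Real.abs_sin_le_one _)
  have hL : L = 0 := by
    have hdense : Dense (Submodule.span ℂ (range (@fourier (2 * Real.pi))) :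
        Set C(AddCircle (2 * Real.pi), ℂ)) :=
      Submodule.dense_iff_topologicalClosure_eq_top.2 span_fourier_closure_eq_top
    refine ContinuousLinearMap.ext_on hdense ?_
    rintro _ ⟨n, rfl⟩
    rw [L_apply, zero_apply]
    have e : ∀ x : ℝ, (F x : ℂ) * fourier n (x : AddCircle (2 * Real.pi)) =
        ((F x * Real.cos (n * x) : ℝ) : ℂ) + ((F x * Real.sin (n * x) : ℝ) : ℂ) * Complex.I := by
      intro x
      have hpi : (Real.pi : ℂ) ≠ 0 := Complex.ofReal_ne_zero.2 Real.pi_ne_zero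
      rw [fourier_coe_apply, show 2 * (Real.pi : ℂ) * Complex.I * n * x / ((2 * Real.pi : ℝ) : ℂ) =
        ((n * x : ℝ) : ℂ) * Complex.I by push_cast; field_simp, Complex.exp_mul_I]
      push_cast
      ring
    simp only [e]
    rw [integral_add (ic n).ofReal ((is n).ofReal.mul_const _), integral_mul_const,
      integral_complex_ofReal, integral_complex_ofReal, hcos, hsin]
    simp
  refine (ae_restrict_iff' measurableSet_Ioo).2 ?_
  refine isOpen_Ioo.ae_eq_zero_of_integral_contDiff_smul_eq_zero
    (IntegrableOn.locallyIntegrableOn hF) fun ψ hψ _ hsupp => ?_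
  have hψ0 : ∀ x, x ∉ Ioo 0 (2 * Real.pi) → ψ x = 0 := fun x hx =>
    image_eq_zero_of_notMem_tsupport fun hx' => hx (hsupp hx')
  have hcont : Continuous (AddCircle.liftIco (2 * Real.pi) 0 fun x => (ψ x : ℂ)) := by
    refine AddCircle.liftIco_continuous ?_ ?_
    · rw [hψ0 0 (by simp), hψ0 _ (by simp)]
    · exact (Complex.continuous_ofReal.comp hψ.continuous).continuousOn
  have h1 : L ⟨_, hcont⟩ = 0 := by rw [hL]; rfl
  rw [L_apply] at h1
  have h2 : ∫ x in Ioo 0 (2 * Real.pi), ψ x • F x = 0 := by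
    have h3 : ∫ x in Ioo 0 (2 * Real.pi), ((ψ x • F x : ℝ) : ℂ) = 0 := by
      rw [← h1]
      refine setIntegral_congr_fun measurableSet_Ioo fun x hx => ?_
      simp only [ContinuousMap.coe_mk]
      rw [AddCircle.liftIco_coe_apply (by rw [zero_add]; exact ⟨hx.1.le, hx.2⟩)]
      rw [smul_eq_mul]
      push_cast
      ring
    rw [integral_complex_ofReal] at h3
    exact_mod_cast h3
  rw [← h2]
  refine (setIntegral_eq_integral_of_forall_compl_eq_zero fun x hx => ?_).symm
  rw [hψ0 x hx, zero_smul]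

theorem separates_smooth : Separates (volume.restrict (Ioo (-1 : ℝ) 1))
    {g | ContDiff ℝ ∞ g ∧ HasCompactSupport g} := by
  intro F hF h
  refine (ae_restrict_iff' measurableSet_Ioo).2 ?_
  refine isOpen_Ioo.ae_eq_zero_of_integral_contDiff_smul_eq_zero
    (IntegrableOn.locallyIntegrableOn hF) fun ψ hψ hψc hsupp => ?_
  refine Eq.trans ?_ (h ψ ⟨hψ, hψc⟩)
  have hψ0 : ∀ x, x ∉ Ioo (-1 : ℝ) 1 → ψ x = 0 := fun x hx =>
    image_eq_zero_of_notMem_tsupport fun hx' => hx (hsupp hx')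
  rw [← setIntegral_eq_integral_of_forall_compl_eq_zero (s := Ioo (-1 : ℝ) 1)]
  · exact integral_congr_ae (Eventually.of_forall fun x => mul_comm _ _)
  · intro x hx
    rw [hψ0 x hx, zero_smul]

/-- A square integrable function on the cell that is orthogonal to all products of trigonometric
functions of `x` and `y` and smooth functions of `z` is zero. -/
theorem ae_eq_zero_of_modes {F : Pt → ℝ} (hF : Integrable F vol)
    (h : ∀ (a b : Bool) (m n : ℕ) (g : smoothFns),
      ∫ P, F P * ((g : ℝ → ℝ) P.2.2 * (trig a (m * P.1) * trig b (n * P.2.1))) ∂vol = 0) :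
    F =ᵐ[vol] 0 := by
  have bt : ∀ T ∈ {T | ∃ (b : Bool) (m : ℕ), T = fun x : ℝ => trig b (m * x)}, BddCts T := by
    rintro _ ⟨b, m, rfl⟩
    exact ⟨(continuous_trig b).comp (by fun_prop), 1, fun x => abs_trig_le _ _⟩
  have bs : ∀ g ∈ {g : ℝ → ℝ | ContDiff ℝ ∞ g ∧ HasCompactSupport g}, BddCts g := by
    rintro g ⟨h1, h2⟩
    exact ⟨h1.continuous, h2.exists_bound_of_continuous h1.continuous⟩
  have hsep := separates_trig.prod (separates_trig.prod separates_smooth bt bs) bt (by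
    rintro _ ⟨T, hT, S, hS, rfl⟩
    obtain ⟨h1, C, h2⟩ := bt T hT
    obtain ⟨h3, C', h4⟩ := bs S hS
    refine ⟨by fun_prop, C * C', fun P => ?_⟩
    rw [norm_mul]
    exact mul_le_mul (h2 _) (h4 _) (norm_nonneg _) ((norm_nonneg _).trans (h2 P.1)))
  rw [vol_eq] at hF h ⊢
  refine hsep F hF ?_
  rintro _ ⟨_, ⟨a, m, rfl⟩, _, ⟨_, ⟨b, n, rfl⟩, g, ⟨hg, -⟩, rfl⟩, rfl⟩
  refine Eq.trans ?_ (h a b m n ⟨g, hg⟩)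
  refine integral_congr_ae (Eventually.of_forall fun P => ?_)
  simp only
  ring

/-! ### Trigonometric integrals -/

theorem integral_cos_int {k : ℤ} (hk : k ≠ 0) :
    ∫ x in Ioo 0 (2 * Real.pi), Real.cos (k * x) = 0 := by
  have hk' : (k : ℝ) ≠ 0 := Int.cast_ne_zero.2 hk
  have h : ∀ t, HasDerivAt (fun x => Real.sin (k * x) / k) (Real.cos (k * t)) t := by
    intro t
    refine ((hasDerivAt_const_mul' k t).sin.div_const (k : ℝ)).congr_deriv ?_
    field_simp
  rw [integral_Ioo_eq_sub Real.two_pi_pos.le h (by fun_prop), mul_zero, Real.sin_zero, zero_div,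
    sub_zero, show (k : ℝ) * (2 * Real.pi) = ((2 * k : ℤ) : ℝ) * Real.pi by push_cast; ring,
    Real.sin_int_mul_pi, zero_div]

theorem integral_sin_int (k : ℤ) : ∫ x in Ioo 0 (2 * Real.pi), Real.sin (k * x) = 0 := by
  rcases eq_or_ne k 0 with rfl | hk
  · simp
  have hk' : (k : ℝ) ≠ 0 := Int.cast_ne_zero.2 hk
  have h : ∀ t, HasDerivAt (fun x => -Real.cos (k * x) / k) (Real.sin (k * t)) t := by
    intro t
    refine ((hasDerivAt_const_mul' k t).cos.neg.div_const (k : ℝ)).congr_deriv ?_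
    field_simp
  rw [integral_Ioo_eq_sub Real.two_pi_pos.le h (by fun_prop),
    Real.cos_int_mul_two_pi, mul_zero, Real.cos_zero, sub_self]

theorem integrableOn_Ioo {f : ℝ → ℝ} (hf : Continuous f) (a b : ℝ) : IntegrableOn f (Ioo a b) :=
  integrable_restrict_of_continuous isCompact_Icc Ioo_subset_Icc_self hf

theorem integral_cos_mul_cos (k l : ℤ) :
    ∫ x in Ioo 0 (2 * Real.pi), Real.cos (k * x) * Real.cos (l * x) =
      ((∫ x in Ioo 0 (2 * Real.pi), Real.cos ((k - l : ℤ) * x))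
        + ∫ x in Ioo 0 (2 * Real.pi), Real.cos ((k + l : ℤ) * x)) / 2 := by
  rw [← integral_add (integrableOn_Ioo (by fun_prop) _ _) (integrableOn_Ioo (by fun_prop) _ _),
    ← integral_div]
  refine integral_congr_ae (Eventually.of_forall fun x => ?_)
  simp only
  push_cast
  rw [sub_mul, add_mul, Real.cos_sub, Real.cos_add]
  ring

theorem integral_sin_mul_sin (k l : ℤ) :
    ∫ x in Ioo 0 (2 * Real.pi), Real.sin (k * x) * Real.sin (l * x) =
      ((∫ x in Ioo 0 (2 * Real.pi), Real.cos ((k - l : ℤ) * x))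
        - ∫ x in Ioo 0 (2 * Real.pi), Real.cos ((k + l : ℤ) * x)) / 2 := by
  rw [← integral_sub (integrableOn_Ioo (by fun_prop) _ _) (integrableOn_Ioo (by fun_prop) _ _),
    ← integral_div]
  refine integral_congr_ae (Eventually.of_forall fun x => ?_)
  simp only
  push_cast
  rw [sub_mul, add_mul, Real.cos_sub, Real.cos_add]
  ring

theorem integral_sin_mul_cos (k l : ℤ) :
    ∫ x in Ioo 0 (2 * Real.pi), Real.sin (k * x) * Real.cos (l * x) = 0 := by
  have h : ∫ x in Ioo 0 (2 * Real.pi), Real.sin (k * x) * Real.cos (l * x) =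
      ((∫ x in Ioo 0 (2 * Real.pi), Real.sin ((k - l : ℤ) * x))
        + ∫ x in Ioo 0 (2 * Real.pi), Real.sin ((k + l : ℤ) * x)) / 2 := by
    rw [← integral_add (integrableOn_Ioo (by fun_prop) _ _) (integrableOn_Ioo (by fun_prop) _ _),
      ← integral_div]
    refine integral_congr_ae (Eventually.of_forall fun x => ?_)
    simp only
    push_cast
    rw [sub_mul, add_mul, Real.sin_sub, Real.sin_add]
    ring
  rw [h, integral_sin_int, integral_sin_int]
  simp

theorem integral_trig_eq_zero {a b : Bool} {m n : ℕ} (h : (a, m) ≠ (b, n)) :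
    ∫ x in Ioo 0 (2 * Real.pi), trig a (m * x) * trig b (n * x) = 0 := by
  have h1 := integral_cos_mul_cos m n
  have h2 := integral_sin_mul_sin m n
  have h3 := integral_sin_mul_cos m n
  have h4 := integral_sin_mul_cos n m
  simp only [Int.cast_natCast] at h1 h2 h3 h4
  cases a <;> cases b <;> simp only [trig, if_true, Bool.false_eq_true, if_false]
  · have hmn : m ≠ n := fun e => h (by rw [e])
    rw [h2, integral_cos_int (by omega), integral_cos_int (by omega)]
    simp
  · exact h3
  · simpa only [mul_comm] using h4
  · have hmn : m ≠ n := fun e => h (by rw [e])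
    rw [h1, integral_cos_int (by omega), integral_cos_int (by omega)]
    simp

theorem integral_trig_sq {m : ℕ} (hm : m ≠ 0) (a : Bool) :
    ∫ x in Ioo 0 (2 * Real.pi), trig a (m * x) * trig a (m * x) = Real.pi := by
  have h1 := integral_cos_mul_cos m m
  have h2 := integral_sin_mul_sin m m
  have h0 : ∫ x in Ioo 0 (2 * Real.pi), Real.cos (((m : ℤ) - m : ℤ) * x) = 2 * Real.pi := by
    simp [Real.pi_pos.le]
  rw [h0, integral_cos_int (by omega)] at h1 h2
  simp only [Int.cast_natCast] at h1 h2
  cases a <;> simp only [trig, if_true, Bool.false_eq_true, if_false]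
  · rw [h2]
    ring
  · rw [h1]
    ring

/-! ### Inner products of separated functions -/

/-- The inner product of `L²(𝕋²)`. -/
def hip (h h' : ℝ → ℝ → ℝ) : ℝ :=
  ∫ x in Ioo 0 (2 * Real.pi), ∫ y in Ioo 0 (2 * Real.pi), h x y * h' x y

theorem ip_eq_setIntegral (f g : smoothFns) :
    ip f g = ∫ z in Ioo (-1 : ℝ) 1, (f : ℝ → ℝ) z * (g : ℝ → ℝ) z := by
  rw [ip_apply, intervalIntegral.integral_of_le (by norm_num), integral_Ioc_eq_integral_Ioo]

theorem integral_sep_mul_sep (g g' : smoothFns) {h h' : ℝ → ℝ → ℝ} (hh : IsSmoothPer h)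
    (hh' : IsSmoothPer h') : ∫ P, sep g h P * sep g' h' P ∂vol = hip h h' * ip g g' := by
  have hi : Integrable (fun P => sep g h P * sep g' h' P) vol :=
    integrable_vol ((isSmooth_sep g hh).continuous.mul (isSmooth_sep g' hh').continuous)
  rw [vol_eq] at hi ⊢
  rw [integral_prod _ hi, hip, ← integral_mul_const]
  refine integral_congr_ae (Eventually.of_forall fun x => ?_)
  simp only
  rw [ip_eq_setIntegral, ← integral_prod_mul]
  refine integral_congr_ae (Eventually.of_forall fun Q => ?_)
  simp only [sep]
  ring

theorem integral_mul_sq_le {f g : Pt → ℝ} (hf : MemLp f 2 vol) (hg : MemLp g 2 vol) :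
    (∫ P, f P * g P ∂vol) ^ 2 ≤ (∫ P, f P * f P ∂vol) * ∫ P, g P * g P ∂vol := by
  have iff := hf.integrable_mul hf
  have ifg := hf.integrable_mul hg
  have igg := hg.integrable_mul hg
  have h : ∀ t : ℝ, 0 ≤ (∫ P, g P * g P ∂vol) * (t * t) + (2 * ∫ P, f P * g P ∂vol) * t
      + ∫ P, f P * f P ∂vol := by
    intro t
    have h1 : 0 ≤ ∫ P, (f P + t * g P) ^ 2 ∂vol := integral_nonneg fun P => sq_nonneg _
    have h2 : ∫ P, (f P + t * g P) ^ 2 ∂vol =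
        ∫ P, (f P * f P + (2 * t * (f P * g P) + t * t * (g P * g P))) ∂vol :=
      integral_congr_ae (Eventually.of_forall fun P => by ring)
    have j1 : Integrable (fun P => 2 * t * (f P * g P)) vol := ifg.const_mul _
    have j2 : Integrable (fun P => t * t * (g P * g P)) vol := igg.const_mul _
    have j0 : Integrable (fun P => f P * f P) vol := iff
    have j3 : Integrable (fun P => 2 * t * (f P * g P) + t * t * (g P * g P)) vol := j1.add j2
    rw [h2, integral_add j0 j3, integral_add j1 j2, integral_const_mul, integral_const_mul] at h1
    linarith
  have := discrim_le_zero h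
  simp only [discrim] at this
  linarith

/-- The functional `g ↦ ∫ vᵢ g(z) h(x, y)`. -/
def coef (v : L2) (i : Fin 3) {h : ℝ → ℝ → ℝ} (hh : IsSmoothPer h) : smoothFns →ₗ[ℝ] ℝ where
  toFun g := ∫ P, v P i * sep g h P ∂vol
  map_add' f g := by
    have hi : ∀ g, Integrable (fun P => v P i * sep g h P) vol := fun g =>
      integrable_memLp_mul ((Lp.memLp v).eval_piLp i) (isSmooth_sep g hh).continuous
    rw [← integral_add (hi f) (hi g)]
    refine integral_congr_ae (Eventually.of_forall fun P => ?_)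
    simp only [sep, coe_add]
    ring
  map_smul' c g := by
    rw [RingHom.id_apply, smul_eq_mul, ← integral_const_mul]
    refine integral_congr_ae (Eventually.of_forall fun P => ?_)
    simp only [sep, coe_smul]
    ring

theorem coef_apply (v : L2) (i : Fin 3) {h : ℝ → ℝ → ℝ} (hh : IsSmoothPer h) (g : smoothFns) :
    coef v i hh g = ∫ P, v P i * sep g h P ∂vol := rfl

theorem integrable_coef (v : L2) (i : Fin 3) {h : ℝ → ℝ → ℝ} (hh : IsSmoothPer h) (g : smoothFns) :
    Integrable (fun P => v P i * sep g h P) vol :=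
  integrable_memLp_mul ((Lp.memLp v).eval_piLp i) (isSmooth_sep g hh).continuous

theorem exists_coef_sq_le (v : L2) (i : Fin 3) {h : ℝ → ℝ → ℝ} (hh : IsSmoothPer h) :
    ∃ C, 0 ≤ C ∧ ∀ g, coef v i hh g ^ 2 ≤ C * ip g g := by
  refine ⟨(∫ P, v P i * v P i ∂vol) * hip h h, ?_, fun g => ?_⟩
  · refine mul_nonneg (integral_nonneg fun P => mul_self_nonneg _) ?_
    exact integral_nonneg fun x => integral_nonneg fun y => mul_self_nonneg _
  · rw [mul_assoc, ← integral_sep_mul_sep g g hh hh]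
    exact integral_mul_sq_le ((Lp.memLp v).eval_piLp i)
      (memLp_of_continuous (isSmooth_sep g hh).continuous)

theorem coeFn_toL2 (Z : Profile) (m n : ℕ) (κ : Fin 4 → ℝ) :
    Z.toL2 m n κ =ᵐ[vol] Z.field m n κ := MemLp.coeFn_toLp _

theorem inner_profile (U V W : smoothFns) (m n : ℕ) (κ : Fin 4 → ℝ) (v : L2) :
    inner ℝ ((profile U V W).toL2 m n κ) v =
      coef v 0 (isSmoothPer_perU m n κ) U + coef v 1 (isSmoothPer_perV m n κ) V
        + coef v 2 (isSmoothPer_perW m n κ) W := by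
  have i0 := integrable_coef v 0 (isSmoothPer_perU m n κ) U
  have i1 := integrable_coef v 1 (isSmoothPer_perV m n κ) V
  have i2 := integrable_coef v 2 (isSmoothPer_perW m n κ) W
  have i01 : Integrable
      (fun P => v P 0 * sep U (perU m n κ) P + v P 1 * sep V (perV m n κ) P) vol := i0.add i1
  rw [inner_eq_integral, coef_apply, coef_apply, coef_apply, ← integral_add i0 i1,
    ← integral_add i01 i2]
  refine integral_congr_ae ?_
  filter_upwards [coeFn_toL2 (profile U V W) m n κ] with P hP
  rw [hP, Fin.sum_univ_three, profile_field_zero_apply, profile_field_one_apply,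
    profile_field_two_apply]
  ring

theorem coef_profile (U V W g : smoothFns) (m n : ℕ) (κ : Fin 4 → ℝ) {h : ℝ → ℝ → ℝ}
    (hh : IsSmoothPer h) :
    coef ((profile U V W).toL2 m n κ) 0 hh g = hip (perU m n κ) h * ip U g ∧
    coef ((profile U V W).toL2 m n κ) 1 hh g = hip (perV m n κ) h * ip V g ∧
    coef ((profile U V W).toL2 m n κ) 2 hh g = hip (perW m n κ) h * ip W g := by
  refine ⟨?_, ?_, ?_⟩
  · rw [coef_apply, ← integral_sep_mul_sep U g (isSmoothPer_perU m n κ) hh]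
    refine integral_congr_ae ?_
    filter_upwards [coeFn_toL2 (profile U V W) m n κ] with P hP
    rw [hP, profile_field_zero_apply]
  · rw [coef_apply, ← integral_sep_mul_sep V g (isSmoothPer_perV m n κ) hh]
    refine integral_congr_ae ?_
    filter_upwards [coeFn_toL2 (profile U V W) m n κ] with P hP
    rw [hP, profile_field_one_apply]
  · rw [coef_apply, ← integral_sep_mul_sep W g (isSmoothPer_perW m n κ) hh]
    refine integral_congr_ae ?_
    filter_upwards [coeFn_toL2 (profile U V W) m n κ] with P hP
    rw [hP, profile_field_two_apply]

theorem inner_profile_profile (U V W U' V' W' : smoothFns) (m n m' n' : ℕ) (κ κ' : Fin 4 → ℝ) :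
    inner ℝ ((profile U V W).toL2 m n κ) ((profile U' V' W').toL2 m' n' κ') =
      hip (perU m' n' κ') (perU m n κ) * ip U' U + hip (perV m' n' κ') (perV m n κ) * ip V' V
        + hip (perW m' n' κ') (perW m n κ) * ip W' W := by
  rw [inner_profile, (coef_profile U' V' W' U m' n' κ' (isSmoothPer_perU m n κ)).1,
    (coef_profile U' V' W' V m' n' κ' (isSmoothPer_perV m n κ)).2.1,
    (coef_profile U' V' W' W m' n' κ' (isSmoothPer_perW m n κ)).2.2]

/-! ### The horizontal factors with a single nonzero parameter -/

/-- Signs and types of the trigonometric factors of a function that is, for each of the four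
parameters, a signed product of a trigonometric function of `x` and one of `y`. -/
structure TrigTable where
  sign : Fin 4 → ℝ
  inX : Fin 4 → Bool
  inY : Fin 4 → Bool
  sign_sq : ∀ j, sign j * sign j = 1
  exists_eq : ∀ a b, ∃ j, inX j = a ∧ inY j = b
  inj : ∀ j j', inX j = inX j' → inY j = inY j' → j = j'

/-- The product described by the `j`-th entry of a table. -/
def TrigTable.fn (t : TrigTable) (m n : ℕ) (j : Fin 4) (x y : ℝ) : ℝ :=
  t.sign j * (trig (t.inX j) (m * x) * trig (t.inY j) (n * y))

/-- The table of `𝒫ᵘ`. -/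
def tableU : TrigTable where
  sign := ![1, -1, -1, 1]
  inX := ![true, false, false, true]
  inY := ![false, false, true, true]
  sign_sq j := by fin_cases j <;> simp
  exists_eq := by decide
  inj := by decide

/-- The table of `𝒫ᵛ`. -/
def tableV : TrigTable where
  sign := ![1, 1, -1, -1]
  inX := ![false, true, true, false]
  inY := ![true, true, false, false]
  sign_sq j := by fin_cases j <;> simp
  exists_eq := by decide
  inj := by decide

/-- The table of `𝒫`. -/
def tableW : TrigTable where
  sign := ![1, 1, 1, 1]
  inX := ![false, true, true, false]
  inY := ![false, false, true, true]
  sign_sq j := by fin_cases j <;> simp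
  exists_eq := by decide
  inj := by decide

theorem perU_single (m n : ℕ) (j : Fin 4) : perU m n (Pi.single j 1) = tableU.fn m n j := by
  funext x y
  fin_cases j <;> simp [perU, TrigTable.fn, tableU, trig]

theorem perV_single (m n : ℕ) (j : Fin 4) : perV m n (Pi.single j 1) = tableV.fn m n j := by
  funext x y
  fin_cases j <;> simp [perV, TrigTable.fn, tableV, trig]

theorem perW_single (m n : ℕ) (j : Fin 4) : perW m n (Pi.single j 1) = tableW.fn m n j := by
  funext x y
  fin_cases j <;> simp [perW, TrigTable.fn, tableW, trig]

theorem TrigTable.hip_fn (t : TrigTable) (m n m' n' : ℕ) (j j' : Fin 4) :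
    hip (t.fn m n j) (t.fn m' n' j') = t.sign j * t.sign j' *
      ((∫ x in Ioo 0 (2 * Real.pi), trig (t.inX j) (m * x) * trig (t.inX j') (m' * x)) *
      ∫ y in Ioo 0 (2 * Real.pi), trig (t.inY j) (n * y) * trig (t.inY j') (n' * y)) := by
  rw [hip, ← integral_mul_const, ← integral_const_mul]
  refine integral_congr_ae (Eventually.of_forall fun x => ?_)
  simp only [TrigTable.fn]
  rw [← integral_const_mul, ← integral_const_mul]
  refine integral_congr_ae (Eventually.of_forall fun y => ?_)
  simp only
  ring

theorem TrigTable.hip_eq_zero (t : TrigTable) {m n m' n' : ℕ} {j j' : Fin 4}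
    (h : (m, n, j) ≠ (m', n', j')) : hip (t.fn m n j) (t.fn m' n' j') = 0 := by
  rw [t.hip_fn]
  by_cases h1 : (t.inX j, m) = (t.inX j', m')
  · have h2 : (t.inY j, n) ≠ (t.inY j', n') := by
      intro h2
      rw [Prod.mk.injEq] at h1 h2
      exact h (by rw [h1.2, h2.2, t.inj j j' h1.1 h2.1])
    rw [integral_trig_eq_zero h2, mul_zero, mul_zero]
  · rw [integral_trig_eq_zero h1, zero_mul, mul_zero]

theorem TrigTable.hip_self (t : TrigTable) {m n : ℕ} (hm : m ≠ 0) (hn : n ≠ 0) (j : Fin 4) :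
    hip (t.fn m n j) (t.fn m n j) = Real.pi ^ 2 := by
  rw [t.hip_fn, integral_trig_sq hm, integral_trig_sq hn, t.sign_sq, one_mul, sq]

theorem mu_pos_iff {m n : ℕ} : 0 < mu m n ↔ ¬(m = 0 ∧ n = 0) := by
  rw [mu, Real.sqrt_pos]
  constructor
  · rintro h ⟨rfl, rfl⟩
    simp at h
  · intro h
    rcases not_and_or.1 h with h | h
    · have : (0 : ℝ) < m := Nat.cast_pos.2 (Nat.pos_of_ne_zero h)
      positivity
    · have : (0 : ℝ) < n := Nat.cast_pos.2 (Nat.pos_of_ne_zero h)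
      positivity

theorem constProfile_of_pos {m n : ℕ} (h : 0 < mu m n) (f : smoothFns) :
    constProfile m n f = profile ((n : ℝ) • f) (-(m : ℝ) • f) 0 := if_neg (mu_pos_iff.1 h)

theorem exists_constProfile_eq (m n : ℕ) (f : smoothFns) :
    ∃ U V, constProfile m n f = profile U V 0 := by
  unfold constProfile
  split_ifs
  · exact ⟨_, _, rfl⟩
  · exact ⟨_, _, rfl⟩

theorem inner_profile_single_eq_zero (U V W U' V' W' : smoothFns) {m n m' n' : ℕ} {j j' : Fin 4}
    (h : (m, n, j) ≠ (m', n', j')) :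
    inner ℝ ((profile U V W).toL2 m n (Pi.single j 1))
      ((profile U' V' W').toL2 m' n' (Pi.single j' 1)) = 0 := by
  rw [inner_profile_profile]
  simp only [perU_single, perV_single, perW_single, TrigTable.hip_eq_zero _ h.symm, zero_mul,
    add_zero]

/-- The two classes are orthogonal: for equal wave numbers, the horizontal part is orthogonal to the
wave vector in the first class and parallel to it in the second. -/
theorem inner_constProfile_nonconstProfile {m n m' n' : ℕ} (hμ : 0 < mu m' n') (f W : smoothFns)
    (j j' : Fin 4) :
    inner ℝ ((constProfile m n f).toL2 m n (Pi.single j 1))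
      ((nonconstProfile m' n' W).toL2 m' n' (Pi.single j' 1)) = 0 := by
  by_cases h : (m, n, j) = (m', n', j')
  · simp only [Prod.mk.injEq] at h
    obtain ⟨rfl, rfl, rfl⟩ := h
    rw [constProfile_of_pos hμ, nonconstProfile, inner_profile_profile]
    simp only [perU_single, perV_single, map_smul, map_zero, LinearMap.smul_apply, smul_eq_mul]
    rcases eq_or_ne m 0 with rfl | hm
    · simp
    rcases eq_or_ne n 0 with rfl | hn
    · simp
    rw [tableU.hip_self hm hn, tableV.hip_self hm hn]
    ring
  · obtain ⟨U, V, hUV⟩ := exists_constProfile_eq m n f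
    rw [hUV, nonconstProfile, inner_profile_single_eq_zero _ _ _ _ _ _ h]

/-! ### Completeness of the separated fields -/

/-- `k = √(λ - μ²)` for the `p`-th eigenvalue `λ` of the first class. -/
def IsRobinFrequency (β : ℝ) (p : ℕ) (k : ℝ) : Prop :=
  k ∈ Ioo (p * Real.pi / 2) ((p + 1) * Real.pi / 2) ∧
    (Even p → β * Real.cos k = k * Real.sin k) ∧ (Odd p → β * Real.sin k = -(k * Real.cos k))

/-- `k = √(Λ - μ²)` for the `p`-th eigenvalue `Λ` of the second class. -/
def IsStokesFrequency (β μ : ℝ) (p : ℕ) (k : ℝ) : Prop :=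
  k ∈ Ioo ((p + 1) * Real.pi / 2) ((p + 2) * Real.pi / 2) ∧
    (Even p → k * Real.sin k = (-((k ^ 2 + μ ^ 2) / β) - μ * Real.tanh μ) * Real.cos k) ∧
    (Odd p → k * Real.cos k =
      ((k ^ 2 + μ ^ 2) / β + μ * (Real.cosh μ / Real.sinh μ)) * Real.sin k)

theorem IsRobinFrequency.pos {β k : ℝ} {p : ℕ} (h : IsRobinFrequency β p k) : 0 < k :=
  lt_of_le_of_lt (by positivity) h.1.1

theorem IsStokesFrequency.pos {β μ k : ℝ} {p : ℕ} (h : IsStokesFrequency β μ p k) : 0 < k :=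
  lt_of_le_of_lt (by positivity) h.1.1

theorem IsRobinFrequency.trigFn_one {β k : ℝ} {p : ℕ} (h : IsRobinFrequency β p k) :
    (trigFn p k : ℝ → ℝ) 1 ≠ 0 := trigFn_one_ne_zero h.1

theorem IsStokesFrequency.trigFn_one {β μ k : ℝ} {p : ℕ} (h : IsStokesFrequency β μ p k) :
    (trigFn p k : ℝ → ℝ) 1 ≠ 0 := by
  refine trigFn_one_ne_zero (q := p + 1) ?_
  have := h.1
  push_cast
  convert this using 2
  ring

theorem IsRobinFrequency.D_one {β k : ℝ} {p : ℕ} (h : IsRobinFrequency β p k) :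
    (D (trigFn p k) : ℝ → ℝ) 1 = -β * (trigFn p k : ℝ → ℝ) 1 := D_trigFn_one h.2.1 h.2.2

theorem IsStokesFrequency.helm_one {β μ k : ℝ} {p : ℕ} (hβ : 0 < β) (hμ : 0 < μ)
    (h : IsStokesFrequency β μ p k) :
    (helm μ (vertFn p μ k) : ℝ → ℝ) 1 = -β * (D (vertFn p μ k) : ℝ → ℝ) 1 :=
  helm_vertFn_one hβ hμ h.2.1 h.2.2

theorem IsStokesFrequency.D_vertFn_one_ne_zero {β μ k : ℝ} {p : ℕ} (hβ : 0 < β) (hμ : 0 < μ)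
    (h : IsStokesFrequency β μ p k) : (D (vertFn p μ k) : ℝ → ℝ) 1 ≠ 0 := by
  intro h0
  have h1 := h.helm_one hβ hμ
  rw [h0, mul_zero, helm_vertFn, coe_smul] at h1
  refine mul_ne_zero ?_ h.trigFn_one h1
  positivity

theorem coef_eq_zero_of_fn_eq_zero (v : L2) (i : Fin 3) {h : ℝ → ℝ → ℝ} (hh : IsSmoothPer h)
    (h0 : ∀ x y, h x y = 0) (g : smoothFns) : coef v i hh g = 0 := by
  rw [coef_apply]
  simp [sep, h0]

/-- The divergence condition for the Fourier coefficients. -/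
theorem coef_div {v : L2} (hv : v ∈ HP) (m n : ℕ) (κ : Fin 4 → ℝ) (g : smoothFns) :
    m * coef v 0 (isSmoothPer_perU m n κ) g + n * coef v 1 (isSmoothPer_perV m n κ) g
      + coef v 2 (isSmoothPer_perW m n κ) (D g) = 0 := by
  have h := hv (sep g (perW m n κ)) (isSmooth_sep g (isSmoothPer_perW m n κ))
  have i0 := integrable_coef v 0 (isSmoothPer_perU m n κ) ((m : ℝ) • g)
  have i1 := integrable_coef v 1 (isSmoothPer_perV m n κ) ((n : ℝ) • g)
  have i2 := integrable_coef v 2 (isSmoothPer_perW m n κ) (D g)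
  have i01 : Integrable (fun P => v P 0 * sep ((m : ℝ) • g) (perU m n κ) P
    + v P 1 * sep ((n : ℝ) • g) (perV m n κ) P) vol := i0.add i1
  simp only [Fin.sum_univ_three, pd_zero_sep_perW, pd_one_sep_perW, pd_two_sep_perW] at h
  rw [integral_add i01 i2, integral_add i0 i1] at h
  simpa only [← coef_apply v 0 (isSmoothPer_perU m n κ), ← coef_apply v 1 (isSmoothPer_perV m n κ),
    ← coef_apply v 2 (isSmoothPer_perW m n κ), map_smul, smul_eq_mul] using h

/-- A solenoidal field orthogonal to the separated fields of the second class with wave numbers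
`m, n` and parameters `κ` has vanishing vertical coefficients for these wave numbers and
parameters. By the divergence condition the functional that takes a vertical profile to the inner
product determines the vertical coefficients on the range of `d²/dz² - μ²`. -/
theorem coef_two_eq_zero_of_orthogonal {β : ℝ} (hβ : 0 < β) {ks : ℕ → ℝ} {m n : ℕ}
    (hμ : 0 < mu m n) (hks : ∀ p, IsStokesFrequency β (mu m n) p (ks p)) {κ : Fin 4 → ℝ} {v : L2}
    (hv : v ∈ HP)
    (h2 : ∀ p, inner ℝ ((nonconstProfile m n (vertFn p (mu m n) (ks p))).toL2 m n κ) v = 0)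
    (g : smoothFns) : coef v 2 (isSmoothPer_perW m n κ) g = 0 := by
  have hdiv := coef_div hv m n κ
  obtain ⟨C₀, hC₀, hb0⟩ := exists_coef_sq_le v 0 (isSmoothPer_perU m n κ)
  obtain ⟨C₁, hC₁, hb1⟩ := exists_coef_sq_le v 1 (isSmoothPer_perV m n κ)
  obtain ⟨C₂, hC₂, hb2⟩ := exists_coef_sq_le v 2 (isSmoothPer_perW m n κ)
  simp only [nonconstProfile, inner_profile] at h2
  set A₀ := coef v 0 (isSmoothPer_perU m n κ)
  set A₁ := coef v 1 (isSmoothPer_perV m n κ)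
  set A₂ := coef v 2 (isSmoothPer_perW m n κ)
  set μ := mu m n
  have hμ2 : 0 < μ ^ 2 := by positivity
  have hhelm : ∀ X : dirichlet, A₂ (helm μ X) = 0 := by
    intro X
    let B : dirichlet →ₗ[ℝ] ℝ := ((m / μ ^ 2) • (A₀ ∘ₗ D) + (n / μ ^ 2) • (A₁ ∘ₗ D) + A₂) ∘ₗ
      dirichlet.subtype
    have B_apply : ∀ X : dirichlet, B X =
        m / μ ^ 2 * A₀ (D X) + n / μ ^ 2 * A₁ (D X) + A₂ X := fun X => rfl
    have hB := eq_zero_of_stokes hβ ks (fun p => (hks p).1)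
      (fun p => ⟨vertFn p μ (ks p), vertFn_mem p hμ (ks p)⟩)
      (fun p => by rw [helm_vertFn, map_smul, map_smul, D_D_trigFn, smul_comm])
      (fun p => (hks p).helm_one hβ hμ)
      (fun p => helm_vertFn_neg_one ((hks p).helm_one hβ hμ))
      (fun p => ip_self_pos (z := 1) (by norm_num) ((hks p).D_vertFn_one_ne_zero hβ hμ))
      B (C := 3 * ((m / μ ^ 2) ^ 2 * C₀ + (n / μ ^ 2) ^ 2 * C₁ + C₂ / μ ^ 2)) (by positivity)
      ?_ ?_ X
    · rw [B_apply] at hB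
      have h3 := hdiv (D X)
      rw [helm_apply, map_sub, map_smul, smul_eq_mul]
      field_simp at hB
      linarith
    · intro X
      rw [B_apply]
      have e0 := mul_le_mul_of_nonneg_left (hb0 (D X)) (sq_nonneg ((m : ℝ) / μ ^ 2))
      have e1 := mul_le_mul_of_nonneg_left (hb1 (D X)) (sq_nonneg ((n : ℝ) / μ ^ 2))
      have e2 := hb2 X
      have d0 := ip_self_nonneg (D X)
      have d1 := ip_self_nonneg (X : smoothFns)
      set a := (m : ℝ) / μ ^ 2 * A₀ (D X)
      set b := (n : ℝ) / μ ^ 2 * A₁ (D X)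
      set c := A₂ X
      have e3 : (a + b + c) ^ 2 ≤ 3 * (a ^ 2 + b ^ 2 + c ^ 2) := by
        nlinarith [sq_nonneg (a - b), sq_nonneg (b - c), sq_nonneg (a - c)]
      have e4 : C₂ * ip (X : smoothFns) X = C₂ / μ ^ 2 * (μ ^ 2 * ip (X : smoothFns) X) := by
        field_simp
      have e5 : 0 ≤ C₂ / μ ^ 2 * ip (D X) (D X) := by positivity
      have e6 : 0 ≤ ((m / μ ^ 2) ^ 2 * C₀ + (n / μ ^ 2) ^ 2 * C₁) *
        (μ ^ 2 * ip (X : smoothFns) X) := by positivity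
      have e7 : a ^ 2 ≤ (m / μ ^ 2) ^ 2 * (C₀ * ip (D X) (D X)) := by
        rw [mul_pow]
        exact e0
      have e8 : b ^ 2 ≤ (n / μ ^ 2) ^ 2 * (C₁ * ip (D X) (D X)) := by
        rw [mul_pow]
        exact e1
      rw [e4] at e2
      linarith
    · intro p
      have := h2 p
      rw [map_smul, map_smul] at this
      exact this
  obtain ⟨W, hW⟩ := exists_dirichlet_helm hμ g
  rw [← hW, hhelm]

/-- A solenoidal field orthogonal to the separated fields of both classes with wave numbers `m, n`
and parameters `κ` has vanishing coefficients for these wave numbers and parameters. -/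
theorem coef_eq_zero_of_orthogonal {β : ℝ} (hβ : 0 < β) {kr ks : ℕ → ℝ}
    (hkr : ∀ p, IsRobinFrequency β p (kr p)) {m n : ℕ} (hμ : 0 < mu m n)
    (hks : ∀ p, IsStokesFrequency β (mu m n) p (ks p)) {κ : Fin 4 → ℝ} {v : L2} (hv : v ∈ HP)
    (h1 : ∀ p, inner ℝ ((constProfile m n (trigFn p (kr p))).toL2 m n κ) v = 0)
    (h2 : ∀ p, inner ℝ ((nonconstProfile m n (vertFn p (mu m n) (ks p))).toL2 m n κ) v = 0)
    (g : smoothFns) :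
    coef v 0 (isSmoothPer_perU m n κ) g = 0 ∧ coef v 1 (isSmoothPer_perV m n κ) g = 0 ∧
      coef v 2 (isSmoothPer_perW m n κ) g = 0 := by
  have hdiv := coef_div hv m n κ
  obtain ⟨C₀, hC₀, hb0⟩ := exists_coef_sq_le v 0 (isSmoothPer_perU m n κ)
  obtain ⟨C₁, hC₁, hb1⟩ := exists_coef_sq_le v 1 (isSmoothPer_perV m n κ)
  simp only [constProfile_of_pos hμ, inner_profile] at h1
  set A₀ := coef v 0 (isSmoothPer_perU m n κ)
  set A₁ := coef v 1 (isSmoothPer_perV m n κ)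
  set A₂ := coef v 2 (isSmoothPer_perW m n κ)
  have hmu := mu_sq m n
  set μ := mu m n
  have hμ2 : 0 < μ ^ 2 := by positivity
  -- the horizontal coefficients are parallel to the wave vector
  have hpar : ∀ g, (n : ℝ) * A₀ g = m * A₁ g := by
    intro g
    have := eq_zero_of_robin hβ kr (fun p => (hkr p).1) (fun p => trigFn p (kr p))
      (fun p => D_D_trigFn p (kr p)) (fun p => (hkr p).D_one)
      (fun p => D_trigFn_neg_one (hkr p).D_one)
      (fun p => ip_self_pos (z := 1) (by norm_num) (hkr p).trigFn_one)
      ((n : ℝ) • A₀ - (m : ℝ) • A₁) (C := 2 * (n ^ 2 * C₀ + m ^ 2 * C₁)) (by positivity) ?_ ?_ g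
    · simp only [LinearMap.sub_apply, LinearMap.smul_apply, smul_eq_mul] at this
      linarith
    · intro g
      simp only [LinearMap.sub_apply, LinearMap.smul_apply, smul_eq_mul]
      have e0 := mul_le_mul_of_nonneg_left (hb0 g) (sq_nonneg (n : ℝ))
      have e1 := mul_le_mul_of_nonneg_left (hb1 g) (sq_nonneg (m : ℝ))
      have e2 := sq_nonneg ((n : ℝ) * A₀ g + m * A₁ g)
      linear_combination 2 * e0 + 2 * e1 + e2
    · intro p
      have := h1 p
      simp only [map_smul, map_zero, smul_eq_mul] at this
      simp only [LinearMap.sub_apply, LinearMap.smul_apply, smul_eq_mul]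
      linarith
  have hA₂ : ∀ g, A₂ g = 0 := coef_two_eq_zero_of_orthogonal hβ hμ hks hv h2
  have h3 := hdiv g
  rw [hA₂, add_zero] at h3
  have h4 := hpar g
  refine ⟨?_, ?_, hA₂ g⟩
  · refine (mul_eq_zero.1 ?_).resolve_left hμ2.ne'
    rw [hmu]
    linear_combination (m : ℝ) * h3 + n * h4
  · refine (mul_eq_zero.1 ?_).resolve_left hμ2.ne'
    rw [hmu]
    linear_combination (n : ℝ) * h3 - m * h4

/-- The same for the zero wave vector. -/
theorem coef_eq_zero_of_orthogonal_zero {β : ℝ} (hβ : 0 < β) {kr : ℕ → ℝ}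
    (hkr : ∀ p, IsRobinFrequency β p (kr p)) {v : L2} (hv : v ∈ HP) (j : Fin 4)
    (h1 : ∀ p, inner ℝ ((constProfile 0 0 (trigFn p (kr p))).toL2 0 0 (Pi.single j 1)) v = 0)
    (g : smoothFns) :
    coef v 0 (isSmoothPer_perU 0 0 (Pi.single j 1)) g = 0 ∧
      coef v 1 (isSmoothPer_perV 0 0 (Pi.single j 1)) g = 0 ∧
      coef v 2 (isSmoothPer_perW 0 0 (Pi.single j 1)) g = 0 := by
  have hdiv := coef_div hv 0 0 (Pi.single j 1)
  obtain ⟨C₀, hC₀, hb0⟩ := exists_coef_sq_le v 0 (isSmoothPer_perU 0 0 (Pi.single j 1))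
  obtain ⟨C₁, hC₁, hb1⟩ := exists_coef_sq_le v 1 (isSmoothPer_perV 0 0 (Pi.single j 1))
  simp only [constProfile, and_self, if_true, inner_profile] at h1
  have hz : (∀ g, coef v 0 (isSmoothPer_perU 0 0 (Pi.single j 1)) g = 0) ∨
      ∀ g, coef v 1 (isSmoothPer_perV 0 0 (Pi.single j 1)) g = 0 := by
    by_cases hj : j = 3
    · refine Or.inr (coef_eq_zero_of_fn_eq_zero v 1 _ fun x y => ?_)
      subst hj
      simp [perV]
    · refine Or.inl (coef_eq_zero_of_fn_eq_zero v 0 _ fun x y => ?_)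
      simp [perU, Pi.single_eq_of_ne (Ne.symm hj)]
  set A₀ := coef v 0 (isSmoothPer_perU 0 0 (Pi.single j 1))
  set A₁ := coef v 1 (isSmoothPer_perV 0 0 (Pi.single j 1))
  set A₂ := coef v 2 (isSmoothPer_perW 0 0 (Pi.single j 1))
  have key : ∀ (A : smoothFns →ₗ[ℝ] ℝ) (C : ℝ), 0 ≤ C → (∀ g, A g ^ 2 ≤ C * ip g g) →
      (∀ p, A (trigFn p (kr p)) = 0) → A g = 0 := fun A C hC hb h0 =>
    eq_zero_of_robin hβ kr (fun p => (hkr p).1) (fun p => trigFn p (kr p))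
      (fun p => D_D_trigFn p (kr p)) (fun p => (hkr p).D_one)
      (fun p => D_trigFn_neg_one (hkr p).D_one)
      (fun p => ip_self_pos (z := 1) (by norm_num) (hkr p).trigFn_one) A hC hb h0 g
  obtain ⟨G, hG⟩ := exists_primitive g
  have hA₂ : A₂ g = 0 := by
    have := hdiv G
    rw [hG] at this
    simpa using this
  simp only [map_zero, add_zero] at h1
  rcases hz with hz | hz
  · exact ⟨hz g, key A₁ C₁ hC₁ hb1 fun p => by simpa [hz] using h1 p, hA₂⟩
  · exact ⟨key A₀ C₀ hC₀ hb0 fun p => by simpa [hz] using h1 p, hz g, hA₂⟩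

/-- A field all of whose Fourier coefficients vanish is zero. -/
theorem eq_zero_of_coef {v : L2}
    (h : ∀ m n j g, coef v 0 (isSmoothPer_perU m n (Pi.single j 1)) g = 0 ∧
      coef v 1 (isSmoothPer_perV m n (Pi.single j 1)) g = 0 ∧
      coef v 2 (isSmoothPer_perW m n (Pi.single j 1)) g = 0) : v = 0 := by
  have hint : ∀ i, Integrable (fun P => v P i) vol := fun i =>
    ((Lp.memLp v).eval_piLp i).integrable (by norm_num)
  have key : ∀ (i : Fin 3) (t : TrigTable),
      (∀ m n j (g : smoothFns), ∫ P, v P i * sep g (t.fn m n j) P ∂vol = 0) →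
      (fun P => v P i) =ᵐ[vol] 0 := by
    intro i t ht
    refine ae_eq_zero_of_modes (hint i) fun a b m n g => ?_
    obtain ⟨j, rfl, rfl⟩ := t.exists_eq a b
    have h0 := ht m n j g
    have hs : t.sign j ≠ 0 := fun hs => by simpa [hs] using t.sign_sq j
    refine (mul_eq_zero.1 (Eq.trans ?_ h0)).resolve_left hs
    rw [← integral_const_mul]
    refine integral_congr_ae (Eventually.of_forall fun P => ?_)
    simp only [sep, TrigTable.fn]
    ring
  have k0 := key 0 tableU fun m n j g => by
    have := (h m n j g).1
    rwa [coef_apply, perU_single] at this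
  have k1 := key 1 tableV fun m n j g => by
    have := (h m n j g).2.1
    rwa [coef_apply, perV_single] at this
  have k2 := key 2 tableW fun m n j g => by
    have := (h m n j g).2.2
    rwa [coef_apply, perW_single] at this
  refine Lp.ext ?_
  filter_upwards [k0, k1, k2, Lp.coeFn_zero Vec 2 vol] with P h0 h1 h2 hP
  rw [hP]
  ext i
  fin_cases i
  · exact h0
  · exact h1
  · exact h2

/-- Completeness: a field in `H_𝒫` orthogonal to all separated fields is zero. -/
theorem eq_zero_of_orthogonal {β : ℝ} (hβ : 0 < β) {kr : ℕ → ℝ} {ks : ℕ → ℕ → ℕ → ℝ}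
    (hkr : ∀ p, IsRobinFrequency β p (kr p))
    (hks : ∀ m n p, 0 < mu m n → IsStokesFrequency β (mu m n) p (ks m n p)) {v : L2} (hv : v ∈ HP)
    (h1 : ∀ m n p j,
      inner ℝ ((constProfile m n (trigFn p (kr p))).toL2 m n (Pi.single j 1)) v = 0)
    (h2 : ∀ m n p j, 0 < mu m n → inner ℝ
      ((nonconstProfile m n (vertFn p (mu m n) (ks m n p))).toL2 m n (Pi.single j 1)) v = 0) :
    v = 0 := by
  refine eq_zero_of_coef fun m n j g => ?_
  by_cases hμ : 0 < mu m n
  · exact coef_eq_zero_of_orthogonal hβ hkr hμ (fun p => hks m n p hμ) hv (fun p => h1 m n p j)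
      (fun p => h2 m n p j hμ) g
  · obtain ⟨rfl, rfl⟩ := not_not.1 (mt mu_pos_iff.2 hμ)
    exact coef_eq_zero_of_orthogonal_zero hβ hkr hv j (fun p => h1 0 0 p j) g

/-! ### The eigenvalues -/

/-- Sequences `μ² + k_p²` with one frequency `k_p` in each interval between consecutive multiples of
`π / 2`, from the `r`-th on. -/
theorem eigenvalue_bounds {k : ℕ → ℝ} (r : ℕ)
    (hk : ∀ p : ℕ, k p ∈ Ioo ((p + r) * Real.pi / 2) ((p + r + 1) * Real.pi / 2)) (μ : ℝ) :
    (∀ p, 0 < μ ^ 2 + k p ^ 2) ∧ StrictMono (fun p => μ ^ 2 + k p ^ 2) ∧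
      Tendsto (fun p => μ ^ 2 + k p ^ 2) atTop atTop ∧
      ∀ p : ℕ, μ ^ 2 + k p ^ 2 ∈ Ioo (μ ^ 2 + Real.pi ^ 2 / 4 * (p + r) ^ 2)
        (μ ^ 2 + Real.pi ^ 2 / 4 * (p + r + 1) ^ 2) := by
  have hpi := Real.pi_pos
  have h0 : ∀ p, 0 < k p := fun p => lt_of_le_of_lt (by positivity) (hk p).1
  have hsq : ∀ a : ℝ, (a * Real.pi / 2) ^ 2 = Real.pi ^ 2 / 4 * a ^ 2 := fun a => by ring
  have hb : ∀ p : ℕ, Real.pi ^ 2 / 4 * (p + r : ℝ) ^ 2 < k p ^ 2 ∧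
      k p ^ 2 < Real.pi ^ 2 / 4 * (p + r + 1 : ℝ) ^ 2 := fun p => by
    rw [← hsq, ← hsq]
    exact ⟨pow_lt_pow_left₀ (hk p).1 (by positivity) two_ne_zero,
      pow_lt_pow_left₀ (hk p).2 (h0 p).le two_ne_zero⟩
  refine ⟨fun p => ?_, strictMono_nat_of_lt_succ fun p => ?_, ?_, fun p => ?_⟩
  · have := h0 p
    positivity
  · have h1 := (hb p).2
    have h2 := (hb (p + 1)).1
    push_cast at h2
    have h3 : (p : ℝ) + 1 + r = p + r + 1 := by ring
    rw [h3] at h2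
    linarith
  · refine tendsto_atTop_mono (fun p => ?_) tendsto_natCast_atTop_atTop
    have h1 := (hk p).1
    have h2 : (p : ℝ) ≤ (p + r) * Real.pi / 2 := by
      have h3 : (0 : ℝ) ≤ r := Nat.cast_nonneg r
      have h4 : (0 : ℝ) ≤ p := Nat.cast_nonneg p
      have := Real.two_le_pi
      nlinarith
    rcases Nat.eq_zero_or_pos p with rfl | hp
    · simp only [Nat.cast_zero]
      positivity
    · have h5 : (1 : ℝ) ≤ p := Nat.one_le_cast.2 hp
      nlinarith [sq_nonneg μ]
  · exact ⟨by linarith [(hb p).1], by linarith [(hb p).2]⟩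

theorem IsRobinFrequency.cot_tan {β k : ℝ} {p : ℕ} (hβ : 0 < β) (h : IsRobinFrequency β p k) :
    (Even p → Real.cot k = k / β) ∧ (Odd p → Real.tan k = -(k / β)) := by
  obtain ⟨hc, hs⟩ := cos_ne_zero_and_sin_ne_zero h.1
  refine ⟨fun hp => ?_, fun hp => ?_⟩
  · have := h.2.1 hp
    rw [Real.cot_eq_cos_div_sin]
    field_simp
    linarith
  · have := h.2.2 hp
    rw [Real.tan_eq_sin_div_cos]
    field_simp
    linarith

theorem IsStokesFrequency.tan_cot {β μ k : ℝ} {p : ℕ} (h : IsStokesFrequency β μ p k) :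
    (Even p → k * Real.tan k = -((μ ^ 2 + k ^ 2) / β) - μ * Real.tanh μ) ∧
      (Odd p → k * Real.cot k = (μ ^ 2 + k ^ 2) / β + μ * (Real.cosh μ / Real.sinh μ)) := by
  obtain ⟨hc, hs⟩ := cos_ne_zero_and_sin_ne_zero (k := k) (p := p + 1) (by
    have := h.1
    push_cast
    convert this using 2
    ring)
  refine ⟨fun hp => ?_, fun hp => ?_⟩
  · rw [Real.tan_eq_sin_div_cos, mul_div_assoc', h.2.1 hp, mul_div_cancel_right₀ _ hc,
      add_comm (k ^ 2)]
  · rw [Real.cot_eq_cos_div_sin, mul_div_assoc', h.2.2 hp, mul_div_cancel_right₀ _ hs,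
      add_comm (k ^ 2)]

/-- Only finitely many indices have a value below a given bound. -/
theorem finite_index_of_le (ℓ : ℝ) :
    {i : ℕ × ℕ × ℕ × Fin 4 | mu i.1 i.2.1 ^ 2 + (i.2.2.1 : ℝ) ^ 2 ≤ ℓ}.Finite := by
  have h : ∀ m : ℕ, (m : ℝ) ^ 2 ≤ ℓ → m ∈ Iic ⌊ℓ⌋₊ := by
    intro m hm
    refine Nat.le_floor (le_trans ?_ hm)
    exact_mod_cast Nat.le_self_pow two_ne_zero m
  refine ((finite_Iic ⌊ℓ⌋₊).prod ((finite_Iic ⌊ℓ⌋₊).prod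
    ((finite_Iic ⌊ℓ⌋₊).prod finite_univ))).subset ?_
  rintro ⟨m, n, p, j⟩ hi
  simp only [mem_ofPred_eq, mu_sq] at hi
  have h1 := sq_nonneg (m : ℝ)
  have h2 := sq_nonneg (n : ℝ)
  have h3 := sq_nonneg (p : ℝ)
  exact ⟨h m (by linarith), h n (by linarith), h p (by linarith), mem_univ j⟩

/-! ### Nonvanishing -/

/-- Continuous functions that agree almost everywhere agree on the period cell. -/
theorem eqOn_cell_of_ae_eq {F : Type*} [NormedAddCommGroup F] {f g : Pt → F} (hf : Continuous f)
    (hg : Continuous g) (h : f =ᵐ[vol] g) : EqOn f g (closure cell) :=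
  (Measure.eqOn_open_of_ae_eq h isOpen_cell hf.continuousOn hg.continuousOn).closure hf hg

theorem field_eq_zero_of_toL2 {Z : Profile} {m n : ℕ} {κ : Fin 4 → ℝ} (h : Z.toL2 m n κ = 0) :
    EqOn (Z.field m n κ) 0 (closure cell) := by
  refine eqOn_cell_of_ae_eq (Z.continuous_field m n κ) continuous_zero ?_
  have h1 := coeFn_toL2 Z m n κ
  rw [h] at h1
  exact h1.symm.trans (Lp.coeFn_zero Vec 2 vol)

theorem toL2_eq_zero_of_field {Z : Profile} {m n : ℕ} {κ : Fin 4 → ℝ}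
    (h : ∀ P ∈ cell, Z.field m n κ P = 0) : Z.toL2 m n κ = 0 := by
  refine Lp.ext ?_
  filter_upwards [coeFn_toL2 Z m n κ, Lp.coeFn_zero Vec 2 vol, ae_mem_cell] with P h1 h2 h3
  rw [h1, h2, h P h3, Pi.zero_apply]

theorem corner_mem_closure_cell : ((0 : ℝ), (0 : ℝ), (1 : ℝ)) ∈ closure cell := by
  rw [cell, closure_prod_eq, closure_prod_eq, closure_Ioo Real.two_pi_pos.ne,
    closure_Ioo (by norm_num)]
  have := Real.two_pi_pos.le
  exact ⟨left_mem_Icc.2 this, left_mem_Icc.2 this, right_mem_Icc.2 (by norm_num)⟩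

theorem profile_corner {U V W : smoothFns} {m n : ℕ} {κ : Fin 4 → ℝ}
    (h : (profile U V W).toL2 m n κ = 0) :
    (U : ℝ → ℝ) 1 * κ 3 = 0 ∧ (V : ℝ → ℝ) 1 * κ 1 = 0 := by
  have h1 := field_eq_zero_of_toL2 h corner_mem_closure_cell
  have h2 := profile_field_zero_apply U V W m n κ (0, 0, 1)
  have h3 := profile_field_one_apply U V W m n κ (0, 0, 1)
  rw [h1] at h2 h3
  simp only [sep, perU, perV] at h2 h3
  simp only [Pi.zero_apply, PiLp.zero_apply, mul_zero, Real.cos_zero, Real.sin_zero, mul_one,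
    sub_zero, zero_add] at h2 h3
  constructor
  · linarith
  · linarith

theorem exists_constProfile_ne_zero (m n : ℕ) {f : smoothFns} (hf : (f : ℝ → ℝ) 1 ≠ 0) :
    ∃ κ, (constProfile m n f).toL2 m n κ ≠ 0 := by
  refine ⟨fun _ => 1, fun h => ?_⟩
  unfold constProfile at h
  split_ifs at h with h0
  · obtain ⟨h1, -⟩ := profile_corner h
    exact hf (by linarith)
  · obtain ⟨h1, h2⟩ := profile_corner h
    rw [coe_smul, mul_one] at h1 h2
    have hn := (mul_eq_zero.1 h1).resolve_right hf
    have hm := (mul_eq_zero.1 h2).resolve_right hf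
    exact h0 ⟨by exact_mod_cast neg_eq_zero.1 hm, by exact_mod_cast hn⟩

theorem exists_nonconstProfile_ne_zero {m n : ℕ} (hμ : 0 < mu m n) {W : smoothFns}
    (hW : (D W : ℝ → ℝ) 1 ≠ 0) : ∃ κ, (nonconstProfile m n W).toL2 m n κ ≠ 0 := by
  refine ⟨fun _ => 1, fun h => ?_⟩
  obtain ⟨h1, h2⟩ := profile_corner h
  rw [coe_smul, mul_one] at h1 h2
  have hμ2 : mu m n ^ 2 ≠ 0 := by positivity
  have hm := (div_eq_zero_iff.1 ((mul_eq_zero.1 h1).resolve_right hW)).resolve_right hμ2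
  have hn := (div_eq_zero_iff.1 ((mul_eq_zero.1 h2).resolve_right hW)).resolve_right hμ2
  exact mu_pos_iff.1 hμ ⟨by exact_mod_cast hm, by exact_mod_cast hn⟩

/-- The pressure of a nonzero field of the second class is not constant. -/
theorem exists_pd_pressure_ne_zero {p m n : ℕ} (hμ : 0 < mu m n) {k : ℝ} (hk : 0 < k)
    (h1 : (trigFn p k : ℝ → ℝ) 1 ≠ 0) {W : smoothFns} {κ : Fin 4 → ℝ}
    (h : (nonconstProfile m n W).toL2 m n κ ≠ 0) :
    ∃ P ∈ cell, ∃ i, pd i (sep (pressureFn p (mu m n) k) (perW m n κ)) P ≠ 0 := by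
  by_contra! hq
  refine h (toL2_eq_zero_of_field ?_)
  rintro ⟨x, y, z⟩ ⟨hx, hy, hz⟩
  -- for `z ≠ 0` neither the vertical factor of the pressure nor its derivative vanishes
  have hP : (x, y, (1 / 2 : ℝ)) ∈ cell := ⟨hx, hy, by norm_num, by norm_num⟩
  have hc : (k ^ 2 + mu m n ^ 2) * ((trigFn p k : ℝ → ℝ) 1 / (hypFn p (mu m n) : ℝ → ℝ) 1) ≠ 0 :=
    mul_ne_zero (by positivity) (div_ne_zero h1 (hypFn_ne_zero p hμ one_ne_zero))
  have hμ2 : mu m n ^ 2 ≠ 0 := by positivity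
  have hr : (pressureFn p (mu m n) k : ℝ → ℝ) (1 / 2) ≠ 0 := by
    rw [pressureFn, coe_smul]
    exact mul_ne_zero (div_ne_zero hc hμ2) (D_hypFn_ne_zero p hμ (by norm_num))
  have hDr : (D (pressureFn p (mu m n) k) : ℝ → ℝ) (1 / 2) ≠ 0 := by
    rw [pressureFn, map_smul, D_D_hypFn, coe_smul, coe_smul]
    exact mul_ne_zero (div_ne_zero hc hμ2)
      (mul_ne_zero hμ2 (hypFn_ne_zero p hμ (by norm_num)))
  have q0 := hq _ hP 0
  have q1 := hq _ hP 1
  have q2 := hq _ hP 2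
  rw [pd_zero_sep_perW, sep, coe_smul] at q0
  rw [pd_one_sep_perW, sep, coe_smul] at q1
  rw [pd_two_sep_perW, sep] at q2
  have e0 : (m : ℝ) * perU m n κ x y = 0 := by
    refine (mul_eq_zero.1 ?_).resolve_left hr
    linear_combination q0
  have e1 : (n : ℝ) * perV m n κ x y = 0 := by
    refine (mul_eq_zero.1 ?_).resolve_left hr
    linear_combination q1
  have e2 : perW m n κ x y = 0 := (mul_eq_zero.1 q2).resolve_left hDr
  ext i
  fin_cases i
  · change ((m : ℝ) / mu m n ^ 2 * (D W : ℝ → ℝ) z) * perU m n κ x y = 0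
    linear_combination ((D W : ℝ → ℝ) z / mu m n ^ 2) * e0
  · change ((n : ℝ) / mu m n ^ 2 * (D W : ℝ → ℝ) z) * perV m n κ x y = 0
    linear_combination ((D W : ℝ → ℝ) z / mu m n ^ 2) * e1
  · change (W : ℝ → ℝ) z * perW m n κ x y = 0
    rw [e2, mul_zero]

/-- If the gradient of a smooth function vanishes in the sense of distributions, it vanishes. -/
theorem GradZero.pd_eq_zero {q : Pt → ℝ} (hs : IsSmooth q) (h : GradZero q) {P : Pt} (hP : P ∈ cell)
    (i : Fin 3) : pd i q P = 0 := by
  have hc := (hs.pd i).continuous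
  have hi : Integrable (fun P => pd i q P * pd i q P) vol := integrable_vol (hc.mul hc)
  have h0 : ∀ n, ∫ P, cutoff n P.2.2 * (pd i q P * pd i q P) ∂vol = 0 := by
    intro n
    have hφ := (isTest_cutoff n).mul_smooth (hs.pd i)
    have h1 := h i _ hφ
    have h2 := hasWeakPartial_of_smooth hs i _ hφ
    simp only [zero_mul, integral_zero, neg_zero] at h1
    rw [h1] at h2
    refine Eq.trans ?_ (neg_eq_zero.1 h2.symm)
    exact integral_congr_ae (Eventually.of_forall fun P => by ring)
  have h1 := tendsto_integral_cutoff hi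
  simp only [h0] at h1
  have h2 := (integral_eq_zero_iff_of_nonneg (fun P => mul_self_nonneg _) hi).1
    (tendsto_nhds_unique tendsto_const_nhds h1).symm
  have h3 := eqOn_cell_of_ae_eq (hc.mul hc) continuous_zero h2 (subset_closure hP)
  exact mul_self_eq_zero.1 h3

/-! ### Abstract expansions -/

/-- A vector orthogonal to all but finitely many members of a complete orthogonal family is a linear
combination of these. -/
theorem mem_span_of_complete {E ι : Type*} [NormedAddCommGroup E] [InnerProductSpace ℝ E]
    {H : Submodule ℝ E} {e : ι → E} (heH : ∀ i, e i ∈ H)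
    (horth : Pairwise fun i j => inner ℝ (e i) (e j) = 0)
    (hcomplete : ∀ v ∈ H, (∀ i, inner ℝ (e i) v = 0) → v = 0) {s : Set ι} (hs : s.Finite) {u : E}
    (hu : u ∈ H) (h : ∀ i ∉ s, inner ℝ (e i) u = 0) : u ∈ Submodule.span ℝ (e '' s) := by
  have : FiniteDimensional ℝ (Submodule.span ℝ (e '' s)) :=
    FiniteDimensional.span_of_finite ℝ (hs.image e)
  set T := Submodule.span ℝ (e '' s) with hT
  obtain ⟨y, hy, z, hz, rfl⟩ := T.exists_add_mem_mem_orthogonal u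
  have hyH : y ∈ H := by
    refine Submodule.span_le.2 ?_ hy
    rintro _ ⟨i, -, rfl⟩
    exact heH i
  have hz0 : z = 0 := by
    refine hcomplete z ?_ fun i => ?_
    · simpa using H.sub_mem hu hyH
    · by_cases hi : i ∈ s
      · exact hz _ (Submodule.subset_span (mem_image_of_mem e hi))
      · have h1 := h i hi
        have h2 : inner ℝ (e i) y = 0 := by
          have : T ≤ (Submodule.span ℝ {e i})ᗮ := by
            refine Submodule.span_le.2 ?_
            rintro _ ⟨j, hj, rfl⟩
            rw [SetLike.mem_coe, Submodule.mem_orthogonal_singleton_iff_inner_right]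
            exact horth fun hij => hi (hij ▸ hj)
          exact Submodule.mem_orthogonal_singleton_iff_inner_right.1 (this hy)
        rwa [inner_add_right, h2, zero_add] at h1
  rwa [hz0, add_zero]

/-- The nonzero members of a complete orthogonal family, normalized, form a Hilbert basis. -/
theorem exists_hilbertBasis_of_complete {E ι : Type*} [NormedAddCommGroup E]
    [InnerProductSpace ℝ E] {H : Submodule ℝ E} [CompleteSpace H] {e : ι → E} (heH : ∀ i, e i ∈ H)
    (horth : Pairwise fun i j => inner ℝ (e i) (e j) = 0)
    (hcomplete : ∀ v ∈ H, (∀ i, inner ℝ (e i) v = 0) → v = 0) :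
    ∃ b : HilbertBasis {i // e i ≠ 0} ℝ H, ∀ i, (b i : E) = ‖e i.1‖⁻¹ • e i.1 := by
  let w : {i // e i ≠ 0} → H := fun i => ⟨‖e i.1‖⁻¹ • e i.1, H.smul_mem _ (heH i.1)⟩
  have hw : Orthonormal ℝ w := by
    refine ⟨fun i => ?_, fun i j hij => ?_⟩
    · change ‖‖e i.1‖⁻¹ • e i.1‖ = 1
      rw [norm_smul, norm_inv, norm_norm, inv_mul_cancel₀ (norm_ne_zero_iff.2 i.2)]
    · change inner ℝ (‖e i.1‖⁻¹ • e i.1) (‖e j.1‖⁻¹ • e j.1) = 0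
      rw [real_inner_smul_left, real_inner_smul_right, horth fun h => hij (Subtype.ext h), mul_zero,
        mul_zero]
  have hbot : (Submodule.span ℝ (range w))ᗮ = ⊥ := by
    refine (Submodule.eq_bot_iff _).2 fun v hv => Subtype.ext (hcomplete v v.2 fun i => ?_)
    by_cases hi : e i = 0
    · rw [hi, inner_zero_left]
    · have h1 : inner ℝ (w ⟨i, hi⟩) v = 0 := hv _ (Submodule.subset_span (mem_range_self _))
      change inner ℝ (‖e i‖⁻¹ • e i) (v : E) = 0 at h1
      rw [real_inner_smul_left] at h1
      exact (mul_eq_zero.1 h1).resolve_left (inv_ne_zero (norm_ne_zero_iff.2 hi))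
  refine ⟨HilbertBasis.mkOfOrthogonalEqBot hw hbot, fun i => ?_⟩
  rw [HilbertBasis.coe_mkOfOrthogonalEqBot]

theorem isClosed_HP : IsClosed (HP : Set L2) := by
  have h : (HP : Set L2) = ⋂ (φ : Pt → ℝ) (hφ : IsSmooth φ), {v : L2 | inner ℝ
      ((memLp_of_continuous (F := Vec) (f := fun P => WithLp.toLp 2 fun i => pd i φ P)
        ((PiLp.continuous_toLp 2 _).comp (continuous_pi fun i => (hφ.pd i).continuous))).toLp _)
      v = 0} := by
    ext v
    simp only [mem_iInter, mem_ofPred_eq]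
    refine forall_congr' fun φ => forall_congr' fun hφ => ?_
    rw [inner_eq_integral]
    refine Eq.congr (integral_congr_ae ?_) rfl
    filter_upwards [MemLp.coeFn_toLp (memLp_of_continuous (F := Vec)
      (f := fun P => WithLp.toLp 2 fun i => pd i φ P)
      ((PiLp.continuous_toLp 2 _).comp (continuous_pi fun i => (hφ.pd i).continuous)))] with P hP
    rw [hP]
    exact Finset.sum_congr rfl fun i _ => mul_comm _ _
  rw [h]
  exact isClosed_iInter fun φ => isClosed_iInter fun hφ =>
    isClosed_eq (continuous_const.inner continuous_id) continuous_const

instance : CompleteSpace HP := isClosed_HP.completeSpace_coe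

/-! ### Pressures with vanishing gradient -/

theorem integrable_lap (u : L2) (i : Fin 3) {φ : Pt → ℝ} (hφ : IsTest φ) :
    Integrable (fun P => -(u P i * lap φ P)) vol := by
  refine Integrable.neg ?_
  simp only [lap, Finset.mul_sum]
  exact integrable_finsetSum _ fun j _ =>
    integrable_memLp_mul ((Lp.memLp u).eval_piLp i) ((hφ.pd j).pd j).smooth.continuous

theorem isPressure_iff {ℓ : ℝ} {u : L2} {q : Pt → ℝ} : IsPressure ℓ u q ↔ MemLp q 2 vol ∧
    ∀ i φ, IsTest φ → -∫ P, u P i * lap φ P ∂vol - ∫ P, q P * pd i φ P ∂vol =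
      ℓ * ∫ P, u P i * φ P ∂vol := by
  refine and_congr_right fun hq => forall_congr' fun i => forall_congr' fun φ =>
    forall_congr' fun hφ => ?_
  rw [integral_sub (integrable_lap u i hφ)
    (integrable_memLp_mul hq (hφ.pd i).smooth.continuous), integral_neg]

theorem gradZero_iff {q : Pt → ℝ} :
    GradZero q ↔ ∀ i φ, IsTest φ → ∫ P, q P * pd i φ P ∂vol = 0 := by
  simp only [GradZero, HasWeakPartial, zero_mul, integral_zero, neg_zero]

theorem gradZero_zero : GradZero fun _ => 0 := by
  simp only [gradZero_iff, zero_mul, integral_zero, implies_true]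

/-- If one pressure has vanishing gradient, so do all. -/
theorem IsPressure.gradZero {ℓ : ℝ} {u : L2} {q r : Pt → ℝ} (hq : IsPressure ℓ u q)
    (hr : IsPressure ℓ u r) (h : GradZero q) : GradZero r := by
  rw [gradZero_iff] at h ⊢
  intro i φ hφ
  have h1 := (isPressure_iff.1 hq).2 i φ hφ
  have h2 := (isPressure_iff.1 hr).2 i φ hφ
  rw [h i φ hφ] at h1
  linarith

/-- Pointwise solutions with different eigenvalues are orthogonal. -/
theorem IsClassicalSolution.inner_eq_zero {β ℓ ℓ' : ℝ} {U V : Pt → Vec} {q r : Pt → ℝ}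
    (hU : IsClassicalSolution β ℓ U q) (hV : IsClassicalSolution β ℓ' V r) {u v : L2}
    (hu : u =ᵐ[vol] U) (hv : v =ᵐ[vol] V) (hne : ℓ ≠ ℓ') : inner ℝ v u = 0 := by
  by_cases h0 : u = 0
  · rw [h0, inner_zero_right]
  · exact (hU.isEigenfunction hu h0).inner_eq_zero hV hv hne

theorem IsEigenfunction.mem_HP {β ℓ : ℝ} {u : L2} (h : IsEigenfunction β ℓ u) : u ∈ HP := by
  obtain ⟨-, G, top, bot, hVP, -⟩ := h
  exact hVP.mem

/-- By the divergence condition, the inner product with a field of the second class involves only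
the vertical coefficients. -/
theorem inner_nonconstProfile {m n : ℕ} {κ : Fin 4 → ℝ} {v : L2} (hv : v ∈ HP) (W : smoothFns)
    (h : ∀ g, coef v 2 (isSmoothPer_perW m n κ) g = 0) :
    inner ℝ ((nonconstProfile m n W).toL2 m n κ) v = 0 := by
  have h1 := coef_div hv m n κ (D W)
  rw [h, add_zero] at h1
  rw [nonconstProfile, inner_profile, h, map_smul, map_smul, smul_eq_mul, smul_eq_mul]
  linear_combination (1 / mu m n ^ 2) * h1

/-- An eigenfunction that has a pressure with vanishing gradient is orthogonal to the second class:
otherwise, the vertical coefficients of the eigenfunction would be those of a multiple of a field of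
the second class, whose pressure has a vertical derivative that does not vanish. -/
theorem IsEigenfunction.inner_nonconstProfile_eq_zero {β ℓ : ℝ} (hβ : 0 < β) {u : L2}
    (hu : IsEigenfunction β ℓ u) {q : Pt → ℝ} (hq : IsPressure ℓ u q) (hq0 : GradZero q)
    {ks : ℕ → ℝ} {m n : ℕ} (hμ : 0 < mu m n)
    (hks : ∀ p, IsStokesFrequency β (mu m n) p (ks p)) (κ : Fin 4 → ℝ) (p : ℕ) :
    inner ℝ ((nonconstProfile m n (vertFn p (mu m n) (ks p))).toL2 m n κ) u = 0 := by
  have hY : ∀ p, IsClassicalSolution β (mu m n ^ 2 + ks p ^ 2)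
      ((nonconstProfile m n (vertFn p (mu m n) (ks p))).field m n κ)
      (sep (pressureFn p (mu m n) (ks p)) (perW m n κ)) :=
    fun p => isClassicalSolution_nonconstProfile hμ ((hks p).helm_one hβ hμ) κ
  have hYae : ∀ p, (nonconstProfile m n (vertFn p (mu m n) (ks p))).toL2 m n κ =ᵐ[vol]
    (nonconstProfile m n (vertFn p (mu m n) (ks p))).field m n κ := fun p => coeFn_toL2 _ m n κ
  have hinj : StrictMono fun p => mu m n ^ 2 + ks p ^ 2 := by
    refine (eigenvalue_bounds 1 (fun p => ?_) (mu m n)).2.1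
    have := (hks p).1
    push_cast
    convert this using 2
    ring
  by_cases hℓ : ℓ = mu m n ^ 2 + ks p ^ 2
  swap
  · exact hu.inner_eq_zero (hY p) (hYae p) hℓ
  by_cases he : (nonconstProfile m n (vertFn p (mu m n) (ks p))).toL2 m n κ = 0
  · rw [he, inner_zero_left]
  set e := (nonconstProfile m n (vertFn p (mu m n) (ks p))).toL2 m n κ with he_def
  set c : ℝ := inner ℝ e u / inner ℝ e e with hc
  have hee : inner ℝ e e ≠ 0 := inner_self_ne_zero.2 he
  have heH : e ∈ HP := (hY p).mem_HP (hYae p)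
  set A := coef u 2 (isSmoothPer_perW m n κ) with hA
  set B := coef e 2 (isSmoothPer_perW m n κ) with hB
  -- the vertical coefficients of `u - c e` vanish
  have hAB : ∀ g, A g = c * B g := by
    intro g
    have h0 := coef_two_eq_zero_of_orthogonal (κ := κ) hβ hμ hks
      (HP.sub_mem hu.mem_HP (HP.smul_mem c heH)) (fun p' => ?_) g
    · have h1 : coef (u - c • e) 2 (isSmoothPer_perW m n κ) g = A g - c * B g := by
        have i1 := integrable_coef u 2 (isSmoothPer_perW m n κ) g
        have i2 := (integrable_coef e 2 (isSmoothPer_perW m n κ) g).const_mul c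
        rw [coef_apply, hA, hB, coef_apply, coef_apply, ← integral_const_mul, ← integral_sub i1 i2]
        refine integral_congr_ae ?_
        filter_upwards [Lp.coeFn_sub u (c • e), Lp.coeFn_smul c e] with P h1 h2
        rw [h1, Pi.sub_apply, h2, Pi.smul_apply, PiLp.sub_apply, PiLp.smul_apply, smul_eq_mul]
        ring
      linarith
    · rw [inner_sub_right, real_inner_smul_right]
      by_cases hpp : p' = p
      · rw [hpp, ← he_def, hc, div_mul_cancel₀ _ hee, sub_self]
      · have hne : mu m n ^ 2 + ks p ^ 2 ≠ mu m n ^ 2 + ks p' ^ 2 :=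
          fun h => hpp (hinj.injective h).symm
        rw [hu.inner_eq_zero (hY p') (hYae p') (hℓ ▸ hne),
          (hY p).inner_eq_zero (hY p') (hYae p) (hYae p') hne, mul_zero, sub_zero]
  -- hence `c` times the vertical derivative of the pressure vanishes
  have hgrad : c = 0 ∨ hip (perW m n κ) (perW m n κ) = 0 := by
    set r := pressureFn p (mu m n) (ks p) with hr
    have hs := isSmooth_sep (D r) (isSmoothPer_perW m n κ)
    have h0 : ∀ N, c * ∫ P, cutoff N P.2.2 *
        (sep (D r) (perW m n κ) P * sep (D r) (perW m n κ) P) ∂vol = 0 := by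
      intro N
      let χ : smoothFns := ⟨cutoff N, contDiff_cutoff N⟩
      have hφ : IsTest (sep (mulFn χ (D r)) (perW m n κ)) := by
        have := (isTest_cutoff N).mul_smooth hs
        convert this using 1
        funext P
        simp only [sep, coe_mulFn, χ]
        ring
      have h1 := (isPressure_iff.1 hq).2 2 _ hφ
      have h2 := (isPressure_iff.1 ((hY p).isPressure (hYae p))).2 2 _ hφ
      have h3 := hasWeakPartial_of_smooth (hY p).smooth_q 2 _ hφ
      rw [gradZero_iff.1 hq0 2 _ hφ] at h1
      rw [h3, ← hℓ] at h2
      simp only [lap_sep_perW, ← coef_apply _ 2 (isSmoothPer_perW m n κ)] at h1 h2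
      rw [← hA, hAB, hAB] at h1
      rw [← he_def, ← hB, pd_two_sep_perW] at h2
      have h4 : ∫ P, cutoff N P.2.2 *
          (sep (D r) (perW m n κ) P * sep (D r) (perW m n κ) P) ∂vol =
          ∫ P, sep (D r) (perW m n κ) P * sep (mulFn χ (D r)) (perW m n κ) P ∂vol := by
        refine integral_congr_ae (Eventually.of_forall fun P => ?_)
        simp only [sep, coe_mulFn, χ]
        ring
      rw [h4]
      linear_combination c * h2 - h1
    have hi : Integrable (fun P => sep (D r) (perW m n κ) P * sep (D r) (perW m n κ) P) vol :=
      integrable_vol (hs.continuous.mul hs.continuous)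
    have h1 := (tendsto_integral_cutoff hi).const_mul c
    simp only [h0] at h1
    have h2 := tendsto_nhds_unique tendsto_const_nhds h1
    rw [integral_sep_mul_sep _ _ (isSmoothPer_perW m n κ) (isSmoothPer_perW m n κ)] at h2
    rcases mul_eq_zero.1 h2.symm with h3 | h3
    · exact Or.inl h3
    · refine Or.inr ((mul_eq_zero.1 h3).resolve_right (ne_of_gt ?_))
      refine ip_self_pos (z := 1) (by norm_num) ?_
      have hμ2 : mu m n ^ 2 ≠ 0 := by positivity
      have hk := (hks p).pos
      have hh := hypFn_ne_zero p hμ one_ne_zero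
      rw [hr, pressureFn, map_smul, D_D_hypFn, coe_smul, coe_smul]
      exact mul_ne_zero (div_ne_zero (mul_ne_zero (by positivity)
        (div_ne_zero (hks p).trigFn_one hh)) hμ2) (mul_ne_zero hμ2 hh)
  refine inner_nonconstProfile hu.mem_HP _ fun g => ?_
  rw [← hA, hAB]
  rcases hgrad with h | h
  · rw [h, zero_mul]
  · rw [hB, he_def, nonconstProfile, (coef_profile _ _ _ _ _ _ _ _).2.2, h, zero_mul, mul_zero]

/-! ### The family of separated solutions -/

/-- The fields of the first class. -/
def constFields (kr : ℕ → ℝ) (m n p : ℕ) : Profile := constProfile m n (trigFn p (kr p))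

/-- The fields of the second class. -/
def nonconstFields (ks : ℕ → ℕ → ℕ → ℝ) (m n p : ℕ) : Profile :=
  nonconstProfile m n (vertFn p (mu m n) (ks m n p))

/-- The eigenvalues of the first class. -/
def constValue (kr : ℕ → ℝ) (m n p : ℕ) : ℝ := mu m n ^ 2 + kr p ^ 2

/-- The eigenvalues of the second class. -/
def nonconstValue (ks : ℕ → ℕ → ℕ → ℝ) (m n p : ℕ) : ℝ := mu m n ^ 2 + ks m n p ^ 2

/-- The eigenvalues belonging to the members of the family of separated fields. -/
def familyValue (kr : ℕ → ℝ) (ks : ℕ → ℕ → ℕ → ℝ) :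
    (ℕ × ℕ × ℕ × Fin 4) ⊕ {k : ℕ × ℕ × ℕ × Fin 4 // 0 < mu k.1 k.2.1} → ℝ
  | .inl (m, n, p, _) => constValue kr m n p
  | .inr ⟨(m, n, p, _), _⟩ => nonconstValue ks m n p

section family

variable {β : ℝ} {kr : ℕ → ℝ} {ks : ℕ → ℕ → ℕ → ℝ}

theorem constValue_bounds (hkr : ∀ p, IsRobinFrequency β p (kr p)) (m n : ℕ) :
    (∀ p, 0 < constValue kr m n p) ∧ StrictMono (constValue kr m n) ∧
      Tendsto (constValue kr m n) atTop atTop ∧ ∀ p : ℕ, constValue kr m n p ∈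
        Ioo (mu m n ^ 2 + Real.pi ^ 2 / 4 * (p : ℝ) ^ 2)
          (mu m n ^ 2 + Real.pi ^ 2 / 4 * (1 + (p : ℝ)) ^ 2) := by
  have := eigenvalue_bounds 0 (k := kr) (fun p => by simpa using (hkr p).1) (mu m n)
  simp only [Nat.cast_zero, add_zero, add_comm _ (1 : ℝ)] at this
  exact this

theorem nonconstValue_bounds
    (hks : ∀ m n p, 0 < mu m n → IsStokesFrequency β (mu m n) p (ks m n p)) {m n : ℕ}
    (hμ : 0 < mu m n) :
    (∀ p, 0 < nonconstValue ks m n p) ∧ StrictMono (nonconstValue ks m n) ∧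
      Tendsto (nonconstValue ks m n) atTop atTop ∧ ∀ p : ℕ, nonconstValue ks m n p ∈
        Ioo (mu m n ^ 2 + Real.pi ^ 2 / 4 * (1 + (p : ℝ)) ^ 2)
          (mu m n ^ 2 + Real.pi ^ 2 / 4 * (2 + (p : ℝ)) ^ 2) := by
  have h2 : ∀ p : ℕ, (p : ℝ) + 1 + 1 = 2 + p := fun p => by ring
  have := eigenvalue_bounds 1 (k := ks m n) (fun p => by
    rw [Nat.cast_one, h2, add_comm 2]
    exact (hks m n p hμ).1) (mu m n)
  simp only [Nat.cast_one, h2] at this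
  simp only [add_comm _ (1 : ℝ)] at this
  exact this

theorem isClassicalSolution_constFields (hkr : ∀ p, IsRobinFrequency β p (kr p)) (m n p : ℕ)
    (κ : Fin 4 → ℝ) (Q₀ : ℝ) : IsClassicalSolution β (constValue kr m n p)
      ((constFields kr m n p).field m n κ) (fun _ => Q₀) :=
  isClassicalSolution_constProfile (D_D_trigFn p (kr p)) (hkr p).D_one
    (D_trigFn_neg_one (hkr p).D_one) m n κ Q₀

theorem isClassicalSolution_nonconstFields (hβ : 0 < β)
    (hks : ∀ m n p, 0 < mu m n → IsStokesFrequency β (mu m n) p (ks m n p)) {m n : ℕ}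
    (hμ : 0 < mu m n) (p : ℕ) (κ : Fin 4 → ℝ) : IsClassicalSolution β (nonconstValue ks m n p)
      ((nonconstFields ks m n p).field m n κ)
      (sep (pressureFn p (mu m n) (ks m n p)) (perW m n κ)) :=
  isClassicalSolution_nonconstProfile hμ ((hks m n p hμ).helm_one hβ hμ) κ

theorem family_mem_classical (hβ : 0 < β) (hkr : ∀ p, IsRobinFrequency β p (kr p))
    (hks : ∀ m n p, 0 < mu m n → IsStokesFrequency β (mu m n) p (ks m n p))
    (i : (ℕ × ℕ × ℕ × Fin 4) ⊕ {k : ℕ × ℕ × ℕ × Fin 4 // 0 < mu k.1 k.2.1}) :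
    ∃ U q, IsClassicalSolution β (familyValue kr ks i) U q ∧
      family (constFields kr) (nonconstFields ks) i =ᵐ[vol] U := by
  rcases i with ⟨m, n, p, j⟩ | ⟨⟨m, n, p, j⟩, hμ⟩
  · exact ⟨_, _, isClassicalSolution_constFields hkr m n p _ 0, coeFn_toL2 _ m n _⟩
  · exact ⟨_, _, isClassicalSolution_nonconstFields hβ hks hμ p _, coeFn_toL2 _ m n _⟩

theorem family_mem_HP (hβ : 0 < β) (hkr : ∀ p, IsRobinFrequency β p (kr p))
    (hks : ∀ m n p, 0 < mu m n → IsStokesFrequency β (mu m n) p (ks m n p))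
    (i : (ℕ × ℕ × ℕ × Fin 4) ⊕ {k : ℕ × ℕ × ℕ × Fin 4 // 0 < mu k.1 k.2.1}) :
    family (constFields kr) (nonconstFields ks) i ∈ HP := by
  obtain ⟨U, q, h, hU⟩ := family_mem_classical hβ hkr hks i
  exact h.mem_HP hU

/-- The separated fields are pairwise orthogonal: those with different wave numbers or parameters
because their horizontal factors are, those of different classes by the direction of their
horizontal parts, and the others because they belong to different eigenvalues. -/
theorem family_orthogonal (hβ : 0 < β) (hkr : ∀ p, IsRobinFrequency β p (kr p))
    (hks : ∀ m n p, 0 < mu m n → IsStokesFrequency β (mu m n) p (ks m n p)) :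
    Pairwise fun i i' => inner ℝ (family (constFields kr) (nonconstFields ks) i)
      (family (constFields kr) (nonconstFields ks) i') = 0 := by
  have hval : ∀ i i', familyValue kr ks i' ≠ familyValue kr ks i →
      inner ℝ (family (constFields kr) (nonconstFields ks) i)
        (family (constFields kr) (nonconstFields ks) i') = 0 := by
    intro i i' hne
    obtain ⟨U, q, h, hU⟩ := family_mem_classical hβ hkr hks i
    obtain ⟨V, r, h', hV⟩ := family_mem_classical hβ hkr hks i'
    exact h'.inner_eq_zero h hV hU hne
  intro i i' hne
  rcases i with ⟨m, n, p, j⟩ | ⟨⟨m, n, p, j⟩, hμ⟩ <;>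
    rcases i' with ⟨m', n', p', j'⟩ | ⟨⟨m', n', p', j'⟩, hμ'⟩
  · by_cases h : (m, n, j) = (m', n', j')
    · simp only [Prod.mk.injEq] at h
      obtain ⟨rfl, rfl, rfl⟩ := h
      refine hval _ _ fun h => hne ?_
      rw [(constValue_bounds hkr m n).2.1.injective h]
    · obtain ⟨U, V, hUV⟩ := exists_constProfile_eq m n (trigFn p (kr p))
      obtain ⟨U', V', hUV'⟩ := exists_constProfile_eq m' n' (trigFn p' (kr p'))
      simp only [family, constFields, hUV, hUV']
      exact inner_profile_single_eq_zero _ _ _ _ _ _ h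
  · exact inner_constProfile_nonconstProfile hμ' _ _ j j'
  · rw [real_inner_comm]
    exact inner_constProfile_nonconstProfile hμ _ _ j' j
  · by_cases h : (m, n, j) = (m', n', j')
    · simp only [Prod.mk.injEq] at h
      obtain ⟨rfl, rfl, rfl⟩ := h
      refine hval _ _ fun h => hne ?_
      have := (nonconstValue_bounds hks hμ).2.1.injective h
      subst this
      rfl
    · exact inner_profile_single_eq_zero _ _ _ _ _ _ h

theorem family_complete (hβ : 0 < β) (hkr : ∀ p, IsRobinFrequency β p (kr p))
    (hks : ∀ m n p, 0 < mu m n → IsStokesFrequency β (mu m n) p (ks m n p)) (v : L2) (hv : v ∈ HP)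
    (h : ∀ i, inner ℝ (family (constFields kr) (nonconstFields ks) i) v = 0) : v = 0 :=
  eq_zero_of_orthogonal hβ hkr hks hv (fun m n p j => h (.inl (m, n, p, j)))
    fun m n p j hμ => h (.inr ⟨(m, n, p, j), hμ⟩)

theorem finite_familyValue_eq (hkr : ∀ p, IsRobinFrequency β p (kr p))
    (hks : ∀ m n p, 0 < mu m n → IsStokesFrequency β (mu m n) p (ks m n p)) (ℓ : ℝ) :
    {i | familyValue kr ks i = ℓ}.Finite := by
  have hpi : 1 ≤ Real.pi ^ 2 / 4 := by
    have := Real.two_le_pi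
    nlinarith
  have hf := finite_index_of_le ℓ
  refine ((hf.image Sum.inl).union
    ((hf.preimage (f := Subtype.val) Subtype.val_injective.injOn).image Sum.inr)).subset ?_
  rintro (⟨m, n, p, j⟩ | ⟨⟨m, n, p, j⟩, hμ⟩) rfl
  · refine Or.inl (mem_image_of_mem _ ?_)
    have h1 := ((constValue_bounds hkr m n).2.2.2 p).1
    rw [mem_ofPred_eq, familyValue]
    nlinarith [sq_nonneg (p : ℝ)]
  · refine Or.inr (mem_image_of_mem _ ?_)
    have h1 := ((nonconstValue_bounds hks hμ).2.2.2 p).1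
    have hp : (0 : ℝ) ≤ p := Nat.cast_nonneg p
    rw [mem_preimage, mem_ofPred_eq, familyValue]
    nlinarith [sq_nonneg (p : ℝ)]

/-- An eigenfunction is a linear combination of the separated fields with the same eigenvalue to
which it is not orthogonal. -/
theorem IsEigenfunction.mem_span (hβ : 0 < β) (hkr : ∀ p, IsRobinFrequency β p (kr p))
    (hks : ∀ m n p, 0 < mu m n → IsStokesFrequency β (mu m n) p (ks m n p)) {ℓ : ℝ} {u : L2}
    (hu : IsEigenfunction β ℓ u) {T : Set L2}
    (hT : ∀ i, familyValue kr ks i = ℓ →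
      inner ℝ (family (constFields kr) (nonconstFields ks) i) u ≠ 0 →
      family (constFields kr) (nonconstFields ks) i ∈ T) : u ∈ Submodule.span ℝ T := by
  refine Submodule.span_mono ?_ (mem_span_of_complete (family_mem_HP hβ hkr hks)
    (family_orthogonal hβ hkr hks) (family_complete hβ hkr hks) (s := {i | familyValue kr ks i = ℓ ∧
      inner ℝ (family (constFields kr) (nonconstFields ks) i) u ≠ 0})
    ((finite_familyValue_eq hkr hks ℓ).subset fun i hi => hi.1) hu.mem_HP fun i hi => ?_)
  · rintro _ ⟨i, hi, rfl⟩
    exact hT i hi.1 hi.2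
  · by_contra h0
    obtain ⟨U, q, h, hU⟩ := family_mem_classical hβ hkr hks i
    exact h0 (hu.inner_eq_zero h hU fun hℓ => hi ⟨hℓ.symm, h0⟩)

theorem isEigenfunction_or_zero_iff (hβ : 0 < β) (hkr : ∀ p, IsRobinFrequency β p (kr p))
    (hks : ∀ m n p, 0 < mu m n → IsStokesFrequency β (mu m n) p (ks m n p)) (ℓ : ℝ) (u : L2) :
    (IsEigenfunction β ℓ u ∨ u = 0) ↔ u ∈ Submodule.span ℝ
      (fieldsConst (constValue kr) (constFields kr) ℓ ∪
        fieldsNonconst (nonconstValue ks) (nonconstFields ks) ℓ) := by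
  constructor
  · rintro (hu | rfl)
    · refine hu.mem_span hβ hkr hks ?_
      rintro (⟨m, n, p, j⟩ | ⟨⟨m, n, p, j⟩, hμ⟩) hi -
      · exact Or.inl ⟨m, n, p, _, hi, rfl⟩
      · exact Or.inr ⟨m, n, p, _, hμ, hi, rfl⟩
    · exact Submodule.zero_mem _
  · intro hu
    by_cases h0 : u = 0
    · exact Or.inr h0
    have hs : ∀ v ∈ fieldsConst (constValue kr) (constFields kr) ℓ ∪
        fieldsNonconst (nonconstValue ks) (nonconstFields ks) ℓ,
        ∃ U q, IsClassicalSolution β ℓ U q ∧ v =ᵐ[vol] U ∧ True := by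
      rintro v (⟨m, n, p, κ, rfl, rfl⟩ | ⟨m, n, p, κ, hμ, rfl, rfl⟩)
      · exact ⟨_, _, isClassicalSolution_constFields hkr m n p κ 0, coeFn_toL2 _ m n κ, trivial⟩
      · exact ⟨_, _, isClassicalSolution_nonconstFields hβ hks hμ p κ, coeFn_toL2 _ m n κ, trivial⟩
    obtain ⟨U, q, h, hU, -⟩ := exists_classical_of_mem_span (p := fun _ => True)
      trivial (fun _ _ _ _ => trivial) (fun _ _ _ => trivial) hs hu
    exact Or.inl (h.isEigenfunction hU h0)

/-- Linear combinations of fields of the first class solve the problem with zero pressure. -/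
theorem exists_classical_of_mem_span_fieldsConst (hkr : ∀ p, IsRobinFrequency β p (kr p)) {ℓ : ℝ}
    {u : L2} (hu : u ∈ Submodule.span ℝ (fieldsConst (constValue kr) (constFields kr) ℓ)) :
    ∃ U, IsClassicalSolution β ℓ U (fun _ => 0) ∧ u =ᵐ[vol] U := by
  have hs : ∀ v ∈ fieldsConst (constValue kr) (constFields kr) ℓ,
      ∃ U q, IsClassicalSolution β ℓ U q ∧ v =ᵐ[vol] U ∧ q = fun _ => 0 := by
    rintro v ⟨m, n, p, κ, rfl, rfl⟩
    exact ⟨_, _, isClassicalSolution_constFields hkr m n p κ 0, coeFn_toL2 _ m n κ, rfl⟩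
  obtain ⟨U, q, h, hU, rfl⟩ := exists_classical_of_mem_span (p := fun q => q = fun _ => 0) rfl
    (fun q r hq hr => by simp only [hq, hr, add_zero]) (fun c q hq => by simp only [hq, mul_zero])
    hs hu
  exact ⟨U, h, hU⟩

theorem isEigenfunction_gradZero_or_zero_iff (hβ : 0 < β)
    (hkr : ∀ p, IsRobinFrequency β p (kr p))
    (hks : ∀ m n p, 0 < mu m n → IsStokesFrequency β (mu m n) p (ks m n p)) (ℓ : ℝ) (u : L2) :
    ((IsEigenfunction β ℓ u ∧ ∃ q, IsPressure ℓ u q ∧ GradZero q) ∨ u = 0) ↔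
      u ∈ Submodule.span ℝ (fieldsConst (constValue kr) (constFields kr) ℓ) := by
  constructor
  · rintro (⟨hu, q, hq, hq0⟩ | rfl)
    · refine hu.mem_span hβ hkr hks ?_
      rintro (⟨m, n, p, j⟩ | ⟨⟨m, n, p, j⟩, hμ⟩) hi h0
      · exact ⟨m, n, p, _, hi, rfl⟩
      · exact absurd (hu.inner_nonconstProfile_eq_zero hβ hq hq0 hμ (fun p => hks m n p hμ) _ p) h0
    · exact Submodule.zero_mem _
  · intro hu
    by_cases h0 : u = 0
    · exact Or.inr h0
    obtain ⟨U, h, hU⟩ := exists_classical_of_mem_span_fieldsConst hkr hu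
    exact Or.inl ⟨h.isEigenfunction hU h0, _, h.isPressure hU, gradZero_zero⟩

theorem exists_nonconstFields_ne_zero (hβ : 0 < β)
    (hks : ∀ m n p, 0 < mu m n → IsStokesFrequency β (mu m n) p (ks m n p)) {m n : ℕ}
    (hμ : 0 < mu m n) (p : ℕ) : ∃ κ, (nonconstFields ks m n p).toL2 m n κ ≠ 0 :=
  exists_nonconstProfile_ne_zero hμ ((hks m n p hμ).D_vertFn_one_ne_zero hβ hμ)

theorem exists_nonconst_pressure (hβ : 0 < β)
    (hks : ∀ m n p, 0 < mu m n → IsStokesFrequency β (mu m n) p (ks m n p)) {m n : ℕ}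
    (hμ : 0 < mu m n) (p : ℕ) {κ : Fin 4 → ℝ} (h : (nonconstFields ks m n p).toL2 m n κ ≠ 0) :
    ∃ q, IsClassicalSolution β (nonconstValue ks m n p) ((nonconstFields ks m n p).field m n κ) q ∧
      ∃ P ∈ cell, ∃ i, pd i q P ≠ 0 :=
  ⟨_, isClassicalSolution_nonconstFields hβ hks hμ p κ,
    exists_pd_pressure_ne_zero hμ (hks m n p hμ).pos (hks m n p hμ).trigFn_one h⟩

theorem exists_eigenfunction_not_gradZero_iff (hβ : 0 < β)
    (hkr : ∀ p, IsRobinFrequency β p (kr p))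
    (hks : ∀ m n p, 0 < mu m n → IsStokesFrequency β (mu m n) p (ks m n p)) (ℓ : ℝ) :
    (∃ u q, IsEigenfunction β ℓ u ∧ IsPressure ℓ u q ∧ ¬ GradZero q) ↔
      ∃ m n p, 0 < mu m n ∧ nonconstValue ks m n p = ℓ := by
  constructor
  · rintro ⟨u, q, hu, hq, hq0⟩
    by_contra! hno
    have h : u ∈ Submodule.span ℝ (fieldsConst (constValue kr) (constFields kr) ℓ) := by
      refine hu.mem_span hβ hkr hks ?_
      rintro (⟨m, n, p, j⟩ | ⟨⟨m, n, p, j⟩, hμ⟩) hi -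
      · exact ⟨m, n, p, _, hi, rfl⟩
      · exact absurd hi (hno m n p hμ)
    obtain ⟨U, h, hU⟩ := exists_classical_of_mem_span_fieldsConst hkr h
    exact hq0 ((h.isPressure hU).gradZero hq gradZero_zero)
  · rintro ⟨m, n, p, hμ, rfl⟩
    obtain ⟨κ, hκ⟩ := exists_nonconstFields_ne_zero hβ hks hμ p
    obtain ⟨q, h, P, hP, i, hi⟩ := exists_nonconst_pressure hβ hks hμ p hκ
    have hae := coeFn_toL2 (nonconstFields ks m n p) m n κ
    exact ⟨_, q, h.isEigenfunction hae hκ, h.isPressure hae,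
      fun h0 => hi (h0.pd_eq_zero h.smooth_q hP i)⟩

end family

end Stokes

end

open Stokes in
theorem theorem3p1 (β : ℝ) (hβ : 0 < β) :
    ∃ (lam Lam : ℕ → ℕ → ℕ → ℝ) (Z Y : ℕ → ℕ → ℕ → Profile),
      -- the eigenvalues with constant pressure
      (∀ m n : ℕ,
        (∀ p, 0 < lam m n p) ∧ StrictMono (lam m n) ∧ Tendsto (lam m n) atTop atTop ∧
        ∀ p : ℕ,
          lam m n p ∈ Ioo (mu m n ^ 2 + Real.pi ^ 2 / 4 * (p : ℝ) ^ 2)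
            (mu m n ^ 2 + Real.pi ^ 2 / 4 * (1 + (p : ℝ)) ^ 2) ∧
          (Even p → Real.cot (√(lam m n p - mu m n ^ 2)) = √(lam m n p - mu m n ^ 2) / β) ∧
          (Odd p → Real.tan (√(lam m n p - mu m n ^ 2)) = -(√(lam m n p - mu m n ^ 2) / β))) ∧
      -- the eigenvalues with nonconstant pressure
      (∀ m n : ℕ, 0 < mu m n →
        (∀ p, 0 < Lam m n p) ∧ StrictMono (Lam m n) ∧ Tendsto (Lam m n) atTop atTop ∧
        ∀ p : ℕ,
          Lam m n p ∈ Ioo (mu m n ^ 2 + Real.pi ^ 2 / 4 * (1 + (p : ℝ)) ^ 2)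
            (mu m n ^ 2 + Real.pi ^ 2 / 4 * (2 + (p : ℝ)) ^ 2) ∧
          (Even p →
            √(Lam m n p - mu m n ^ 2) * Real.tan (√(Lam m n p - mu m n ^ 2)) =
              -(Lam m n p / β) - mu m n * Real.tanh (mu m n)) ∧
          (Odd p →
            √(Lam m n p - mu m n ^ 2) * Real.cot (√(Lam m n p - mu m n ^ 2)) =
              Lam m n p / β + mu m n * (Real.cosh (mu m n) / Real.sinh (mu m n)))) ∧
      -- the separated fields solve the problem pointwise, with constant pressure ...
      (∀ m n p : ℕ,
        (∃ κ, (Z m n p).toL2 m n κ ≠ 0) ∧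
        ∀ κ (Q₀ : ℝ),
          IsClassicalSolution β (lam m n p) ((Z m n p).field m n κ) (fun _ => Q₀)) ∧
      -- ... and with nonconstant pressure, respectively
      (∀ m n p : ℕ, 0 < mu m n →
        (∃ κ, (Y m n p).toL2 m n κ ≠ 0) ∧
        ∀ κ, (Y m n p).toL2 m n κ ≠ 0 →
          ∃ q, IsClassicalSolution β (Lam m n p) ((Y m n p).field m n κ) q ∧
            ∃ P ∈ cell, ∃ i, pd i q P ≠ 0) ∧
      -- there are no other eigenvalues and eigenfunctions
      (∀ (ℓ : ℝ) (u : L2),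
        ((IsEigenfunction β ℓ u ∧ ∃ q, IsPressure ℓ u q ∧ GradZero q) ∨ u = 0) ↔
          u ∈ Submodule.span ℝ (fieldsConst lam Z ℓ)) ∧
      (∀ ℓ : ℝ,
        (∃ u q, IsEigenfunction β ℓ u ∧ IsPressure ℓ u q ∧ ¬ GradZero q) ↔
          ∃ m n p, 0 < mu m n ∧ Lam m n p = ℓ) ∧
      (∀ (ℓ : ℝ) (u : L2),
        (IsEigenfunction β ℓ u ∨ u = 0) ↔
          u ∈ Submodule.span ℝ (fieldsConst lam Z ℓ ∪ fieldsNonconst Lam Y ℓ)) ∧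
      -- the eigenfunctions form a basis
      (∃ b : HilbertBasis {i // family Z Y i ≠ 0} ℝ HP,
        ∀ i, (b i : L2) = ‖family Z Y i.1‖⁻¹ • family Z Y i.1) := by
  obtain ⟨kr, hkr⟩ : ∃ kr : ℕ → ℝ, ∀ p, IsRobinFrequency β p (kr p) :=
    Classical.axiomOfChoice fun p => by
      obtain ⟨k, h1, h2, h3⟩ := exists_robin_frequency hβ p
      exact ⟨k, h1, h2, h3⟩
  have hex : ∀ m n p, ∃ k, 0 < mu m n → IsStokesFrequency β (mu m n) p k := by
    intro m n p
    by_cases hμ : 0 < mu m n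
    · obtain ⟨k, h1, h2, h3⟩ := exists_stokes_frequency hβ hμ p
      exact ⟨k, fun _ => ⟨h1, h2, h3⟩⟩
    · exact ⟨0, fun h => absurd h hμ⟩
  choose ks hks using hex
  have hsqrt : ∀ {μ k : ℝ}, 0 < k → √(μ ^ 2 + k ^ 2 - μ ^ 2) = k := fun hk => by
    rw [add_sub_cancel_left, Real.sqrt_sq hk.le]
  refine ⟨constValue kr, nonconstValue ks, constFields kr, nonconstFields ks, fun m n => ?_,
    fun m n hμ => ?_, fun m n p => ?_, fun m n p hμ => ?_,
    isEigenfunction_gradZero_or_zero_iff hβ hkr hks,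
    exists_eigenfunction_not_gradZero_iff hβ hkr hks, isEigenfunction_or_zero_iff hβ hkr hks,
    exists_hilbertBasis_of_complete (family_mem_HP hβ hkr hks) (family_orthogonal hβ hkr hks)
      (family_complete hβ hkr hks)⟩
  · obtain ⟨h1, h2, h3, h4⟩ := constValue_bounds hkr m n
    refine ⟨h1, h2, h3, fun p => ⟨h4 p, ?_⟩⟩
    rw [constValue, hsqrt (hkr p).pos]
    exact (hkr p).cot_tan hβ
  · obtain ⟨h1, h2, h3, h4⟩ := nonconstValue_bounds hks hμ
    refine ⟨h1, h2, h3, fun p => ⟨h4 p, ?_⟩⟩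
    rw [nonconstValue, hsqrt (hks m n p hμ).pos]
    exact (hks m n p hμ).tan_cot
  · exact ⟨exists_constProfile_ne_zero m n (hkr p).trigFn_one,
      fun κ Q₀ => isClassicalSolution_constFields hkr m n p κ Q₀⟩
  · exact ⟨exists_nonconstFields_ne_zero hβ hks hμ p,
      fun κ hκ => exists_nonconst_pressure hβ hks hμ p hκ⟩
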